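/- Consider a polling system with $N\ge 2$ queues visited cyclically by a group of infinitely many servers. In each cycle the servers stay at queue $j$ for a random visit time $V_j$ and then need a random switch-over time $D_j$ to move to the next queue. The system starts empty at time $0$ with a polling instant of the first queue. Customers arrive at queue $j$ according to a Poisson process with rate $\lambda_j>0$. A customer of queue $j$ starts service as soon as the servers are present (on arrival if they are already there), independently of the other customers, with service requirement distributed as $B_j$. If the service is not completed before the servers leave, a new requirement with the law of $B_j$ is drawn for the next visit; the customer leaves the system on completing a service. All visit times, switch-over times, interarrival times and service requirements are nonnegative and mutually independent; the visit times of a queue are identically distributed, and so are the switch-over times after a queue and the service requirements at a queue. Let $C=\sum_{j=1}^N (V_j+D_j)$ be the cycle time, fix a queue $i$, and put $C_{/i}=C-V_i$ and $p_i=\mathbb P[B_i\le V_i]$. Assume that all $V_j$ and $D_j$ have finite second moments, that $\mathbb E[V_i]>0$ and $\mathbb E[C_{/i}]>0$, and that $p_i>0$. Let $V_i^{res}$ be independent of $B_i$ with density $x\mapsto\mathbb P[V_i>x]/\mathbb E[V_i]$ on $(0,\infty)$, and let $N_i$ be geometric, $\mathbb P[N_i=n]=(1-p_i)^np_i$ for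 $n\ge 0$. Let $\mathbb E[S_i]$ be the mean sojourn time of a customer at queue $i$ in steady state, that is, the limit as $n\to\infty$ of the expected average of the sojourn times (from arrival to service completion) of the first $n$ customers arriving at queue $i$. Then this limit exists and $$ \begin{aligned} \mathbb E[S_i]={}&\frac{\mathbb E[V_i]}{\mathbb E[C]}\,\mathbb P[B_i\le V_i^{res}]\,\mathbb E[B_i\mid B_i\le V_i^{res}]\\ &+\frac{\mathbb E[V_i]}{\mathbb E[C]}\,\mathbb P[B_i>V_i^{res}]\Big(\mathbb E[V_i^{res}\mid B_i>V_i^{res}]+\mathbb E[N_i+1]\big(\mathbb E[C_{/i}]+\mathbb E[\min(B_i,V_i)]\big)\Big)\\ &+\frac{\mathbb E[C_{/i}]}{\mathbb E[C]}\Big(\frac{\mathbb E[C_{/i}^2]}{2\,\mathbb E[C_{/i}]}+\mathbb E[N_i]\,\mathbb E[C_{/i}]+\mathbb E[N_i+1]\,\mathbb E[\min(B_i,V_i)]\Big), \end{aligned} $$ where $B_i$ and $V_i$ are independent, and where a product of the probability of an event with a conditional expectation given it is read as $0$ if the event has probability $0$. If moreover $B_i$ and $V_i$ are exponentially distributed with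 rates $\mu_i>0$ and $\gamma_i>0$, then $$ \mathbb E[S_i]=\frac{(\gamma_i\mathbb E[C_{/i}]+1)^2}{\gamma_i\mu_i\mathbb E[C]}+\frac{\mathbb E[C_{/i}^2]}{2\,\mathbb E[C]}. $$ -/

import Mathlib

open MeasureTheory ProbabilityTheory Filter Topology
open scoped ENNReal

noncomputable section

namespace Polling

/-- The index set of the primitive random variables of a polling system with `N` queues. -/
inductive Source (N : ℕ) : Type
  /-- length of the visit to queue `j` in cycle `m` -/
  | visit (j : Fin N) (m : ℕ)
  /-- switch-over time after the visit to queue `j` in cycle `m` -/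
  | switch (j : Fin N) (m : ℕ)
  /-- time between the arrivals of customers `k - 1` and `k` at queue `j`
  (for `k = 0`: between time `0` and the first arrival) -/
  | interarrival (j : Fin N) (k : ℕ)
  /-- service requirement drawn for customer `k` of queue `j` at the visit to `j` in cycle `m`
  (it is used only if the customer is present during that visit) -/
  | service (j : Fin N) (k m : ℕ)

/-- A cyclic polling system with `N` queues, random visit times and infinitely many servers,
on the probability space `(Ω, P)`. Queues are visited in the order `0, 1, …, N - 1` in each of the
cycles `m = 0, 1, 2, …`; at time `0` queue `0` is polled and the system is empty. -/
structure System (N : ℕ) (Ω : Type*) [MeasurableSpace Ω] (P : Measure Ω) where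
  /-- the Poisson arrival rates -/
  rate : Fin N → ℝ
  rate_pos : ∀ j, 0 < rate j
  /-- the primitive random variables -/
  prim : Source N → Ω → ℝ
  measurable_prim : ∀ s, Measurable (prim s)
  nonneg_prim : ∀ s, ∀ᵐ ω ∂P, 0 ≤ prim s ω
  /-- all primitive random variables are mutually independent -/
  indep_prim : iIndepFun prim P
  /-- the visit times of a queue are identically distributed -/
  visit_ident : ∀ j m, IdentDistrib (prim (.visit j m)) (prim (.visit j 0)) P P
  /-- the switch-over times after a queue are identically distributed -/
  switch_ident : ∀ j m, IdentDistrib (prim (.switch j m)) (prim (.switch j 0)) P P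
  /-- the service requirements at a queue are identically distributed -/
  service_ident : ∀ j k m, IdentDistrib (prim (.service j k m)) (prim (.service j 0 0)) P P
  /-- customers arrive at queue `j` according to a Poisson process of rate `rate j` -/
  interarrival_law : ∀ j k, P.map (prim (.interarrival j k)) = expMeasure (rate j)

/-- The law of the residual (equilibrium) version of a nonnegative random variable with law `ν`:
`Y^res` has the density `y ↦ ℙ(Y > y) / 𝔼[Y]` on `(0, ∞)`. -/
def residualLaw (ν : Measure ℝ) : Measure ℝ :=
  (volume.restrict (Set.Ioi 0)).withDensity
    fun y => ENNReal.ofReal (ν.real (Set.Ioi y) / ∫ x, x ∂ν)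

/-- The shifted geometric law with success probability `p`: mass `(1 - p) ^ n * p` at `n : ℕ`. -/
def geometricLaw (p : ℝ) : Measure ℕ :=
  Measure.sum fun n : ℕ => ENNReal.ofReal ((1 - p) ^ n * p) • Measure.dirac n

namespace System

variable {N : ℕ} {Ω : Type*} [MeasurableSpace Ω] {P : Measure Ω}

/-- `V_j`, in cycle `m`. -/
def V (S : System N Ω P) (j : Fin N) (m : ℕ) : Ω → ℝ := S.prim (.visit j m)

/-- `D_j`, in cycle `m`. -/
def D (S : System N Ω P) (j : Fin N) (m : ℕ) : Ω → ℝ := S.prim (.switch j m)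

/-- `B_j`, as drawn for customer `k` at the visit in cycle `m`. -/
def B (S : System N Ω P) (j : Fin N) (k m : ℕ) : Ω → ℝ := S.prim (.service j k m)

/-- The cycle time `C = ∑ j, (V_j + D_j)`, in cycle `m`. -/
def C (S : System N Ω P) (m : ℕ) (ω : Ω) : ℝ := ∑ j, (S.V j m ω + S.D j m ω)

/-- The cycle time without the visit to queue `i`, `C - V_i`, in cycle `m`. -/
def Cexcl (S : System N Ω P) (i : Fin N) (m : ℕ) (ω : Ω) : ℝ := S.C m ω - S.V i m ω

/-- The instant at which queue `i` is polled in cycle `m`. -/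
def pollTime (S : System N Ω P) (i : Fin N) (m : ℕ) (ω : Ω) : ℝ :=
  (∑ l ∈ Finset.range m, S.C l ω) + ∑ j ∈ Finset.Iio i, (S.V j m ω + S.D j m ω)

/-- The instant at which the servers leave queue `i` in cycle `m`. -/
def leaveTime (S : System N Ω P) (i : Fin N) (m : ℕ) (ω : Ω) : ℝ :=
  S.pollTime i m ω + S.V i m ω

/-- The arrival time of customer `k = 0, 1, 2, …` of queue `i`. -/
def arrivalTime (S : System N Ω P) (i : Fin N) (k : ℕ) (ω : Ω) : ℝ :=
  ∑ l ∈ Finset.range (k + 1), S.prim (.interarrival i l) ω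

/-- The instant at which customer `k` of queue `i` would complete the service started in the visit
of cycle `m`: service begins at the polling instant, or on arrival if the customer arrives later. -/
def finishTime (S : System N Ω P) (i : Fin N) (k m : ℕ) (ω : Ω) : ℝ :=
  max (S.arrivalTime i k ω) (S.pollTime i m ω) + S.B i k m ω

/-- The service of customer `k` of queue `i` fits into what the customer sees of the visit of
cycle `m`. This fails for the visits that end before the arrival. -/
def FinishesIn (S : System N Ω P) (i : Fin N) (k m : ℕ) (ω : Ω) : Prop :=
  S.arrivalTime i k ω ≤ S.leaveTime i m ω ∧ S.finishTime i k m ω ≤ S.leaveTime i m ω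

open Classical in
/-- The sojourn time of customer `k` of queue `i`: the time from the arrival to the completion of
service in the first visit in which the service can be completed (`∞` if there is none). -/
def sojournTime (S : System N Ω P) (i : Fin N) (k : ℕ) (ω : Ω) : ℝ≥0∞ :=
  if h : ∃ m, S.FinishesIn i k m ω then
    ENNReal.ofReal (S.finishTime i k (Nat.find h) ω - S.arrivalTime i k ω)
  else ∞

/-- `s` is the steady-state mean sojourn time at queue `i`: the expected average sojourn time of the
first `n` customers of that queue tends to `s` as `n → ∞`. -/
def HasMeanSojournTime (S : System N Ω P) (i : Fin N) (s : ℝ) : Prop :=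
  Tendsto (fun n : ℕ => (∑ k ∈ Finset.range n, ∫⁻ ω, S.sojournTime i k ω ∂P) / (n : ℝ≥0∞))
    atTop (𝓝 (ENNReal.ofReal s))

/-- `p_i = ℙ(B_i ≤ V_i)`. -/
def p (S : System N Ω P) (i : Fin N) : ℝ := P.real {ω | S.B i 0 0 ω ≤ S.V i 0 ω}

/-- The joint law of the independent pair `(B_i, V_i^res)`. -/
def serviceResidualLaw (S : System N Ω P) (i : Fin N) : Measure (ℝ × ℝ) :=
  (P.map (S.B i 0 0)).prod (residualLaw (P.map (S.V i 0)))

end System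

end Polling

end

noncomputable section

set_option linter.unusedSectionVars false

/-! ### Renewal epochs and the renewal-reward theorem with explicit error terms. -/

namespace Polling

variable {Ω E : Type*} [MeasurableSpace Ω] [MeasurableSpace E]

/-! Seen from queue `i`, the polling instants cut time into cycles, each with a mark `((V, W), B)`:
the visit time, the time `W` until the servers return (distributed as `C_{/i}`), and the service
requirement a given customer would draw. The mark has a fixed law and is independent of the past and
of all arrivals (`lintegral_past_mark`), so the polling instants are a delayed renewal process
(`isRenewal`). A customer waiting at a polling instant spends `min(B, V)`, plus `W` in case of
failure, until service or the next polling instant, and succeeds with probability `p`. The expected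
remaining time is therefore `κ = (E min(B, V) + (1 - p) E W) / p = E[N + 1] E min(B, V) + E[N] E W`
(`waitingMean`, `waitingMean_eq`). So only the cycle of arrival has to be followed in detail: the
customer pays the time spent in that cycle and, if still present at its end, a further `κ` on
average (`arrivalReward`, `lintegral_sojournTime`). This gives a mean sojourn time `h(t)` as a
function of the arrival time `t` (`meanSojournAt`).

The average over customers becomes an average over time. Since the interarrival times are
exponential, `∑_{k<n} E h(a_k) = λ E ∫_0^{A_n} h`, where `A_n` is the sum of the first `n` of them
(`sum_lintegral_arrivalTime`). The renewal-reward theorem compares `c ∫_0^T h` with `r T`, where `c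
= E C` and `r` is the mean integral of the reward over a cycle (`cycleReward`). It is proved with
errors of the form `ε T + K`, valid for every `T ≥ 0`. Such bounds are affine in `T` and can be
integrated against the law of `A_n`, for which `λ E A_n = n`; no concentration of `A_n` and no
non-lattice condition enters. The limit is `r / c` (`tendsto_average_sojournTime`).

To compute `r`, arrivals in the visit are indexed by the remaining visit time, which yields `E V`
times an expectation over `(B, V^res)`; arrivals outside it contribute `E W² / 2 + κ E W`
(`cycleReward_eq_lintegral`). For exponential laws `V^res` has the law of `V`, and with `β = E
min(B, V)` one has `p = μ β` and `1 - p = γ β`, whence `β = 1 / (μ + γ)`. -/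

/-- A (delayed) renewal process with renewal epochs `τ m` whose `m`-th cycle is described by the
mark `Z m` of law `ν` and has length `x (Z m)`; the mark of a cycle is independent of the epoch at
which the cycle starts. -/
structure IsRenewal (P : Measure Ω) (ν : Measure E) (x : E → ℝ) (τ : ℕ → Ω → ℝ)
    (Z : ℕ → Ω → E) : Prop where
  measurable_length : Measurable x
  measurable_epoch : ∀ m, Measurable (τ m)
  measurable_mark : ∀ m, Measurable (Z m)
  law : ∀ m, P.map (fun ω => (τ m ω, Z m ω)) = (P.map (τ m)).prod ν
  step : ∀ m ω, τ (m + 1) ω = τ m ω + x (Z m ω)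
  zero_nonneg : ∀ᵐ ω ∂P, 0 ≤ τ 0 ω
  length_nonneg : ∀ᵐ z ∂ν, 0 ≤ x z

/-- The expected number of renewal epochs before time `T`. -/
def renewalFunction (P : Measure Ω) (τ : ℕ → Ω → ℝ) (T : ℝ) : ℝ≥0∞ :=
  ∑' m, P {ω | τ m ω < T}

/-- The expected reward collected up to time `T`, if during a cycle with mark `z` a reward is earned
at rate `φ u z` at age `u`. -/
def renewalReward (P : Measure Ω) (ν : Measure E) (τ : ℕ → Ω → ℝ)
    (φ : ℝ → E → ℝ≥0∞) (T : ℝ) : ℝ≥0∞ :=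
  ∑' m, ∫⁻ ω, ∫⁻ z, (∫⁻ t in Set.Ioc 0 T, φ (t - τ m ω) z) ∂ν ∂P

namespace IsRenewal

variable {P : Measure Ω} [IsProbabilityMeasure P] {ν : Measure E} [IsProbabilityMeasure ν]
  {x : E → ℝ} {τ : ℕ → Ω → ℝ} {Z : ℕ → Ω → E}

lemma lintegral_epoch_mark (h : IsRenewal P ν x τ Z) (m : ℕ) {F : ℝ × E → ℝ≥0∞}
    (hF : Measurable F) :
    ∫⁻ ω, F (τ m ω, Z m ω) ∂P = ∫⁻ ω, ∫⁻ z, F (τ m ω, z) ∂ν ∂P := by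
  have h1 := h.measurable_epoch m
  have h2 := h.measurable_mark m
  rw [← lintegral_map (f := F) (g := fun ω => (τ m ω, Z m ω)) hF (h1.prodMk h2), h.law m,
    lintegral_prod _ hF.aemeasurable, lintegral_map hF.lintegral_prod_right' h1]

lemma ae_nonneg (h : IsRenewal P ν x τ Z) : ∀ᵐ ω ∂P, ∀ m, 0 ≤ x (Z m ω) := by
  rw [ae_all_iff]
  intro m
  have h1 : P.map (Z m) = ν := by
    have h2 : P.map (Z m) = (P.map (fun ω => (τ m ω, Z m ω))).snd := by
      rw [Measure.snd_map_prodMk (h.measurable_epoch m)]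
    have := Measure.isProbabilityMeasure_map (μ := P) (h.measurable_epoch m).aemeasurable
    rw [h2, h.law, Measure.snd_prod]
  have h3 := h.length_nonneg
  rw [← h1] at h3
  exact ae_of_ae_map (h.measurable_mark m).aemeasurable h3

lemma ae_epoch_nonneg (h : IsRenewal P ν x τ Z) : ∀ᵐ ω ∂P, ∀ m, 0 ≤ τ m ω := by
  filter_upwards [h.zero_nonneg, h.ae_nonneg] with ω h0 hx m
  induction m with
  | zero => exact h0
  | succ m ih => rw [h.step]; linarith [hx m]

lemma ae_monotone (h : IsRenewal P ν x τ Z) : ∀ᵐ ω ∂P, Monotone fun m => τ m ω := by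
  filter_upwards [h.ae_nonneg] with ω hx
  refine monotone_nat_of_le_succ fun m => ?_
  rw [h.step]; linarith [hx m]

/-- A truncated Wald identity, as a bound. -/
lemma renewalFunction_mul_le (h : IsRenewal P ν x τ Z) {T : ℝ} (hT : 0 ≤ T) :
    renewalFunction P τ T * ∫⁻ z, ENNReal.ofReal (min (x z) 1) ∂ν ≤ ENNReal.ofReal (T + 1) := by
  have hx := h.measurable_length
  have key : ∀ m, P {ω | τ m ω < T} * ∫⁻ z, ENNReal.ofReal (min (x z) 1) ∂ν
      = ∫⁻ ω, {s | s < T}.indicator 1 (τ m ω) * ENNReal.ofReal (min (x (Z m ω)) 1) ∂P := by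
    intro m
    have hτ := h.measurable_epoch m
    rw [h.lintegral_epoch_mark m (F := fun q => {s | s < T}.indicator 1 q.1
      * ENNReal.ofReal (min (x q.2) 1)) (((measurable_one.indicator measurableSet_Iio).comp
        measurable_fst).mul (by fun_prop))]
    simp_rw [lintegral_const_mul (μ := ν) _
      (show Measurable fun z => ENNReal.ofReal (min (x z) 1) by fun_prop)]
    rw [lintegral_mul_const (μ := P) (f := fun ω => {s | s < T}.indicator 1 (τ m ω)) _
      ((measurable_one.indicator measurableSet_Iio).comp hτ)]
    congr 1
    exact (lintegral_indicator_one (hτ measurableSet_Iio)).symm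
  rw [renewalFunction, ← ENNReal.tsum_mul_right]
  simp_rw [key]
  rw [← lintegral_tsum]
  swap
  · intro m
    exact (((measurable_one.indicator measurableSet_Iio).comp (h.measurable_epoch m)).mul
      (by have := h.measurable_mark m; fun_prop)).aemeasurable
  calc _ ≤ ∫⁻ ω, ENNReal.ofReal (T + 1) ∂P := ?_
    _ = _ := by simp
  refine lintegral_mono_ae ?_
  filter_upwards [h.ae_nonneg, h.ae_epoch_nonneg] with ω hx0 hτ0
  rw [ENNReal.tsum_eq_iSup_nat]
  refine iSup_le fun n => ?_
  -- A cycle begun before `T` advances the clock by at least its truncated length, and truncation at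
  -- `1` keeps the clock below `T + 1`; both facts are carried through the induction by the minimum.
  have : ∑ m ∈ Finset.range n, {s | s < T}.indicator (1 : ℝ → ℝ≥0∞) (τ m ω)
      * ENNReal.ofReal (min (x (Z m ω)) 1) ≤ ENNReal.ofReal (min (τ n ω) (T + 1)) := by
    induction n with
    | zero => simp
    | succ n ih =>
      rw [Finset.sum_range_succ]
      have hn := hx0 n
      have hs := h.step n ω
      by_cases hlt : τ n ω < T
      · refine (add_le_add_left ih _).trans ?_
        rw [Set.indicator_of_mem (by exact hlt), Pi.one_apply, one_mul,
          ← ENNReal.ofReal_add (le_min (hτ0 n) (by linarith)) (le_min hn zero_le_one)]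
        refine ENNReal.ofReal_le_ofReal ?_
        rw [min_eq_left (by linarith : τ n ω ≤ T + 1), hs]
        refine le_min ?_ ?_
        · linarith [min_le_left (x (Z n ω)) 1]
        · linarith [min_le_right (x (Z n ω)) 1]
      · rw [Set.indicator_of_notMem (by exact hlt), zero_mul, add_zero]
        refine ih.trans (ENNReal.ofReal_le_ofReal (min_le_min_right _ (by linarith)))
  exact this.trans (ENNReal.ofReal_le_ofReal (min_le_right _ _))

lemma lintegral_min_one_ne_zero (h : IsRenewal P ν x τ Z)
    (hc : ∫⁻ z, ENNReal.ofReal (x z) ∂ν ≠ 0) :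
    ∫⁻ z, ENNReal.ofReal (min (x z) 1) ∂ν ≠ 0 := by
  have hx := h.measurable_length
  contrapose! hc
  rw [lintegral_eq_zero_iff (by fun_prop)] at hc ⊢
  filter_upwards [hc] with z hz
  simp only [Pi.zero_apply, ENNReal.ofReal_eq_zero, min_le_iff] at hz ⊢
  rcases hz with hz | hz
  · exact hz
  · norm_num at hz

lemma renewalFunction_ne_top (h : IsRenewal P ν x τ Z)
    (hc : ∫⁻ z, ENNReal.ofReal (x z) ∂ν ≠ 0) (T : ℝ) : renewalFunction P τ T ≠ ∞ := by
  have h1 : renewalFunction P τ (max T 0) ≠ ∞ := by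
    intro htop
    have h2 := h.renewalFunction_mul_le (le_max_right T 0)
    rw [htop, ENNReal.top_mul (h.lintegral_min_one_ne_zero hc)] at h2
    exact ENNReal.ofReal_ne_top (top_le_iff.mp h2)
  refine ne_top_of_le_ne_top h1 (ENNReal.tsum_le_tsum fun m => measure_mono fun ω hω => ?_)
  exact lt_of_lt_of_le (Set.mem_ofPred.mp hω) (le_max_left _ _)

/-- The renewal function grows at most linearly. -/
lemma exists_renewalFunction_le (h : IsRenewal P ν x τ Z)
    (hc : ∫⁻ z, ENNReal.ofReal (x z) ∂ν ≠ 0) :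
    ∃ A : ℝ≥0∞, A ≠ ∞ ∧ ∀ T, 0 ≤ T → renewalFunction P τ T ≤ A * (ENNReal.ofReal T + 1) := by
  have h0 := h.lintegral_min_one_ne_zero hc
  refine ⟨(∫⁻ z, ENNReal.ofReal (min (x z) 1) ∂ν)⁻¹, ENNReal.inv_ne_top.2 h0, fun T hT => ?_⟩
  have htop : ∫⁻ z, ENNReal.ofReal (min (x z) 1) ∂ν ≠ ∞ := by
    refine ne_top_of_le_ne_top ENNReal.one_ne_top ?_
    calc _ ≤ ∫⁻ _, 1 ∂ν := lintegral_mono fun z => by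
          rw [← ENNReal.ofReal_one]; exact ENNReal.ofReal_le_ofReal (min_le_right _ _)
      _ = 1 := by simp
  rw [mul_comm, ← div_eq_mul_inv, ENNReal.le_div_iff_mul_le (Or.inl h0) (Or.inl htop)]
  refine (h.renewalFunction_mul_le hT).trans (le_of_eq ?_)
  rw [ENNReal.ofReal_add hT zero_le_one, ENNReal.ofReal_one]

/-- Almost surely the renewal epochs are unbounded. -/
lemma ae_exists_le_epoch (h : IsRenewal P ν x τ Z)
    (hc : ∫⁻ z, ENNReal.ofReal (x z) ∂ν ≠ 0) : ∀ᵐ ω ∂P, ∀ T : ℝ, ∃ m, T ≤ τ m ω := by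
  have h1 : ∀ᵐ ω ∂P, ∀ n : ℕ, ∀ᶠ m in atTop, ω ∉ {ω | τ m ω < n} := by
    rw [ae_all_iff]
    exact fun n => ae_eventually_notMem (h.renewalFunction_ne_top hc n)
  filter_upwards [h1] with ω hω T
  obtain ⟨n, hn⟩ := exists_nat_ge T
  obtain ⟨m, hm⟩ := (hω n).exists
  exact ⟨m, hn.trans (not_lt.mp hm)⟩

end IsRenewal

/-- Dominated convergence: a finite integral has small tails. It controls the reward lost in the
cycle that is cut off at time `T`, since that cycle need not be typical. -/
lemma exists_setLIntegral_lt_le (ν : Measure E) {r : E → ℝ≥0∞} (hr : Measurable r)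
    (hfin : ∫⁻ z, r z ∂ν ≠ ∞) {ε : ℝ≥0∞} (hε : ε ≠ 0) :
    ∃ K : ℕ, ∫⁻ z in {z | (K : ℝ≥0∞) < r z}, r z ∂ν ≤ ε := by
  have hm : ∀ n : ℕ, MeasurableSet {z | (n : ℝ≥0∞) < r z} := fun n =>
    measurableSet_lt measurable_const hr
  have hlim : Tendsto (fun n : ℕ => ∫⁻ z, {z | (n : ℝ≥0∞) < r z}.indicator r z ∂ν) atTop
      (𝓝 (∫⁻ _, 0 ∂ν)) := by
    refine tendsto_lintegral_of_dominated_convergence r (fun n => hr.indicator (hm n))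
      (fun n => ae_of_all _ fun z => Set.indicator_le_self _ _ _) hfin ?_
    filter_upwards [ae_lt_top hr hfin] with z hz
    obtain ⟨N, hN⟩ := ENNReal.exists_nat_gt hz.ne
    refine tendsto_const_nhds.congr' ?_
    filter_upwards [eventually_ge_atTop N] with n hn
    rw [Set.indicator_of_notMem]
    have : (N : ℝ≥0∞) ≤ n := by exact_mod_cast hn
    exact not_lt.mpr (hN.le.trans this)
  rw [lintegral_zero] at hlim
  obtain ⟨n, hn⟩ := (hlim.eventually (ge_mem_nhds (pos_iff_ne_zero.mpr hε))).exists
  refine ⟨n, ?_⟩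
  rwa [← lintegral_indicator (hm n)]

lemma tsum_indicator_Ioc_succ {a : ℕ → ℝ} (ha : Monotone a) (hunb : ∀ T, ∃ m, T ≤ a m) (t : ℝ) :
    ∑' m, (Set.Ioc (a m) (a (m + 1))).indicator (1 : ℝ → ℝ≥0∞) t
      = (Set.Ioi (a 0)).indicator 1 t := by
  have hsum : ∀ n, ∑ m ∈ Finset.range n, (Set.Ioc (a m) (a (m + 1))).indicator (1 : ℝ → ℝ≥0∞) t
      = (Set.Ioc (a 0) (a n)).indicator 1 t := by
    intro n
    induction n with
    | zero => simp
    | succ n ih =>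
      have h0 := ha (Nat.zero_le n)
      have h1 := ha (Nat.le_succ n)
      rw [Finset.sum_range_succ, ih, ← Set.Ioc_union_Ioc_eq_Ioc h0 h1,
        Set.indicator_union_of_disjoint]
      exact Set.disjoint_left.mpr fun y hy hy' => absurd hy'.1 (not_lt.mpr hy.2)
  rw [ENNReal.tsum_eq_iSup_nat]
  simp_rw [hsum]
  refine le_antisymm (iSup_le fun n => Set.indicator_le_indicator_of_subset
    Set.Ioc_subset_Ioi_self (fun _ => zero_le) t) ?_
  by_cases ht : t ∈ Set.Ioi (a 0)
  · obtain ⟨m, hm⟩ := hunb t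
    refine le_iSup_of_le m ?_
    rw [Set.indicator_of_mem ht, Set.indicator_of_mem (Set.mem_Ioc.mpr ⟨ht, hm⟩)]
  · rw [Set.indicator_of_notMem ht]; exact zero_le

namespace IsRenewal

variable {P : Measure Ω} [IsProbabilityMeasure P] {ν : Measure E} [IsProbabilityMeasure ν]
  {x : E → ℝ} {τ : ℕ → Ω → ℝ} {Z : ℕ → Ω → E} {φ : ℝ → E → ℝ≥0∞}

lemma lintegral_indicator_mul (h : IsRenewal P ν x τ Z) (m : ℕ) (T : ℝ) (c : ℝ≥0∞) :
    ∫⁻ ω, {s | s < T}.indicator 1 (τ m ω) * c ∂P = P {ω | τ m ω < T} * c := by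
  rw [lintegral_mul_const (μ := P) (f := fun ω => {s | s < T}.indicator 1 (τ m ω)) _
      ((measurable_one.indicator measurableSet_Iio).comp (h.measurable_epoch m))]
  congr 1
  exact lintegral_indicator_one (h.measurable_epoch m measurableSet_Iio)

/-- Only cycles begun before `T` earn anything by time `T`, and each is credited here with its full
reward. -/
lemma renewalReward_le (h : IsRenewal P ν x τ Z)
    (hsupp : ∀ u z, u ∉ Set.Ioc 0 (x z) → φ u z = 0) (T : ℝ) :
    renewalReward P ν τ φ T ≤ renewalFunction P τ T * ∫⁻ z, (∫⁻ u, φ u z) ∂ν := by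
  rw [renewalReward, renewalFunction, ← ENNReal.tsum_mul_right]
  refine ENNReal.tsum_le_tsum fun m => ?_
  rw [← h.lintegral_indicator_mul]
  refine lintegral_mono fun ω => ?_
  by_cases hlt : τ m ω < T
  · rw [Set.indicator_of_mem (by exact hlt), Pi.one_apply, one_mul]
    refine lintegral_mono fun z => (setLIntegral_le_lintegral _ _).trans (le_of_eq ?_)
    exact lintegral_sub_right_eq_self (fun u => φ u z) (τ m ω)
  · refine (le_of_eq ?_).trans (zero_le)
    refine (lintegral_congr fun z => ?_).trans lintegral_zero
    refine (setLIntegral_congr_fun measurableSet_Ioc fun t ht => hsupp _ _ fun h' => ?_).trans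
      lintegral_zero
    linarith [h'.1, ht.2]

lemma measurableSet_straddle (h : IsRenewal P ν x τ Z) (T : ℝ) :
    MeasurableSet {q : ℝ × E | q.1 < T ∧ T < q.1 + x q.2} := by
  have hx := h.measurable_length
  have h1 : MeasurableSet {q : ℝ × E | q.1 < T} := measurableSet_lt (by fun_prop) (by fun_prop)
  have h2 : MeasurableSet {q : ℝ × E | T < q.1 + x q.2} :=
    measurableSet_lt (by fun_prop) (by fun_prop)
  exact h1.inter h2

lemma measurable_indicator_length (h : IsRenewal P ν x τ Z) :
    Measurable fun q : ℝ × E => (Set.Ioc 0 (x q.2)).indicator (1 : ℝ → ℝ≥0∞) q.1 := by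
  have hx := h.measurable_length
  have h1 : MeasurableSet {q : ℝ × E | 0 < q.1} := measurableSet_lt (by fun_prop) (by fun_prop)
  have h2 : MeasurableSet {q : ℝ × E | q.1 ≤ x q.2} :=
    measurableSet_le (by fun_prop) (by fun_prop)
  exact measurable_one.indicator (h1.inter h2)

/-- At most one cycle straddles a given time. -/
lemma tsum_straddle_le (h : IsRenewal P ν x τ Z) (T : ℝ) :
    ∑' m, ∫⁻ ω, ∫⁻ z, {q : ℝ × E | q.1 < T ∧ T < q.1 + x q.2}.indicator (1 : ℝ × E → ℝ≥0∞)
      (τ m ω, z) ∂ν ∂P ≤ 1 := by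
  have hx := h.measurable_length
  have hmeas := h.measurableSet_straddle T
  simp_rw [← fun m => h.lintegral_epoch_mark m (measurable_one.indicator hmeas)]
  rw [← lintegral_tsum (f := fun m ω => {q : ℝ × E | q.1 < T ∧ T < q.1 + x q.2}.indicator 1
    (τ m ω, Z m ω)) fun m => ((measurable_one.indicator hmeas).comp
    ((h.measurable_epoch m).prodMk (h.measurable_mark m))).aemeasurable]
  calc _ ≤ ∫⁻ _, 1 ∂P := ?_
    _ = 1 := by simp
  refine lintegral_mono_ae ?_
  filter_upwards [h.ae_monotone] with ω hmono
  rw [ENNReal.tsum_eq_iSup_nat]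
  refine iSup_le fun n => ?_
  -- The partial sum can be nonzero only once the epochs have passed `T`, and from then on no cycle
  -- starts before `T`.
  have key : ∑ m ∈ Finset.range n, {q : ℝ × E | q.1 < T ∧ T < q.1 + x q.2}.indicator
      (1 : ℝ × E → ℝ≥0∞) (τ m ω, Z m ω) ≤ (Set.Ioi T).indicator 1 (τ n ω) := by
    induction n with
    | zero => simp
    | succ n ih =>
      have h1 := hmono (Nat.le_succ n)
      have h2 := h.step n ω
      simp only [Nat.succ_eq_add_one] at h1
      rw [Finset.sum_range_succ]
      refine (add_le_add_left ih _).trans ?_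
      by_cases c1 : T < τ n ω
      · simp [Set.indicator, c1, c1.trans_le h1, c1.not_gt]
      · simp [Set.indicator, c1]
        split_ifs with c2 c3
        · exact le_rfl
        · exact absurd (h2 ▸ c2.2) c3
        · exact zero_le
        · exact le_rfl
  exact key.trans (Set.indicator_le_self _ _ _)

/-- Crediting full rewards overcounts only in the single cycle straddling `T`. Its reward is either
at most `K`, paid once, or larger than `K`, and then it is charged to the tail integral, once per
cycle begun. -/
lemma renewalFunction_mul_le_reward_add (h : IsRenewal P ν x τ Z)
    (hφ : Measurable fun q : ℝ × E => φ q.1 q.2)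
    (hsupp : ∀ u z, u ∉ Set.Ioc 0 (x z) → φ u z = 0) (T : ℝ) (K : ℝ≥0∞) :
    renewalFunction P τ T * ∫⁻ z, (∫⁻ u, φ u z) ∂ν ≤ renewalReward P ν τ φ T
      + (K + renewalFunction P τ T * ∫⁻ z in {z | K < ∫⁻ u, φ u z}, (∫⁻ u, φ u z) ∂ν) := by
  have hx := h.measurable_length
  have hr : Measurable fun z => ∫⁻ u, φ u z := hφ.lintegral_prod_left'
  have hmeas := h.measurableSet_straddle T
  have hKm : MeasurableSet {z | K < ∫⁻ u, φ u z} := measurableSet_lt measurable_const hr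
  have hone := (measurable_one (α := ℝ≥0∞)).indicator hmeas
  set S1 := {q : ℝ × E | q.1 < T ∧ T < q.1 + x q.2} with hS1
  set SK := {z | K < ∫⁻ u, φ u z} with hSK
  have hi : Measurable fun q : ℝ × E => ∫⁻ t in Set.Ioc 0 T, φ (t - q.1) q.2 := by
    have : Measurable fun q : (ℝ × E) × ℝ => φ (q.2 - q.1.1) q.1.2 :=
      hφ.comp (f := fun q : (ℝ × E) × ℝ => (q.2 - q.1.1, q.1.2)) (by fun_prop)
    exact this.lintegral_prod_right'
  calc renewalFunction P τ T * ∫⁻ z, (∫⁻ u, φ u z) ∂ν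
      = ∑' m, ∫⁻ ω, {s | s < T}.indicator 1 (τ m ω) * ∫⁻ z, (∫⁻ u, φ u z) ∂ν ∂P := by
        rw [renewalFunction, ← ENNReal.tsum_mul_right]
        simp_rw [h.lintegral_indicator_mul]
    _ ≤ ∑' m, ((∫⁻ ω, ∫⁻ z, (∫⁻ t in Set.Ioc 0 T, φ (t - τ m ω) z) ∂ν ∂P)
          + (∫⁻ ω, ∫⁻ z, K * S1.indicator 1 (τ m ω, z) ∂ν ∂P
            + ∫⁻ ω, {s | s < T}.indicator 1 (τ m ω) * ∫⁻ z in SK, (∫⁻ u, φ u z) ∂ν ∂P)) := by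
        refine ENNReal.tsum_le_tsum fun m => ?_
        have hτ := h.measurable_epoch m
        rw [← lintegral_add_left, ← lintegral_add_left]
        rotate_left
        · exact (hi.comp ((hτ.comp measurable_fst).prodMk measurable_snd)).lintegral_prod_right'
        · exact ((hone.const_mul K).comp ((hτ.comp measurable_fst).prodMk
            measurable_snd)).lintegral_prod_right'
        refine lintegral_mono_ae ?_
        filter_upwards [h.ae_epoch_nonneg] with ω hτ0
        by_cases hlt : τ m ω < T
        swap
        · rw [Set.indicator_of_notMem (by exact hlt), zero_mul]; exact zero_le
        rw [Set.indicator_of_mem (by exact hlt), Pi.one_apply, one_mul, one_mul,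
          ← lintegral_indicator hKm, ← lintegral_add_left, ← lintegral_add_left]
        rotate_left
        · exact hi.comp (measurable_const.prodMk measurable_id)
        · exact (hone.const_mul K).comp (measurable_const.prodMk measurable_id)
        refine lintegral_mono fun z => ?_
        by_cases hend : T < τ m ω + x z
        · refine le_add_left ?_
          rw [Set.indicator_of_mem (show (τ m ω, z) ∈ S1 from ⟨hlt, hend⟩), Pi.one_apply, mul_one]
          by_cases hz : z ∈ SK
          · rw [Set.indicator_of_mem hz]; exact le_add_self
          · exact le_add_right (not_lt.mp hz)
        · refine le_add_right ?_
          rw [← lintegral_sub_right_eq_self (fun u => φ u z) (τ m ω),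
            ← lintegral_indicator measurableSet_Ioc]
          refine lintegral_mono fun t => ?_
          by_cases ht : t ∈ Set.Ioc 0 T
          · rw [Set.indicator_of_mem ht]
          · rw [Set.indicator_of_notMem ht, hsupp]
            intro h'
            exact ht ⟨by linarith [h'.1, hτ0 m], by linarith [h'.2]⟩
    _ = renewalReward P ν τ φ T + (K * (∑' m, ∫⁻ ω, ∫⁻ z, S1.indicator 1 (τ m ω, z) ∂ν ∂P)
          + renewalFunction P τ T * ∫⁻ z in SK, (∫⁻ u, φ u z) ∂ν) := by
        rw [ENNReal.tsum_add, ENNReal.tsum_add, ← ENNReal.tsum_mul_left, renewalFunction,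
          ← ENNReal.tsum_mul_right, renewalReward]
        simp_rw [h.lintegral_indicator_mul]
        congr 3
        ext m
        have hτ := h.measurable_epoch m
        rw [← lintegral_const_mul]
        · refine lintegral_congr fun ω => ?_
          rw [lintegral_const_mul]
          exact hone.comp (measurable_const.prodMk measurable_id)
        · exact (hone.comp ((hτ.comp measurable_fst).prodMk measurable_snd)).lintegral_prod_right'
    _ ≤ _ := by
        gcongr
        exact (mul_le_mul_right (h.tsum_straddle_le T) K).trans (mul_one K).le

lemma exists_renewalFunction_mul_le_reward_add (h : IsRenewal P ν x τ Z)
    (hc : ∫⁻ z, ENNReal.ofReal (x z) ∂ν ≠ 0)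
    (hφ : Measurable fun q : ℝ × E => φ q.1 q.2)
    (hsupp : ∀ u z, u ∉ Set.Ioc 0 (x z) → φ u z = 0) (hfin : ∫⁻ z, (∫⁻ u, φ u z) ∂ν ≠ ∞)
    {ε : ℝ≥0∞} (hε : ε ≠ 0) (hε' : ε ≠ ∞) :
    ∃ K : ℝ≥0∞, K ≠ ∞ ∧ ∀ T, 0 ≤ T → renewalFunction P τ T * ∫⁻ z, (∫⁻ u, φ u z) ∂ν
      ≤ renewalReward P ν τ φ T + (ε * ENNReal.ofReal T + K) := by
  obtain ⟨A, hA, hAT⟩ := h.exists_renewalFunction_le hc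
  have hδ : ε / (A + 1) ≠ 0 := (ENNReal.div_pos hε (by simp [hA])).ne'
  obtain ⟨K, hK⟩ := exists_setLIntegral_lt_le ν hφ.lintegral_prod_left' hfin hδ
  have hAε : A * (ε / (A + 1)) ≤ ε := by
    calc A * (ε / (A + 1)) ≤ (A + 1) * (ε / (A + 1)) := by gcongr; exact le_self_add
      _ ≤ ε := ENNReal.mul_div_le
  refine ⟨K + ε, by simp [hε'], fun T hT => ?_⟩
  refine (h.renewalFunction_mul_le_reward_add hφ hsupp T K).trans (add_le_add_right ?_ _)
  calc _ ≤ K + (A * (ENNReal.ofReal T + 1)) * (ε / (A + 1)) := by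
        gcongr
        exact hAT T hT
    _ = K + (A * (ε / (A + 1))) * (ENNReal.ofReal T + 1) := by ring
    _ ≤ K + ε * (ENNReal.ofReal T + 1) := by gcongr
    _ = _ := by ring

/-- With unit reward rate throughout each cycle, the cycles tile the half-line beyond the first
epoch, so the reward is elapsed time. Comparing a general reward with this one eliminates the
renewal function. -/
lemma renewalReward_length (h : IsRenewal P ν x τ Z)
    (hc : ∫⁻ z, ENNReal.ofReal (x z) ∂ν ≠ 0) (T : ℝ) :
    renewalReward P ν τ (fun u z => (Set.Ioc 0 (x z)).indicator 1 u) T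
      = ∫⁻ ω, (∫⁻ t in Set.Ioc 0 T, (Set.Ioi (τ 0 ω)).indicator 1 t) ∂P := by
  have hx := h.measurable_length
  have hm : Measurable fun q : (ℝ × E) × ℝ =>
      (Set.Ioc 0 (x q.1.2)).indicator (1 : ℝ → ℝ≥0∞) (q.2 - q.1.1) :=
    h.measurable_indicator_length.comp (f := fun q : (ℝ × E) × ℝ => (q.2 - q.1.1, q.1.2))
      (by fun_prop)
  rw [renewalReward]
  simp_rw [← fun m => h.lintegral_epoch_mark m (F := fun q : ℝ × E => ∫⁻ t in Set.Ioc 0 T,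
    (Set.Ioc 0 (x q.2)).indicator 1 (t - q.1)) hm.lintegral_prod_right']
  rw [← lintegral_tsum (f := fun m ω => ∫⁻ t in Set.Ioc 0 T,
    (Set.Ioc 0 (x (Z m ω))).indicator 1 (t - τ m ω)) fun m => (hm.lintegral_prod_right'.comp
    ((h.measurable_epoch m).prodMk (h.measurable_mark m))).aemeasurable]
  refine lintegral_congr_ae ?_
  filter_upwards [h.ae_monotone, h.ae_exists_le_epoch hc] with ω hmono hunb
  rw [← lintegral_tsum]
  swap
  · intro m
    exact (hm.comp (measurable_const (a := (τ m ω, Z m ω)) |>.prodMk measurable_id)).aemeasurable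
  refine lintegral_congr fun t => ?_
  rw [← tsum_indicator_Ioc_succ hmono hunb]
  refine tsum_congr fun m => ?_
  have h2 := h.step m ω
  simp only [Set.indicator, Set.mem_Ioc, h2, sub_pos, sub_le_iff_le_add',
    Pi.one_apply]

lemma renewalReward_length_le (h : IsRenewal P ν x τ Z)
    (hc : ∫⁻ z, ENNReal.ofReal (x z) ∂ν ≠ 0) (T : ℝ) :
    renewalReward P ν τ (fun u z => (Set.Ioc 0 (x z)).indicator 1 u) T ≤ ENNReal.ofReal T := by
  rw [h.renewalReward_length hc]
  calc _ ≤ ∫⁻ _, ENNReal.ofReal T ∂P := by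
        refine lintegral_mono fun ω => ?_
        refine (lintegral_mono fun t => Set.indicator_le_self _ _ _).trans (le_of_eq ?_)
        simp
    _ = ENNReal.ofReal T := by simp

lemma le_renewalReward_length_add (h : IsRenewal P ν x τ Z)
    (hc : ∫⁻ z, ENNReal.ofReal (x z) ∂ν ≠ 0) (T : ℝ) :
    ENNReal.ofReal T ≤ renewalReward P ν τ (fun u z => (Set.Ioc 0 (x z)).indicator 1 u) T
      + ∫⁻ ω, ENNReal.ofReal (τ 0 ω) ∂P := by
  have hτ := h.measurable_epoch 0
  rw [h.renewalReward_length hc, ← lintegral_add_right _ (by fun_prop)]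
  calc ENNReal.ofReal T = ∫⁻ _, ENNReal.ofReal T ∂P := by simp
    _ ≤ _ := lintegral_mono_ae ?_
  filter_upwards [h.zero_nonneg] with ω h0
  have h1 : Set.Ioc (τ 0 ω) T ⊆ Set.Ioi (τ 0 ω) ∩ Set.Ioc 0 T :=
    fun t ht => ⟨ht.1, by linarith [ht.1], ht.2⟩
  have h2 := measure_mono (μ := volume) h1
  rw [Real.volume_Ioc] at h2
  rw [lintegral_indicator_one measurableSet_Ioi, Measure.restrict_apply measurableSet_Ioi]
  refine le_trans ?_ (add_le_add_left h2 _)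
  rcases le_total (τ 0 ω) T with h3 | h3
  · rw [← ENNReal.ofReal_add (by linarith) h0, sub_add_cancel]
  · exact le_add_left (ENNReal.ofReal_le_ofReal h3)

/-- Renewal-reward theorem, upper bound. -/
lemma exists_length_mul_renewalReward_le (h : IsRenewal P ν x τ Z)
    (hc : ∫⁻ z, ENNReal.ofReal (x z) ∂ν ≠ 0) (hc' : ∫⁻ z, ENNReal.ofReal (x z) ∂ν ≠ ∞)
    (hsupp : ∀ u z, u ∉ Set.Ioc 0 (x z) → φ u z = 0) (hfin : ∫⁻ z, (∫⁻ u, φ u z) ∂ν ≠ ∞)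
    {ε : ℝ≥0∞} (hε : ε ≠ 0) (hε' : ε ≠ ∞) :
    ∃ K : ℝ≥0∞, K ≠ ∞ ∧ ∀ T, 0 ≤ T → (∫⁻ z, ENNReal.ofReal (x z) ∂ν) * renewalReward P ν τ φ T
      ≤ ((∫⁻ z, (∫⁻ u, φ u z) ∂ν) + ε) * ENNReal.ofReal T + K := by
  have hx := h.measurable_length
  have hm := h.measurable_indicator_length
  have hlen : ∫⁻ z, (∫⁻ u, (Set.Ioc 0 (x z)).indicator 1 u) ∂ν = ∫⁻ z, ENNReal.ofReal (x z) ∂ν := by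
    refine lintegral_congr fun z => ?_
    rw [lintegral_indicator_one measurableSet_Ioc, Real.volume_Ioc, sub_zero]
  set c := ∫⁻ z, ENNReal.ofReal (x z) ∂ν
  set r := ∫⁻ z, (∫⁻ u, φ u z) ∂ν
  -- The added `1` keeps the quotient finite when `r = 0`.
  have hδ : ε / (r + 1) ≠ 0 := (ENNReal.div_pos hε (by simp [hfin])).ne'
  have hδ' : ε / (r + 1) ≠ ∞ := ENNReal.div_ne_top hε' (by simp)
  obtain ⟨K, hK, hKT⟩ := h.exists_renewalFunction_mul_le_reward_add hc hm
    (fun u z hu => Set.indicator_of_notMem hu _) (by rwa [hlen]) hδ hδ'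
  rw [hlen] at hKT
  have hrε : r * (ε / (r + 1)) ≤ ε := by
    calc r * (ε / (r + 1)) ≤ (r + 1) * (ε / (r + 1)) := by gcongr; exact le_self_add
      _ ≤ ε := ENNReal.mul_div_le
  refine ⟨r * K, ENNReal.mul_ne_top hfin hK, fun T hT => ?_⟩
  calc c * renewalReward P ν τ φ T ≤ c * (renewalFunction P τ T * r) := by
        gcongr; exact h.renewalReward_le hsupp T
    _ = r * (renewalFunction P τ T * c) := by ring
    _ ≤ r * (ENNReal.ofReal T + (ε / (r + 1) * ENNReal.ofReal T + K)) := by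
        gcongr
        exact (hKT T hT).trans (add_le_add_left (h.renewalReward_length_le hc T) _)
    _ = r * ENNReal.ofReal T + (r * (ε / (r + 1))) * ENNReal.ofReal T + r * K := by ring
    _ ≤ r * ENNReal.ofReal T + ε * ENNReal.ofReal T + r * K := by gcongr
    _ = _ := by ring

/-- Renewal-reward theorem, lower bound. -/
lemma exists_mul_le_length_mul_renewalReward (h : IsRenewal P ν x τ Z)
    (hc : ∫⁻ z, ENNReal.ofReal (x z) ∂ν ≠ 0) (hc' : ∫⁻ z, ENNReal.ofReal (x z) ∂ν ≠ ∞)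
    (hτ0 : ∫⁻ ω, ENNReal.ofReal (τ 0 ω) ∂P ≠ ∞)
    (hφ : Measurable fun q : ℝ × E => φ q.1 q.2)
    (hsupp : ∀ u z, u ∉ Set.Ioc 0 (x z) → φ u z = 0) (hfin : ∫⁻ z, (∫⁻ u, φ u z) ∂ν ≠ ∞)
    {ε : ℝ≥0∞} (hε : ε ≠ 0) (hε' : ε ≠ ∞) :
    ∃ K : ℝ≥0∞, K ≠ ∞ ∧ ∀ T, 0 ≤ T → (∫⁻ z, (∫⁻ u, φ u z) ∂ν) * ENNReal.ofReal T
      ≤ (∫⁻ z, ENNReal.ofReal (x z) ∂ν) * renewalReward P ν τ φ T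
        + (ε * ENNReal.ofReal T + K) := by
  have hx := h.measurable_length
  have hm := h.measurable_indicator_length
  have hlen : ∫⁻ z, (∫⁻ u, (Set.Ioc 0 (x z)).indicator 1 u) ∂ν = ∫⁻ z, ENNReal.ofReal (x z) ∂ν := by
    refine lintegral_congr fun z => ?_
    rw [lintegral_indicator_one measurableSet_Ioc, Real.volume_Ioc, sub_zero]
  have hle := fun T => h.renewalReward_le
    (φ := fun u z => (Set.Ioc 0 (x z)).indicator 1 u)
    (fun u z hu => Set.indicator_of_notMem hu _) T
  simp_rw [hlen] at hle
  set c := ∫⁻ z, ENNReal.ofReal (x z) ∂ν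
  set r := ∫⁻ z, (∫⁻ u, φ u z) ∂ν
  set b := ∫⁻ ω, ENNReal.ofReal (τ 0 ω) ∂P
  have hδ : ε / c ≠ 0 := (ENNReal.div_pos hε hc').ne'
  have hδ' : ε / c ≠ ∞ := ENNReal.div_ne_top hε' hc
  obtain ⟨K, hK, hKT⟩ := h.exists_renewalFunction_mul_le_reward_add hc hφ hsupp hfin hδ hδ'
  refine ⟨r * b + c * K, by finiteness, fun T hT => ?_⟩
  calc r * ENNReal.ofReal T ≤ r * (renewalFunction P τ T * c + b) := by
        gcongr
        exact (h.le_renewalReward_length_add hc T).trans (add_le_add_left (hle T) _)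
    _ = c * (renewalFunction P τ T * r) + r * b := by ring
    _ ≤ c * (renewalReward P ν τ φ T + (ε / c * ENNReal.ofReal T + K)) + r * b := by
        gcongr
        exact hKT T hT
    _ = c * renewalReward P ν τ φ T + ((c * (ε / c)) * ENNReal.ofReal T + (r * b + c * K)) := by
        ring
    _ ≤ _ := by gcongr; exact ENNReal.mul_div_le

end IsRenewal

/-! ### Independence of the primitives and the renewal structure of the polling instants. -/

namespace System

variable {N : ℕ} {Ω : Type*} [MeasurableSpace Ω] {P : Measure Ω} [IsProbabilityMeasure P]

/-- The `σ`-algebra generated by a set of primitive random variables. -/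
@[reducible] def sigma (S : System N Ω P) (A : Set (Source N)) : MeasurableSpace Ω :=
  ⨆ s ∈ A, MeasurableSpace.comap (S.prim s) inferInstance

lemma measurable_prim_sigma (S : System N Ω P) {A : Set (Source N)} {s : Source N} (hs : s ∈ A) :
    Measurable[S.sigma A] (S.prim s) :=
  measurable_iff_comap_le.mpr
    (le_iSup₂ (f := fun s (_ : s ∈ A) => MeasurableSpace.comap (S.prim s) inferInstance) s hs)

lemma sigma_le (S : System N Ω P) (A : Set (Source N)) : S.sigma A ≤ ‹MeasurableSpace Ω› :=
  iSup₂_le fun s _ => (S.measurable_prim s).comap_le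

/-- The workhorse for every independence claim below: it reduces each of them to disjointness of two
sets of primitive variables. -/
lemma indepFun_of_sigma (S : System N Ω P) {A B : Set (Source N)} (hAB : Disjoint A B)
    {E F : Type*} [MeasurableSpace E] [MeasurableSpace F] {X : Ω → E} {Y : Ω → F}
    (hX : Measurable[S.sigma A] X) (hY : Measurable[S.sigma B] Y) : IndepFun X Y P := by
  have h := indep_iSup_of_disjoint (fun s => (S.measurable_prim s).comap_le) S.indep_prim.iIndep hAB
  rw [IndepFun_iff_Indep]
  exact indep_of_indep_of_le h (measurable_iff_comap_le.mp hX) (measurable_iff_comap_le.mp hY)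

/-- The cycle of the visit to queue `j` that falls into the interval between the polling instants
of queue `i` in the cycles `m` and `m + 1`. -/
def cycleIndex (i j : Fin N) (m : ℕ) : ℕ := if j < i then m + 1 else m

@[simp] lemma cycleIndex_self (i : Fin N) (m : ℕ) : cycleIndex i i m = m := by simp [cycleIndex]

/-- The time between the departure of the servers from queue `i` in cycle `m` and their return. -/
def away (S : System N Ω P) (i : Fin N) (m : ℕ) (ω : Ω) : ℝ :=
  S.pollTime i (m + 1) ω - S.leaveTime i m ω

lemma pollTime_succ_eq_add_sum (S : System N Ω P) (i : Fin N) (m : ℕ) (ω : Ω) :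
    S.pollTime i (m + 1) ω = S.pollTime i m ω
      + ∑ j, (S.V j (cycleIndex i j m) ω + S.D j (cycleIndex i j m) ω) := by
  have h1 := Finset.sum_filter_add_sum_filter_not Finset.univ (fun j => j < i)
    (fun j => S.V j m ω + S.D j m ω)
  have h2 := Finset.sum_filter_add_sum_filter_not Finset.univ (fun j => j < i)
    (fun j => S.V j (cycleIndex i j m) ω + S.D j (cycleIndex i j m) ω)
  have h3 : ∑ j with j < i, (S.V j (cycleIndex i j m) ω + S.D j (cycleIndex i j m) ω)
      = ∑ j with j < i, (S.V j (m + 1) ω + S.D j (m + 1) ω) :=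
    Finset.sum_congr rfl fun j hj => by
      simp only [cycleIndex, if_pos (Finset.mem_filter.mp hj).2]
  have h4 : ∑ j with ¬ j < i, (S.V j (cycleIndex i j m) ω + S.D j (cycleIndex i j m) ω)
      = ∑ j with ¬ j < i, (S.V j m ω + S.D j m ω) :=
    Finset.sum_congr rfl fun j hj => by
      simp only [cycleIndex, if_neg (Finset.mem_filter.mp hj).2]
  have h5 : (Finset.Iio i : Finset (Fin N)) = Finset.univ.filter (· < i) := by ext; simp
  rw [pollTime, pollTime, Finset.sum_range_succ, C, ← h1, ← h2, h3, h4, h5]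
  ring

lemma away_eq (S : System N Ω P) (i : Fin N) (m : ℕ) (ω : Ω) :
    S.away i m ω = ∑ j, (S.V j (cycleIndex i j m) ω + S.D j (cycleIndex i j m) ω)
      - S.V i m ω := by
  rw [away, leaveTime, pollTime_succ_eq_add_sum]; ring

lemma pollTime_succ (S : System N Ω P) (i : Fin N) (m : ℕ) (ω : Ω) :
    S.pollTime i (m + 1) ω = S.pollTime i m ω + (S.V i m ω + S.away i m ω) := by
  rw [away, leaveTime]; ring

/-- The primitive random variables that are known at the polling instant of queue `i` in cycle `m`,
as far as customer `k` of that queue is concerned, together with all interarrival times. -/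
def pastSources (i : Fin N) (k m : ℕ) : Set (Source N) :=
  {s | match s with
    | .visit j l => l < cycleIndex i j m
    | .switch j l => l < cycleIndex i j m
    -- No mark involves an interarrival time, so all of them can be counted as past; arrival times
    -- are then known from the outset.
    | .interarrival _ _ => True
    | .service j k' l => j = i ∧ k' = k ∧ l < m}

/-- The visit and switch-over times between the polling instants of queue `i` in the cycles `m`
and `m + 1`, except for the visit to queue `i`. -/
def awaySources (i : Fin N) (m : ℕ) : Set (Source N) :=
  {s | match s with
    | .visit j l => j ≠ i ∧ l = cycleIndex i j m
    | .switch j l => l = cycleIndex i j m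
    | _ => False}

lemma lt_cycleIndex_of_lt {i j : Fin N} {l m : ℕ} (h : l < m) : l < cycleIndex i j m := by
  unfold cycleIndex; split_ifs <;> omega

lemma measurable_pollTime_sigma_of_mem (S : System N Ω P) {A : Set (Source N)} (i : Fin N) (m : ℕ)
    (hV : ∀ j, ∀ l < cycleIndex i j m, .visit j l ∈ A)
    (hD : ∀ j, ∀ l < cycleIndex i j m, .switch j l ∈ A) :
    Measurable[S.sigma A] (S.pollTime i m) := by
  refine Measurable.add ?_ ?_
  · refine Finset.measurable_fun_sum _ fun l hl => Finset.measurable_fun_sum _ fun j _ => ?_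
    exact (S.measurable_prim_sigma (hV j l (lt_cycleIndex_of_lt (Finset.mem_range.mp hl)))).add
      (S.measurable_prim_sigma (hD j l (lt_cycleIndex_of_lt (Finset.mem_range.mp hl))))
  · refine Finset.measurable_fun_sum _ fun j hj => ?_
    have hj' : m < cycleIndex i j m := by
      rw [cycleIndex, if_pos (Finset.mem_Iio.mp hj)]; omega
    exact (S.measurable_prim_sigma (hV j m hj')).add (S.measurable_prim_sigma (hD j m hj'))

lemma measurable_pollTime_sigma (S : System N Ω P) (i : Fin N) (k m : ℕ) :
    Measurable[S.sigma (pastSources i k m)] (S.pollTime i m) :=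
  S.measurable_pollTime_sigma_of_mem i m (fun _ _ h => h) (fun _ _ h => h)

lemma pastSources_mono (i : Fin N) (k : ℕ) {l m : ℕ} (h : l ≤ m) :
    pastSources i k l ⊆ pastSources i k m := by
  have hc : ∀ j, cycleIndex i j l ≤ cycleIndex i j m := fun j => by
    unfold cycleIndex; split_ifs <;> omega
  rintro (⟨j, q⟩ | ⟨j, q⟩ | ⟨j, q⟩ | ⟨j, k', q⟩) hs
  · exact lt_of_lt_of_le hs (hc j)
  · exact lt_of_lt_of_le hs (hc j)
  · trivial
  · exact ⟨hs.1, hs.2.1, lt_of_lt_of_le hs.2.2 h⟩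

lemma sigma_mono (S : System N Ω P) {A B : Set (Source N)} (h : A ⊆ B) : S.sigma A ≤ S.sigma B :=
  biSup_mono h

lemma measurable_leaveTime_sigma (S : System N Ω P) (i : Fin N) (k : ℕ) {l m : ℕ} (h : l < m) :
    Measurable[S.sigma (pastSources i k m)] (S.leaveTime i l) := by
  refine Measurable.add ?_ (S.measurable_prim_sigma (lt_cycleIndex_of_lt h))
  exact (S.measurable_pollTime_sigma i k l).mono (S.sigma_mono (pastSources_mono i k h.le)) le_rfl

lemma measurable_arrivalTime_sigma (S : System N Ω P) (i : Fin N) (k m : ℕ) :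
    Measurable[S.sigma (pastSources i k m)] (S.arrivalTime i k) :=
  Finset.measurable_fun_sum _ fun l _ => S.measurable_prim_sigma (by trivial)

lemma measurable_pollTime (S : System N Ω P) (i : Fin N) (m : ℕ) : Measurable (S.pollTime i m) :=
  (S.measurable_pollTime_sigma i 0 m).mono (S.sigma_le _) le_rfl

lemma measurable_arrivalTime (S : System N Ω P) (i : Fin N) (k : ℕ) :
    Measurable (S.arrivalTime i k) :=
  (S.measurable_arrivalTime_sigma i k 0).mono (S.sigma_le _) le_rfl

lemma measurable_away_sigma (S : System N Ω P) (i : Fin N) (m : ℕ) :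
    Measurable[S.sigma (awaySources i m)] (S.away i m) := by
  have h : S.away i m = fun ω => S.D i m ω + ∑ j ∈ Finset.univ.erase i,
      (S.V j (cycleIndex i j m) ω + S.D j (cycleIndex i j m) ω) := by
    ext ω
    rw [away_eq, ← Finset.add_sum_erase _ _ (Finset.mem_univ i), cycleIndex_self]
    ring
  rw [h]
  refine Measurable.add (S.measurable_prim_sigma (by simp [awaySources]))
    (Finset.measurable_fun_sum _ fun j hj => ?_)
  exact Measurable.add (S.measurable_prim_sigma ⟨Finset.ne_of_mem_erase hj, rfl⟩)
    (S.measurable_prim_sigma (by simp [awaySources]))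

/-- What happens to queue `i` between the polling instants in the cycles `m` and `m + 1`, from the
point of view of customer `k`: visit time, time until the return of the servers, and service
requirement. -/
def mark (S : System N Ω P) (i : Fin N) (k m : ℕ) (ω : Ω) : (ℝ × ℝ) × ℝ :=
  ((S.V i m ω, S.away i m ω), S.B i k m ω)

/-- The joint law of `((V_i, C_{/i}), B_i)`. -/
def markLaw (S : System N Ω P) (i : Fin N) : Measure ((ℝ × ℝ) × ℝ) :=
  ((P.map (S.V i 0)).prod (P.map (S.Cexcl i 0))).prod (P.map (S.B i 0 0))

/-- Between two polls of queue `i`, queues before `i` belong to the next cycle. Independence and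
identical laws make the joint law insensitive to this shift, so the time away is distributed as
`C_{/i}`. -/
lemma identDistrib_visit_away (S : System N Ω P) (i : Fin N) (m : ℕ) :
    IdentDistrib (fun ω => (S.V i m ω, S.away i m ω)) (fun ω => (S.V i 0 ω, S.Cexcl i 0 ω))
      P P := by
  let src : (Fin N → ℕ) → Fin N × Bool → Source N := fun c q =>
    if q.2 then .visit q.1 (c q.1) else .switch q.1 (c q.1)
  have hinj : ∀ c, Function.Injective (src c) := by
    rintro c ⟨j, b⟩ ⟨j', b'⟩ h
    cases b <;> cases b' <;> simp_all [src]
  have hid : IdentDistrib (fun ω q => S.prim (src (fun j => cycleIndex i j m) q) ω)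
      (fun ω q => S.prim (src (fun _ => 0) q) ω) P P := by
    refine IdentDistrib.pi (fun q => ?_) (S.indep_prim.precomp (hinj fun j => cycleIndex i j m))
      (S.indep_prim.precomp (hinj fun _ => 0))
    rcases q with ⟨j, b⟩
    cases b
    · exact S.switch_ident j _
    · exact S.visit_ident j _
  have hG : Measurable fun u : Fin N × Bool → ℝ =>
      (u (i, true), ∑ j, (u (j, true) + u (j, false)) - u (i, true)) := by fun_prop
  convert hid.comp hG using 1
  · ext ω
    · simp [src, V]
    · simp [src, away_eq, V, D]
  · ext ω
    · simp [src, V]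
    · simp [src, Cexcl, C, V, D]

lemma measurable_V (S : System N Ω P) (i : Fin N) (m : ℕ) : Measurable (S.V i m) :=
  S.measurable_prim _

lemma measurable_D (S : System N Ω P) (i : Fin N) (m : ℕ) : Measurable (S.D i m) :=
  S.measurable_prim _

lemma measurable_B (S : System N Ω P) (i : Fin N) (k m : ℕ) : Measurable (S.B i k m) :=
  S.measurable_prim _

lemma measurable_away (S : System N Ω P) (i : Fin N) (m : ℕ) : Measurable (S.away i m) :=
  (S.measurable_away_sigma i m).mono (S.sigma_le _) le_rfl

lemma measurable_C (S : System N Ω P) (m : ℕ) : Measurable (S.C m) :=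
  Finset.measurable_fun_sum _ fun j _ => (S.measurable_V j m).add (S.measurable_D j m)

lemma measurable_Cexcl (S : System N Ω P) (i : Fin N) (m : ℕ) : Measurable (S.Cexcl i m) :=
  (S.measurable_C m).sub (S.measurable_V i m)

lemma measurable_mark (S : System N Ω P) (i : Fin N) (k m : ℕ) : Measurable (S.mark i k m) :=
  ((S.measurable_V i m).prodMk (S.measurable_away i m)).prodMk (S.measurable_B i k m)

instance isProbabilityMeasure_markLaw (S : System N Ω P) (i : Fin N) :
    IsProbabilityMeasure (S.markLaw i) := by
  have h1 := Measure.isProbabilityMeasure_map (μ := P) (S.measurable_V i 0).aemeasurable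
  have h2 := Measure.isProbabilityMeasure_map (μ := P) (S.measurable_Cexcl i 0).aemeasurable
  have h3 := Measure.isProbabilityMeasure_map (μ := P) (S.measurable_B i 0 0).aemeasurable
  unfold markLaw
  infer_instance

lemma map_away (S : System N Ω P) (i : Fin N) (m : ℕ) :
    P.map (S.away i m) = P.map (S.Cexcl i 0) :=
  ((S.identDistrib_visit_away i m).comp measurable_snd).map_eq

lemma map_mark (S : System N Ω P) (i : Fin N) (k m : ℕ) :
    P.map (S.mark i k m) = S.markLaw i := by
  have hB := S.measurable_prim_sigma (A := {.service i k m}) rfl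
  have hV := S.measurable_prim_sigma (A := {.visit i m}) rfl
  have hW := S.measurable_away_sigma i m
  have hd1 : Disjoint ({.visit i m} : Set (Source N)) (awaySources i m) := by
    simp [awaySources]
  have hd2 : Disjoint ({.visit i m} ∪ awaySources i m) ({.service i k m} : Set (Source N)) := by
    simp [awaySources]
  have h1 : IndepFun (S.V i m) (S.away i m) P := S.indepFun_of_sigma hd1 hV hW
  have h2 : IndepFun (fun ω => (S.V i m ω, S.away i m ω)) (S.B i k m) P :=
    S.indepFun_of_sigma hd2 (Measurable.prodMk (hV.mono (S.sigma_mono Set.subset_union_left) le_rfl)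
      (hW.mono (S.sigma_mono Set.subset_union_right) le_rfl)) hB
  have hV' := S.measurable_V i m
  have hW' := S.measurable_away i m
  have hB' := S.measurable_B i k m
  unfold mark
  rw [h2.map_prod_eq_prod_map_map (by fun_prop) (by fun_prop),
    h1.map_prod_eq_prod_map_map (by fun_prop) (by fun_prop), markLaw, S.map_away]
  have e1 : P.map (S.V i m) = P.map (S.V i 0) := (S.visit_ident i m).map_eq
  have e2 : P.map (S.B i k m) = P.map (S.B i 0 0) := (S.service_ident i k m).map_eq
  rw [e1, e2]

/-- What happens from the polling instant in cycle `m` until the next one is independent of the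
past. -/
lemma lintegral_past_mark (S : System N Ω P) (i : Fin N) (k m : ℕ) {F : Type*} [MeasurableSpace F]
    {X : Ω → F} (hX : Measurable[S.sigma (pastSources i k m)] X) {f : F × ((ℝ × ℝ) × ℝ) → ℝ≥0∞}
    (hf : Measurable f) :
    ∫⁻ ω, f (X ω, S.mark i k m ω) ∂P = ∫⁻ ω, ∫⁻ z, f (X ω, z) ∂(S.markLaw i) ∂P := by
  have hX' : Measurable X := hX.mono (S.sigma_le _) le_rfl
  have hmark : Measurable[S.sigma (({.visit i m} ∪ awaySources i m) ∪ {.service i k m})]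
      (S.mark i k m) := by
    refine Measurable.prodMk (Measurable.prodMk ?_ ?_) ?_
    · exact S.measurable_prim_sigma (by simp)
    · refine (S.measurable_away_sigma i m).mono (S.sigma_mono ?_) le_rfl
      exact Set.subset_union_right.trans Set.subset_union_left
    · exact S.measurable_prim_sigma (by simp)
  -- The strict inequalities defining the past are exactly what excludes the variables of the
  -- current mark.
  have hd : Disjoint (pastSources i k m)
      (({.visit i m} ∪ awaySources i m) ∪ {.service i k m} : Set (Source N)) := by
    rw [Set.disjoint_left]
    rintro (⟨j, q⟩ | ⟨j, q⟩ | ⟨j, q⟩ | ⟨j, k', q⟩) hs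
    · simp only [pastSources, Set.mem_ofPred_eq] at hs
      simp only [awaySources, Set.mem_union, Set.mem_singleton_iff, Source.visit.injEq,
        Set.mem_ofPred_eq, reduceCtorEq, or_false]
      rintro (⟨rfl, rfl⟩ | ⟨-, h⟩)
      · simp at hs
      · omega
    · simp only [pastSources, Set.mem_ofPred_eq] at hs
      simp [awaySources]
      omega
    · simp [awaySources]
    · simp only [pastSources, Set.mem_ofPred_eq] at hs
      simp [awaySources]
      omega
  have hind := S.indepFun_of_sigma hd hX hmark
  have hmark' := S.measurable_mark i k m
  rw [← lintegral_map (f := f) (g := fun ω => (X ω, S.mark i k m ω)) hf (hX'.prodMk hmark'),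
    hind.map_prod_eq_prod_map_map hX'.aemeasurable hmark'.aemeasurable, S.map_mark,
    lintegral_prod _ hf.aemeasurable, lintegral_map hf.lintegral_prod_right' hX']

lemma ae_nonneg (S : System N Ω P) : ∀ᵐ ω ∂P, (∀ j m, 0 ≤ S.V j m ω) ∧ (∀ j m, 0 ≤ S.D j m ω) ∧
    (∀ j k m, 0 ≤ S.B j k m ω) ∧ ∀ j k, 0 ≤ S.prim (.interarrival j k) ω := by
  refine Filter.Eventually.and ?_ (Filter.Eventually.and ?_ (Filter.Eventually.and ?_ ?_))
  all_goals simp only [ae_all_iff]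
  · exact fun j m => S.nonneg_prim _
  · exact fun j m => S.nonneg_prim _
  · exact fun j k m => S.nonneg_prim _
  · exact fun j k => S.nonneg_prim _

lemma ae_away_nonneg (S : System N Ω P) (i : Fin N) : ∀ᵐ ω ∂P, ∀ m, 0 ≤ S.away i m ω := by
  filter_upwards [S.ae_nonneg] with ω hω m
  rw [away_eq, sub_nonneg]
  have h := Finset.single_le_sum (f := fun j => S.V j (cycleIndex i j m) ω
    + S.D j (cycleIndex i j m) ω) (fun j _ => add_nonneg (hω.1 _ _) (hω.2.1 _ _))
    (Finset.mem_univ i)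
  simp only [cycleIndex_self] at h
  linarith [hω.2.1 i m]

lemma ae_markLaw_nonneg (S : System N Ω P) (i : Fin N) :
    ∀ᵐ z ∂(S.markLaw i), 0 ≤ z.1.1 ∧ 0 ≤ z.1.2 ∧ 0 ≤ z.2 := by
  have hm : MeasurableSet {z : (ℝ × ℝ) × ℝ | 0 ≤ z.1.1 ∧ 0 ≤ z.1.2 ∧ 0 ≤ z.2} := by
    measurability
  rw [← S.map_mark i 0 0, ae_map_iff (S.measurable_mark i 0 0).aemeasurable hm]
  filter_upwards [S.ae_nonneg, S.ae_away_nonneg i] with ω hω hω'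
  exact ⟨hω.1 _ _, hω' _, hω.2.2.1 _ _ _⟩

/-- The polling instants of queue `i` form a renewal process. -/
lemma isRenewal (S : System N Ω P) (i : Fin N) (k : ℕ) :
    IsRenewal P (S.markLaw i) (fun z => z.1.1 + z.1.2) (S.pollTime i) (S.mark i k) where
  measurable_length := by fun_prop
  measurable_epoch := S.measurable_pollTime i
  measurable_mark := S.measurable_mark i k
  law m := by
    refine Measure.ext_of_lintegral _ fun f hf => ?_
    rw [lintegral_map hf ((S.measurable_pollTime i m).prodMk (S.measurable_mark i k m)),
      S.lintegral_past_mark i k m (S.measurable_pollTime_sigma i k m) hf,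
      lintegral_prod _ hf.aemeasurable,
      lintegral_map hf.lintegral_prod_right' (S.measurable_pollTime i m)]
  step m ω := S.pollTime_succ i m ω
  zero_nonneg := by
    filter_upwards [S.ae_nonneg] with ω hω
    simp only [pollTime, Finset.range_zero, Finset.sum_empty, zero_add]
    exact Finset.sum_nonneg fun j _ => add_nonneg (hω.1 _ _) (hω.2.1 _ _)
  length_nonneg := by
    filter_upwards [S.ae_markLaw_nonneg i] with z hz
    exact add_nonneg hz.1 hz.2.1

/-! ### Pathwise evolution of one customer, cycle by cycle. -/

/-- Customer `k` of queue `i` is waiting at the polling instant of cycle `m`. -/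
def Waiting (S : System N Ω P) (i : Fin N) (k m : ℕ) (ω : Ω) : Prop :=
  S.arrivalTime i k ω ≤ S.pollTime i m ω ∧ ∀ l < m, ¬ S.FinishesIn i k l ω

/-- Customer `k` of queue `i` arrives between the polling instants of the cycles `m` and `m + 1`. -/
def ArrivesIn (S : System N Ω P) (i : Fin N) (k m : ℕ) (ω : Ω) : Prop :=
  S.pollTime i m ω < S.arrivalTime i k ω ∧ S.arrivalTime i k ω ≤ S.pollTime i (m + 1) ω

open Classical in
/-- The time that a customer who is waiting at a polling instant spends in the system until the next
polling instant. -/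
def waitingReward (z : (ℝ × ℝ) × ℝ) : ℝ≥0∞ :=
  if z.2 ≤ z.1.1 then ENNReal.ofReal z.2 else ENNReal.ofReal (z.1.1 + z.1.2)

open Classical in
/-- The time that a customer who arrives at time `u` after a polling instant spends in the system
until the next polling instant, plus `κ` if the customer is then still present. -/
def arrivalReward (κ : ℝ≥0∞) (u : ℝ) (z : (ℝ × ℝ) × ℝ) : ℝ≥0∞ :=
  if u ∈ Set.Ioc 0 (z.1.1 + z.1.2) then
    if u + z.2 ≤ z.1.1 then ENNReal.ofReal z.2 else ENNReal.ofReal (z.1.1 + z.1.2 - u) + κ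
  else 0

lemma measurable_waitingReward : Measurable waitingReward :=
  Measurable.ite (measurableSet_le (by fun_prop) (by fun_prop)) (by fun_prop) (by fun_prop)

lemma measurable_arrivalReward (κ : ℝ≥0∞) :
    Measurable fun q : ℝ × ((ℝ × ℝ) × ℝ) => arrivalReward κ q.1 q.2 := by
  have h1 : MeasurableSet {q : ℝ × ((ℝ × ℝ) × ℝ) | 0 < q.1} :=
    measurableSet_lt (by fun_prop) (by fun_prop)
  have h2 : MeasurableSet {q : ℝ × ((ℝ × ℝ) × ℝ) | q.1 ≤ q.2.1.1 + q.2.1.2} :=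
    measurableSet_le (by fun_prop) (by fun_prop)
  refine Measurable.ite (h1.inter h2) (Measurable.ite (measurableSet_le (by fun_prop) (by fun_prop))
    (by fun_prop) (by fun_prop)) measurable_const

lemma arrivalReward_of_notMem (κ : ℝ≥0∞) {u : ℝ} {z : (ℝ × ℝ) × ℝ}
    (h : u ∉ Set.Ioc 0 (z.1.1 + z.1.2)) : arrivalReward κ u z = 0 := if_neg h

lemma measurableSet_finishesIn (S : System N Ω P) (i : Fin N) (k : ℕ) {l m : ℕ} (h : l < m) :
    MeasurableSet[S.sigma (pastSources i k m)] {ω | S.FinishesIn i k l ω} := by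
  have h1 := S.measurable_leaveTime_sigma i k h
  have h2 := S.measurable_arrivalTime_sigma i k m
  have h3 := (S.measurable_pollTime_sigma i k l).mono (S.sigma_mono (pastSources_mono i k h.le))
    le_rfl
  have h4 : Measurable[S.sigma (pastSources i k m)] (S.B i k l) :=
    S.measurable_prim_sigma ⟨rfl, rfl, h⟩
  exact MeasurableSet.inter (measurableSet_le h2 h1)
    (measurableSet_le ((h2.max h3).add h4) h1)

lemma measurableSet_waiting_sigma (S : System N Ω P) (i : Fin N) (k m : ℕ) :
    MeasurableSet[S.sigma (pastSources i k m)] {ω | S.Waiting i k m ω} := by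
  have h1 : MeasurableSet[S.sigma (pastSources i k m)]
      {ω | S.arrivalTime i k ω ≤ S.pollTime i m ω} :=
    measurableSet_le (S.measurable_arrivalTime_sigma i k m) (S.measurable_pollTime_sigma i k m)
  have h2 : MeasurableSet[S.sigma (pastSources i k m)]
      (⋂ l ∈ Finset.range m, {ω | S.FinishesIn i k l ω}ᶜ) :=
    Finset.measurableSet_biInter _ fun l hl =>
      (S.measurableSet_finishesIn i k (Finset.mem_range.mp hl)).compl
  convert MeasurableSet.inter h1 h2 using 1
  ext ω
  simp [Waiting]

/-- Almost surely true facts about a sample point that the evolution of the system relies on. -/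
structure Regular (S : System N Ω P) (i : Fin N) (ω : Ω) : Prop where
  V_nonneg : ∀ m, 0 ≤ S.V i m ω
  away_nonneg : ∀ m, 0 ≤ S.away i m ω
  B_nonneg : ∀ k m, 0 ≤ S.B i k m ω

lemma ae_regular (S : System N Ω P) (i : Fin N) : ∀ᵐ ω ∂P, S.Regular i ω := by
  filter_upwards [S.ae_nonneg, S.ae_away_nonneg i] with ω h1 h2
  exact ⟨h1.1 i, h2, h1.2.2.1 i⟩

namespace Regular

variable {S : System N Ω P} {i : Fin N} {ω : Ω}

lemma leaveTime_le (h : S.Regular i ω) (m : ℕ) : S.leaveTime i m ω ≤ S.pollTime i (m + 1) ω := by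
  have := h.away_nonneg m
  rw [away] at this
  linarith

lemma pollTime_le_leaveTime (h : S.Regular i ω) (m : ℕ) :
    S.pollTime i m ω ≤ S.leaveTime i m ω := by
  have := h.V_nonneg m
  rw [leaveTime]
  linarith

lemma monotone (h : S.Regular i ω) : Monotone fun m => S.pollTime i m ω :=
  monotone_nat_of_le_succ fun m => (h.pollTime_le_leaveTime m).trans (h.leaveTime_le m)

lemma not_finishesIn (h : S.Regular i ω) {k l m : ℕ}
    (ha : S.pollTime i m ω < S.arrivalTime i k ω) (hl : l < m) : ¬ S.FinishesIn i k l ω := by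
  intro hf
  have h1 := h.leaveTime_le l
  have h2 : S.pollTime i (l + 1) ω ≤ S.pollTime i m ω := h.monotone hl
  linarith [hf.1]

lemma finishesIn_iff_of_le (h : S.Regular i ω) {k m : ℕ}
    (ha : S.arrivalTime i k ω ≤ S.pollTime i m ω) :
    S.FinishesIn i k m ω ↔ S.B i k m ω ≤ S.V i m ω := by
  have := h.V_nonneg m
  rw [FinishesIn, finishTime, max_eq_right ha, leaveTime]
  constructor
  · rintro ⟨-, h2⟩; linarith
  · intro h2; constructor <;> linarith

lemma finishesIn_iff_of_lt (h : S.Regular i ω) {k m : ℕ}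
    (ha : S.pollTime i m ω < S.arrivalTime i k ω) :
    S.FinishesIn i k m ω ↔ S.arrivalTime i k ω - S.pollTime i m ω + S.B i k m ω ≤ S.V i m ω := by
  have := h.B_nonneg k m
  rw [FinishesIn, finishTime, max_eq_left ha.le, leaveTime]
  constructor
  · rintro ⟨-, h2⟩; linarith
  · intro h2; constructor <;> linarith

lemma not_waiting_of_lt (_h : S.Regular i ω) {k m : ℕ}
    (ha : S.pollTime i m ω < S.arrivalTime i k ω) : ¬ S.Waiting i k m ω :=
  fun hw => absurd hw.1 (not_le.mpr ha)

lemma waiting_succ_of_le (h : S.Regular i ω) {k m : ℕ}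
    (ha : S.arrivalTime i k ω ≤ S.pollTime i m ω) :
    S.Waiting i k (m + 1) ω ↔ S.Waiting i k m ω ∧ S.V i m ω < S.B i k m ω := by
  have h1 : S.pollTime i m ω ≤ S.pollTime i (m + 1) ω := h.monotone (Nat.le_succ m)
  rw [Waiting, Waiting, ← not_le, ← h.finishesIn_iff_of_le ha, Nat.forall_lt_succ_right]
  have h2 := ha.trans h1
  tauto

lemma waiting_succ_of_lt (h : S.Regular i ω) {k m : ℕ}
    (ha : S.pollTime i m ω < S.arrivalTime i k ω) :
    S.Waiting i k (m + 1) ω ↔ S.ArrivesIn i k m ω ∧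
      S.V i m ω < S.arrivalTime i k ω - S.pollTime i m ω + S.B i k m ω := by
  have e : S.V i m ω < S.arrivalTime i k ω - S.pollTime i m ω + S.B i k m ω
      ↔ ¬ S.FinishesIn i k m ω := by rw [h.finishesIn_iff_of_lt ha, not_le]
  rw [Waiting, ArrivesIn, e, Nat.forall_lt_succ_right]
  have h2 := fun l => h.not_finishesIn (l := l) ha
  tauto

end Regular

/-- The time that customer `k` of queue `i` spends in the system before the polling instant of
cycle `n`. -/
def timeUpTo (S : System N Ω P) (i : Fin N) (k n : ℕ) (ω : Ω) : ℝ≥0∞ :=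
  open Classical in
  if h : ∃ m, S.FinishesIn i k m ω ∧ m < n then
    ENNReal.ofReal (S.finishTime i k (Nat.find h) ω - S.arrivalTime i k ω)
  -- `ENNReal.ofReal` truncates to `0` when the customer has not yet arrived.
  else ENNReal.ofReal (S.pollTime i n ω - S.arrivalTime i k ω)

open Classical in
/-- The time that customer `k` of queue `i` spends in the system between the polling instants of the
cycles `m` and `m + 1`. -/
def timeIn (S : System N Ω P) (i : Fin N) (k m : ℕ) (ω : Ω) : ℝ≥0∞ :=
  (if S.Waiting i k m ω then waitingReward (S.mark i k m ω) else 0)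
    + arrivalReward 0 (S.arrivalTime i k ω - S.pollTime i m ω) (S.mark i k m ω)

lemma timeUpTo_eq (S : System N Ω P) {i : Fin N} {k m n : ℕ} {ω : Ω}
    (hm : S.FinishesIn i k m ω) (hl : ∀ l < m, ¬ S.FinishesIn i k l ω) (hn : m < n) :
    S.timeUpTo i k n ω = ENNReal.ofReal (S.finishTime i k m ω - S.arrivalTime i k ω) := by
  classical
  have h : ∃ m, S.FinishesIn i k m ω ∧ m < n := ⟨m, hm, hn⟩
  have : Nat.find h = m := by
    rw [Nat.find_eq_iff]
    exact ⟨⟨hm, hn⟩, fun l hlm hf => hl l hlm hf.1⟩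
  rw [timeUpTo, dif_pos h, this]

lemma timeUpTo_eq_of_forall_not (S : System N Ω P) {i : Fin N} {k n : ℕ} {ω : Ω}
    (hl : ∀ l < n, ¬ S.FinishesIn i k l ω) :
    S.timeUpTo i k n ω = ENNReal.ofReal (S.pollTime i n ω - S.arrivalTime i k ω) := by
  rw [timeUpTo, dif_neg]
  rintro ⟨m, hm, hmn⟩
  exact hl m hmn hm

lemma sojournTime_eq (S : System N Ω P) {i : Fin N} {k m : ℕ} {ω : Ω}
    (hm : S.FinishesIn i k m ω) (hl : ∀ l < m, ¬ S.FinishesIn i k l ω) :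
    S.sojournTime i k ω = ENNReal.ofReal (S.finishTime i k m ω - S.arrivalTime i k ω) := by
  classical
  have h : ∃ m, S.FinishesIn i k m ω := ⟨m, hm⟩
  have : Nat.find h = m := by
    rw [Nat.find_eq_iff]
    exact ⟨hm, fun l hlm hf => hl l hlm hf⟩
  rw [sojournTime, dif_pos h, ← this]

lemma exists_first_finishesIn (S : System N Ω P) {i : Fin N} {k m : ℕ} {ω : Ω}
    (hm : S.FinishesIn i k m ω) :
    ∃ l ≤ m, S.FinishesIn i k l ω ∧ ∀ l' < l, ¬ S.FinishesIn i k l' ω := by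
  classical
  have h : ∃ m, S.FinishesIn i k m ω := ⟨m, hm⟩
  exact ⟨Nat.find h, Nat.find_le hm, Nat.find_spec h, fun l' hl' => Nat.find_min h hl'⟩

/-- Of the two summands of `timeIn` at most one is active: the first if the customer waits at the
poll, the second if the arrival falls into this cycle. Both vanish if service is already completed
or the arrival is still to come. -/
lemma Regular.timeUpTo_succ {S : System N Ω P} {i : Fin N} {ω : Ω} (h : S.Regular i ω) (k m : ℕ) :
    S.timeUpTo i k (m + 1) ω = S.timeUpTo i k m ω + S.timeIn i k m ω := by
  classical
  have hV := h.V_nonneg m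
  have hB := h.B_nonneg k m
  have hW := h.away_nonneg m
  have hstep := S.pollTime_succ i m ω
  by_cases hex : ∃ l < m, S.FinishesIn i k l ω
  · obtain ⟨l, hlm, hl⟩ := hex
    obtain ⟨l', hl'l, hl', hmin⟩ := S.exists_first_finishesIn hl
    have hle : S.arrivalTime i k ω ≤ S.pollTime i m ω := by
      by_contra hlt
      exact h.not_finishesIn (not_le.mp hlt) hlm hl
    have hnw : ¬ S.Waiting i k m ω := fun hw => hw.2 l hlm hl
    rw [S.timeUpTo_eq hl' hmin (by omega), S.timeUpTo_eq hl' hmin (by omega), timeIn,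
      if_neg hnw, arrivalReward_of_notMem, add_zero, add_zero]
    intro h'
    linarith [h'.1]
  · push Not at hex
    rw [S.timeUpTo_eq_of_forall_not hex, timeIn]
    rcases le_or_gt (S.arrivalTime i k ω) (S.pollTime i m ω) with ha | ha
    · have hw : S.Waiting i k m ω := ⟨ha, hex⟩
      rw [if_pos hw, arrivalReward_of_notMem _ (fun h' => by linarith [h'.1]), add_zero,
        waitingReward]
      by_cases hf : S.FinishesIn i k m ω
      · rw [S.timeUpTo_eq hf hex (Nat.lt_succ_self m), if_pos
            (show (S.mark i k m ω).2 ≤ (S.mark i k m ω).1.1 from (h.finishesIn_iff_of_le ha).mp hf),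
          ← ENNReal.ofReal_add (by linarith) (show 0 ≤ (S.mark i k m ω).2 from hB),
          finishTime, max_eq_right ha]
        congr 1; simp only [mark]; ring
      · rw [S.timeUpTo_eq_of_forall_not (Nat.forall_lt_succ_right.mpr ⟨hex, hf⟩),
          if_neg (show ¬ (S.mark i k m ω).2 ≤ (S.mark i k m ω).1.1 from
            fun h' => hf ((h.finishesIn_iff_of_le ha).mpr h')),
          ← ENNReal.ofReal_add (by linarith)
            (show 0 ≤ (S.mark i k m ω).1.1 + (S.mark i k m ω).1.2 from add_nonneg hV hW)]
        congr 1; simp only [mark]; linarith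
    · rw [if_neg (h.not_waiting_of_lt ha), zero_add, arrivalReward,
        ENNReal.ofReal_of_nonpos (by linarith), zero_add]
      simp only [mark, add_zero]
      by_cases hf : S.FinishesIn i k m ω
      · have hf' := (h.finishesIn_iff_of_lt ha).mp hf
        rw [S.timeUpTo_eq hf hex (Nat.lt_succ_self m), if_pos hf', if_pos, finishTime,
          max_eq_left ha.le, add_sub_cancel_left]
        exact ⟨by linarith, by linarith⟩
      · have hf' := fun h' => hf ((h.finishesIn_iff_of_lt ha).mpr h')
        rw [S.timeUpTo_eq_of_forall_not (Nat.forall_lt_succ_right.mpr ⟨hex, hf⟩), if_neg hf']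
        split_ifs with hu
        · congr 1; linarith
        -- The customer arrives after this cycle.
        · refine ENNReal.ofReal_of_nonpos ?_
          by_contra hlt
          exact hu ⟨by linarith, by linarith⟩

lemma Regular.timeUpTo_eq_add_sum {S : System N Ω P} {i : Fin N} {ω : Ω} (h : S.Regular i ω)
    (k n : ℕ) :
    S.timeUpTo i k n ω = ENNReal.ofReal (S.pollTime i 0 ω - S.arrivalTime i k ω)
      + ∑ m ∈ Finset.range n, S.timeIn i k m ω := by
  induction n with
  | zero => rw [S.timeUpTo_eq_of_forall_not (by simp)]; simp
  | succ n ih => rw [h.timeUpTo_succ, ih, Finset.sum_range_succ, add_assoc]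

/-- Decomposition of the sojourn time along the cycles. -/
lemma Regular.sojournTime_eq_add_tsum {S : System N Ω P} {i : Fin N} {ω : Ω} (h : S.Regular i ω)
    {k : ℕ} (hfin : ∃ m, S.FinishesIn i k m ω) :
    S.sojournTime i k ω = ENNReal.ofReal (S.pollTime i 0 ω - S.arrivalTime i k ω)
      + ∑' m, S.timeIn i k m ω := by
  obtain ⟨m, hm⟩ := hfin
  obtain ⟨l, -, hl, hmin⟩ := S.exists_first_finishesIn hm
  rw [S.sojournTime_eq hl hmin]
  -- The accumulated time is constant after the cycle in which service is completed.
  have h1 : Tendsto (fun n => S.timeUpTo i k n ω) atTop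
      (𝓝 (ENNReal.ofReal (S.finishTime i k l ω - S.arrivalTime i k ω))) := by
    refine tendsto_const_nhds.congr' ?_
    filter_upwards [eventually_gt_atTop l] with n hn
    rw [S.timeUpTo_eq hl hmin hn]
  have h2 : Tendsto (fun n => S.timeUpTo i k n ω) atTop
      (𝓝 (ENNReal.ofReal (S.pollTime i 0 ω - S.arrivalTime i k ω) + ∑' m, S.timeIn i k m ω)) := by
    simp_rw [h.timeUpTo_eq_add_sum]
    exact (ENNReal.tendsto_nat_tsum _).const_add _
  exact tendsto_nhds_unique h1 h2

/-! ### Expected sojourn time of a customer through the recursion for waiting. -/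

open Classical in
/-- The indicator of the event that a customer who arrives at time `u` after a polling instant is
still present at the next polling instant. -/
def arrivalFail (u : ℝ) (z : (ℝ × ℝ) × ℝ) : ℝ≥0∞ :=
  if u ∈ Set.Ioc 0 (z.1.1 + z.1.2) ∧ z.1.1 < u + z.2 then 1 else 0

lemma measurable_arrivalFail :
    Measurable fun q : ℝ × ((ℝ × ℝ) × ℝ) => arrivalFail q.1 q.2 := by
  have h1 : MeasurableSet {q : ℝ × ((ℝ × ℝ) × ℝ) | 0 < q.1} :=
    measurableSet_lt (by fun_prop) (by fun_prop)
  have h2 : MeasurableSet {q : ℝ × ((ℝ × ℝ) × ℝ) | q.1 ≤ q.2.1.1 + q.2.1.2} :=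
    measurableSet_le (by fun_prop) (by fun_prop)
  have h3 : MeasurableSet {q : ℝ × ((ℝ × ℝ) × ℝ) | q.2.1.1 < q.1 + q.2.2} :=
    measurableSet_lt (by fun_prop) (by fun_prop)
  exact Measurable.ite ((h1.inter h2).inter h3) measurable_const measurable_const

lemma arrivalReward_eq (κ : ℝ≥0∞) (u : ℝ) (z : (ℝ × ℝ) × ℝ) :
    arrivalReward κ u z = arrivalReward 0 u z + κ * arrivalFail u z := by
  unfold arrivalReward arrivalFail
  by_cases h1 : u ∈ Set.Ioc 0 (z.1.1 + z.1.2)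
  · rcases le_or_gt (u + z.2) z.1.1 with h2 | h2
    · simp [h1, h2, h2.not_gt]
    · simp [h1, h2, h2.not_ge]
  · simp [h1]

/-- The set of marks of a cycle in which a waiting customer is not served. -/
def failSet : Set ((ℝ × ℝ) × ℝ) := {z | z.1.1 < z.2}

lemma measurableSet_failSet : MeasurableSet failSet :=
  measurableSet_lt (by fun_prop) (by fun_prop)

/-- The expected remaining sojourn time of a customer waiting at a polling instant. -/
def waitingMean (S : System N Ω P) (i : Fin N) : ℝ≥0∞ :=
  (∫⁻ z, waitingReward z ∂(S.markLaw i)) / S.markLaw i failSetᶜ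

/-- The indicator of the event that customer `k` waits at the polling instant of cycle `m`. -/
def waitingInd (S : System N Ω P) (i : Fin N) (k m : ℕ) : Ω → ℝ≥0∞ :=
  {ω | S.Waiting i k m ω}.indicator 1

lemma measurable_waitingInd_sigma (S : System N Ω P) (i : Fin N) (k m : ℕ) :
    Measurable[S.sigma (pastSources i k m)] (S.waitingInd i k m) :=
  Measurable.indicator measurable_const (S.measurableSet_waiting_sigma i k m)

lemma measurable_waitingInd (S : System N Ω P) (i : Fin N) (k m : ℕ) :
    Measurable (S.waitingInd i k m) :=
  (S.measurable_waitingInd_sigma i k m).mono (S.sigma_le _) le_rfl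

lemma lintegral_waitingInd_mul (S : System N Ω P) (i : Fin N) (k m : ℕ)
    {f : (ℝ × ℝ) × ℝ → ℝ≥0∞} (hf : Measurable f) :
    ∫⁻ ω, S.waitingInd i k m ω * f (S.mark i k m ω) ∂P
      = (∫⁻ ω, S.waitingInd i k m ω ∂P) * ∫⁻ z, f z ∂(S.markLaw i) := by
  rw [S.lintegral_past_mark i k m (S.measurable_waitingInd_sigma i k m)
    (f := fun q => q.1 * f q.2) (by fun_prop)]
  simp_rw [lintegral_const_mul _ hf]
  rw [lintegral_mul_const _ (S.measurable_waitingInd i k m)]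

/-- Two exclusive ways to wait at the next poll: to have waited at this one and failed, or to have
arrived in between without finishing. -/
lemma Regular.waitingInd_succ {S : System N Ω P} {i : Fin N} {ω : Ω} (h : S.Regular i ω)
    (k m : ℕ) :
    S.waitingInd i k (m + 1) ω = S.waitingInd i k m ω * failSet.indicator 1 (S.mark i k m ω)
      + arrivalFail (S.arrivalTime i k ω - S.pollTime i m ω) (S.mark i k m ω) := by
  have hstep := S.pollTime_succ i m ω
  rcases le_or_gt (S.arrivalTime i k ω) (S.pollTime i m ω) with ha | ha
  · have h0 : arrivalFail (S.arrivalTime i k ω - S.pollTime i m ω) (S.mark i k m ω) = 0 :=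
      if_neg fun h' => by linarith [h'.1.1]
    rw [h0, add_zero, waitingInd, waitingInd]
    by_cases hw : S.Waiting i k (m + 1) ω
    · have hw' := (h.waiting_succ_of_le ha).mp hw
      rw [Set.indicator_of_mem (by exact hw), Set.indicator_of_mem (by exact hw'.1),
        Set.indicator_of_mem (show S.mark i k m ω ∈ failSet from hw'.2)]
      simp
    · rw [Set.indicator_of_notMem (by exact hw)]
      by_cases h1 : S.Waiting i k m ω
      · rw [Set.indicator_of_notMem (show S.mark i k m ω ∉ failSet from
          fun h2 => hw ((h.waiting_succ_of_le ha).mpr ⟨h1, h2⟩)), mul_zero]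
      · rw [Set.indicator_of_notMem (by exact h1), zero_mul]
  · rw [waitingInd, waitingInd, Set.indicator_of_notMem (a := ω) (s := {ω | S.Waiting i k m ω})
      (h.not_waiting_of_lt ha), zero_mul, zero_add]
    by_cases hw : S.Waiting i k (m + 1) ω
    · have hw' := (h.waiting_succ_of_lt ha).mp hw
      rw [Set.indicator_of_mem (by exact hw), arrivalFail, if_pos, Pi.one_apply]
      exact ⟨⟨by linarith, by simp only [mark]; linarith [hw'.1.2]⟩, hw'.2⟩
    · rw [Set.indicator_of_notMem (by exact hw), arrivalFail, if_neg]
      rintro ⟨⟨-, h1⟩, h2⟩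
      simp only [mark] at h1 h2
      exact hw ((h.waiting_succ_of_lt ha).mpr ⟨⟨ha, by linarith⟩, h2⟩)

lemma lintegral_waitingInd_succ (S : System N Ω P) (i : Fin N) (k m : ℕ) :
    ∫⁻ ω, S.waitingInd i k (m + 1) ω ∂P
      = S.markLaw i failSet * (∫⁻ ω, S.waitingInd i k m ω ∂P)
        + ∫⁻ ω, arrivalFail (S.arrivalTime i k ω - S.pollTime i m ω) (S.mark i k m ω) ∂P := by
  have hf : Measurable (failSet.indicator (1 : (ℝ × ℝ) × ℝ → ℝ≥0∞)) :=
    measurable_one.indicator measurableSet_failSet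
  rw [lintegral_congr_ae (g := fun ω => S.waitingInd i k m ω
    * failSet.indicator 1 (S.mark i k m ω)
      + arrivalFail (S.arrivalTime i k ω - S.pollTime i m ω) (S.mark i k m ω))
    (by filter_upwards [S.ae_regular i] with ω h using h.waitingInd_succ k m),
    lintegral_add_left, S.lintegral_waitingInd_mul i k m hf,
    lintegral_indicator_one measurableSet_failSet, mul_comm]
  exact (S.measurable_waitingInd i k m).mul (hf.comp (S.measurable_mark i k m))

lemma measurable_comp_arrival (S : System N Ω P) (i : Fin N) (k m : ℕ)
    {g : ℝ → (ℝ × ℝ) × ℝ → ℝ≥0∞} (hg : Measurable fun q : ℝ × ((ℝ × ℝ) × ℝ) => g q.1 q.2) :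
    Measurable fun ω => g (S.arrivalTime i k ω - S.pollTime i m ω) (S.mark i k m ω) :=
  hg.comp (((S.measurable_arrivalTime i k).sub (S.measurable_pollTime i m)).prodMk
    (S.measurable_mark i k m))

/-- The terms count entries into the waiting state. A customer arrives either by the first poll or
in exactly one later cycle, hence enters at most once. -/
lemma waitingInd_zero_add_tsum_le (S : System N Ω P) (i : Fin N) (k : ℕ)
    (hc : ∫⁻ z, ENNReal.ofReal (z.1.1 + z.1.2) ∂(S.markLaw i) ≠ 0) :
    (∫⁻ ω, S.waitingInd i k 0 ω ∂P) + ∑' m, ∫⁻ ω, arrivalFail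
      (S.arrivalTime i k ω - S.pollTime i m ω) (S.mark i k m ω) ∂P ≤ 1 := by
  have hR := S.isRenewal i k
  rw [← lintegral_tsum fun m => (S.measurable_comp_arrival i k m
    measurable_arrivalFail).aemeasurable, ← lintegral_add_left (S.measurable_waitingInd i k 0)]
  calc _ ≤ ∫⁻ _, 1 ∂P := ?_
    _ = 1 := by simp
  refine lintegral_mono_ae ?_
  filter_upwards [hR.ae_monotone, hR.ae_exists_le_epoch hc] with ω hmono hunb
  have h1 : ∑' m, arrivalFail (S.arrivalTime i k ω - S.pollTime i m ω) (S.mark i k m ω)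
      ≤ (Set.Ioi (S.pollTime i 0 ω)).indicator 1 (S.arrivalTime i k ω) := by
    rw [← tsum_indicator_Ioc_succ hmono hunb]
    refine ENNReal.tsum_le_tsum fun m => ?_
    have hstep := S.pollTime_succ i m ω
    unfold arrivalFail
    split_ifs with h1
    · simp only [mark] at h1
      rw [Set.indicator_of_mem, Pi.one_apply]
      exact ⟨by linarith [h1.1.1], by linarith [h1.1.2]⟩
    · exact zero_le
  refine (add_le_add_right h1 _).trans ?_
  simp only [waitingInd, Set.indicator, Set.mem_ofPred_eq, Waiting, Set.mem_Ioi, Pi.one_apply]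
  rcases le_or_gt (S.arrivalTime i k ω) (S.pollTime i 0 ω) with ha | ha
  · simp [ha, not_lt.mpr ha]
  · simp [ha, not_le.mpr ha]

lemma markLaw_failSet_add (S : System N Ω P) (i : Fin N) :
    S.markLaw i failSetᶜ + S.markLaw i failSet = 1 := by
  rw [add_comm, measure_add_measure_compl measurableSet_failSet, measure_univ]

/-- A customer enters the waiting state at most once, and leaves it with probability `p_i` in each
cycle. -/
lemma mul_tsum_waitingInd (S : System N Ω P) (i : Fin N) (k : ℕ)
    (hc : ∫⁻ z, ENNReal.ofReal (z.1.1 + z.1.2) ∂(S.markLaw i) ≠ 0)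
    (hp : S.markLaw i failSetᶜ ≠ 0) :
    (∑' m, ∫⁻ ω, S.waitingInd i k m ω ∂P ≠ ∞) ∧
    S.markLaw i failSetᶜ * ∑' m, ∫⁻ ω, S.waitingInd i k m ω ∂P
      = (∫⁻ ω, S.waitingInd i k 0 ω ∂P) + ∑' m, ∫⁻ ω, arrivalFail
      (S.arrivalTime i k ω - S.pollTime i m ω) (S.mark i k m ω) ∂P := by
  have hsucc := S.lintegral_waitingInd_succ i k
  have hle := S.waitingInd_zero_add_tsum_le i k hc
  have hpq := S.markLaw_failSet_add i
  have hfin : ∀ m, ∫⁻ ω, S.waitingInd i k m ω ∂P ≤ 1 := fun m => by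
    refine (lintegral_mono fun ω => Set.indicator_le_self _ _ _).trans (le_of_eq ?_)
    simp
  have hqt : S.markLaw i failSet ≠ ∞ := measure_ne_top _ _
  set x := fun m => ∫⁻ ω, S.waitingInd i k m ω ∂P
  set e := fun m => ∫⁻ ω, arrivalFail
      (S.arrivalTime i k ω - S.pollTime i m ω) (S.mark i k m ω) ∂P
  set p := S.markLaw i failSetᶜ
  set q := S.markLaw i failSet
  change x 0 + ∑' m, e m ≤ 1 at hle
  change ∀ m, x (m + 1) = q * x m + e m at hsucc
  change ∑' m, x m ≠ ∞ ∧ p * ∑' m, x m = x 0 + ∑' m, e m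
  -- With `x (m + 1) = q x m + e m` and `p + q = 1`, summation gives the identity after cancelling
  -- `q ∑ x`. Cancellation in `ℝ≥0∞` needs finiteness, so it is done first for partial sums, which
  -- yields a uniform bound.
  have hpart : ∀ n, p * ∑ m ∈ Finset.range n, x m ≤ 1 := by
    intro n
    have hsn : ∑ m ∈ Finset.range n, x m ≠ ∞ :=
      ENNReal.sum_ne_top.mpr fun m _ => ne_top_of_le_ne_top ENNReal.one_ne_top (hfin m)
    have h1 : ∑ m ∈ Finset.range n, x m ≤ 1 + q * ∑ m ∈ Finset.range n, x m := by
      calc ∑ m ∈ Finset.range n, x m ≤ ∑ m ∈ Finset.range (n + 1), x m :=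
            Finset.sum_le_sum_of_subset (Finset.range_mono (Nat.le_succ n))
        _ = x 0 + ∑ m ∈ Finset.range n, e m + q * ∑ m ∈ Finset.range n, x m := by
            rw [Finset.sum_range_succ', Finset.mul_sum, Finset.sum_congr rfl fun m _ => hsucc m,
              Finset.sum_add_distrib]
            ring
        _ ≤ _ := by
            gcongr
            exact (add_le_add_right (ENNReal.sum_le_tsum _) _).trans hle
    have h2 : p * ∑ m ∈ Finset.range n, x m + q * ∑ m ∈ Finset.range n, x m
        ≤ 1 + q * ∑ m ∈ Finset.range n, x m := by
      rwa [← add_mul, hpq, one_mul]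
    exact (ENNReal.add_le_add_iff_right (ENNReal.mul_ne_top hqt hsn)).mp h2
  have hs : ∑' m, x m ≠ ∞ := by
    intro htop
    have h1 : p * ∑' m, x m ≤ 1 := by
      rw [ENNReal.tsum_eq_iSup_nat, ENNReal.mul_iSup]
      exact iSup_le hpart
    rw [htop, ENNReal.mul_top hp] at h1
    exact absurd h1 (by simp)
  refine ⟨hs, ?_⟩
  have h2 : ∑' m, x m = x 0 + ∑' m, e m + q * ∑' m, x m := by
    nth_rewrite 1 [tsum_eq_zero_add' ENNReal.summable]
    simp_rw [hsucc]
    rw [ENNReal.tsum_add, ENNReal.tsum_mul_left]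
    ring
  have h3 : p * ∑' m, x m + q * ∑' m, x m = x 0 + ∑' m, e m + q * ∑' m, x m := by
    rw [← add_mul, hpq, one_mul]; exact h2
  exact (ENNReal.add_left_inj (ENNReal.mul_ne_top hqt hs)).mp h3

/-- Every customer is eventually served. -/
lemma ae_exists_finishesIn (S : System N Ω P) (i : Fin N) (k : ℕ)
    (hc : ∫⁻ z, ENNReal.ofReal (z.1.1 + z.1.2) ∂(S.markLaw i) ≠ 0)
    (hp : S.markLaw i failSetᶜ ≠ 0) : ∀ᵐ ω ∂P, ∃ m, S.FinishesIn i k m ω := by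
  have h1 := (S.mul_tsum_waitingInd i k hc hp).1
  rw [← lintegral_tsum fun m => (S.measurable_waitingInd i k m).aemeasurable] at h1
  have hm : Measurable fun ω => ∑' m, S.waitingInd i k m ω :=
    Measurable.tsum fun m => S.measurable_waitingInd i k m
  have hR := S.isRenewal i k
  filter_upwards [ae_lt_top hm h1, hR.ae_monotone, hR.ae_exists_le_epoch hc] with ω h2 hmono hunb
  by_contra! hno
  obtain ⟨m0, hm0⟩ := hunb (S.arrivalTime i k ω)
  have h3 := ENNReal.tendsto_atTop_zero_of_tsum_ne_top h2.ne
  -- A customer who is never served waits at every poll from the arrival on, against the summability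
  -- of the indicators.
  have h4 : Tendsto (fun m => S.waitingInd i k m ω) atTop (𝓝 1) := by
    refine tendsto_const_nhds.congr' ?_
    filter_upwards [eventually_ge_atTop m0] with m hm
    have hw : S.Waiting i k m ω := ⟨hm0.trans (hmono hm), fun l _ => hno l⟩
    rw [waitingInd, Set.indicator_of_mem (by exact hw), Pi.one_apply]
  exact zero_ne_one (tendsto_nhds_unique h3 h4)

/-- Every waiting poll costs the mean waiting reward, which is `κ p`. Since `p` times the expected
number of waiting polls is the probability of ever having to wait, the total is `κ` per entry, and
`κ` can be charged at the moment of entry. -/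
lemma lintegral_sojournTime (S : System N Ω P) (i : Fin N) (k : ℕ)
    (hc : ∫⁻ z, ENNReal.ofReal (z.1.1 + z.1.2) ∂(S.markLaw i) ≠ 0)
    (hp : S.markLaw i failSetᶜ ≠ 0) :
    ∫⁻ ω, S.sojournTime i k ω ∂P
      = ∫⁻ ω, ENNReal.ofReal (S.pollTime i 0 ω - S.arrivalTime i k ω) ∂P
        + S.waitingMean i * P {ω | S.arrivalTime i k ω ≤ S.pollTime i 0 ω}
        + ∑' m, ∫⁻ ω, arrivalReward (S.waitingMean i)
          (S.arrivalTime i k ω - S.pollTime i m ω) (S.mark i k m ω) ∂P := by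
  have ha := S.measurable_arrivalTime i k
  have hτ := S.measurable_pollTime i
  have hmeas := fun m κ => S.measurable_comp_arrival i k m (measurable_arrivalReward κ)
  have htime : ∀ m ω, S.timeIn i k m ω = S.waitingInd i k m ω * waitingReward (S.mark i k m ω)
      + arrivalReward 0 (S.arrivalTime i k ω - S.pollTime i m ω) (S.mark i k m ω) := by
    intro m ω
    simp only [timeIn, waitingInd, Set.indicator, Set.mem_ofPred_eq, Pi.one_apply]
    split_ifs <;> simp
  have hwm : ∀ m, Measurable fun ω => S.waitingInd i k m ω * waitingReward (S.mark i k m ω) :=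
    fun m => (S.measurable_waitingInd i k m).mul
      (measurable_waitingReward.comp (S.measurable_mark i k m))
  have hx0 : ∫⁻ ω, S.waitingInd i k 0 ω ∂P = P {ω | S.arrivalTime i k ω ≤ S.pollTime i 0 ω} := by
    rw [waitingInd, lintegral_indicator_one ((S.sigma_le _) _ (S.measurableSet_waiting_sigma i k 0))]
    simp [Waiting]
  -- The division in `waitingMean` is undone here; it is legitimate as `p` is nonzero and finite.
  have hκ : (∫⁻ z, waitingReward z ∂(S.markLaw i)) = S.waitingMean i * S.markLaw i failSetᶜ := by
    rw [waitingMean, ENNReal.div_mul_cancel hp (measure_ne_top _ _)]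
  calc ∫⁻ ω, S.sojournTime i k ω ∂P
      = ∫⁻ ω, (ENNReal.ofReal (S.pollTime i 0 ω - S.arrivalTime i k ω)
          + ∑' m, S.timeIn i k m ω) ∂P := by
        refine lintegral_congr_ae ?_
        filter_upwards [S.ae_regular i, S.ae_exists_finishesIn i k hc hp] with ω h1 h2
        exact h1.sojournTime_eq_add_tsum h2
    _ = ∫⁻ ω, ENNReal.ofReal (S.pollTime i 0 ω - S.arrivalTime i k ω) ∂P
          + ((∫⁻ z, waitingReward z ∂(S.markLaw i)) * ∑' m, ∫⁻ ω, S.waitingInd i k m ω ∂P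
          + ∑' m, ∫⁻ ω, arrivalReward 0 (S.arrivalTime i k ω - S.pollTime i m ω)
            (S.mark i k m ω) ∂P) := by
        have := hτ 0
        rw [lintegral_add_left (by fun_prop)]
        simp_rw [htime]
        rw [lintegral_tsum (f := fun m ω => S.waitingInd i k m ω * waitingReward (S.mark i k m ω)
            + arrivalReward 0 (S.arrivalTime i k ω - S.pollTime i m ω) (S.mark i k m ω))
            fun m => ((hwm m).add (hmeas m 0)).aemeasurable,
          ← ENNReal.tsum_mul_left, ← ENNReal.tsum_add]
        congr 2
        ext m
        rw [lintegral_add_left (hwm m), S.lintegral_waitingInd_mul i k m measurable_waitingReward,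
          mul_comm]
    _ = _ := by
        rw [hκ, mul_assoc, (S.mul_tsum_waitingInd i k hc hp).2, hx0, mul_add, add_assoc, add_assoc,
          ← ENNReal.tsum_mul_left, ← ENNReal.tsum_add]
        congr 3
        ext m
        simp_rw [arrivalReward_eq (S.waitingMean i)]
        rw [lintegral_add_left (hmeas m 0), lintegral_const_mul, add_comm]
        exact S.measurable_comp_arrival i k m measurable_arrivalFail

end System

/-! ### Exponential interarrival times and Campbell's formula. -/

instance nullSingletonClass_expMeasure (r : ℝ) : NullSingletonClass (expMeasure r) := by
  unfold expMeasure gammaMeasure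
  infer_instance

lemma expMeasure_Ici {r : ℝ} (hr : 0 < r) {x : ℝ} (hx : 0 ≤ x) :
    expMeasure r (Set.Ici x) = ENNReal.ofReal (Real.exp (-(r * x))) := by
  have := isProbabilityMeasure_expMeasure hr
  have h1 : expMeasure r (Set.Ici x) = expMeasure r (Set.Ioi x) := measure_congr Ioi_ae_eq_Ici.symm
  rw [h1, ← Set.compl_Iic, prob_compl_eq_one_sub measurableSet_Iic, ← ofReal_cdf,
    cdf_expMeasure_eq hr, if_pos hx, ← ENNReal.ofReal_one, ← ENNReal.ofReal_sub]
  · congr 1; ring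
  · have : Real.exp (-(r * x)) ≤ 1 := Real.exp_le_one_iff.mpr (by nlinarith)
    linarith

/-- The compensator of an exponential random variable. -/
lemma lintegral_expMeasure {r : ℝ} (hr : 0 < r) {g : ℝ → ℝ≥0∞} (hg : Measurable g) :
    ∫⁻ e, g e ∂(expMeasure r)
      = ENNReal.ofReal r * ∫⁻ e, (∫⁻ x in Set.Ioc 0 e, g x) ∂(expMeasure r) := by
  have := isProbabilityMeasure_expMeasure hr
  have hle : MeasurableSet {q : ℝ × ℝ | 0 < q.2 ∧ q.2 ≤ q.1} := by
    have h1 : MeasurableSet {q : ℝ × ℝ | 0 < q.2} := measurableSet_lt (by fun_prop) (by fun_prop)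
    have h2 : MeasurableSet {q : ℝ × ℝ | q.2 ≤ q.1} := measurableSet_le (by fun_prop) (by fun_prop)
    exact h1.inter h2
  have hpdf : Measurable (exponentialPDF r) := (measurable_exponentialPDFReal r).ennreal_ofReal
  -- Tonelli turns the inner integral into one against the tail probability; for the exponential
  -- law, `r` times the tail is the density.
  have h1 : ∫⁻ e, (∫⁻ x in Set.Ioc 0 e, g x) ∂(expMeasure r)
      = ∫⁻ x, (Set.Ioi 0).indicator g x * expMeasure r (Set.Ici x) := by
    have hm : Measurable fun q : ℝ × ℝ =>
        {q : ℝ × ℝ | 0 < q.2 ∧ q.2 ≤ q.1}.indicator (fun q => g q.2) q :=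
      (hg.comp measurable_snd).indicator hle
    calc _ = ∫⁻ e, (∫⁻ x, {q : ℝ × ℝ | 0 < q.2 ∧ q.2 ≤ q.1}.indicator (fun q => g q.2) (e, x))
          ∂(expMeasure r) := by
          refine lintegral_congr fun e => ?_
          rw [← lintegral_indicator measurableSet_Ioc]
          rfl
      _ = ∫⁻ x, ∫⁻ e, {q : ℝ × ℝ | 0 < q.2 ∧ q.2 ≤ q.1}.indicator (fun q => g q.2) (e, x)
          ∂(expMeasure r) := lintegral_lintegral_swap hm.aemeasurable
      _ = _ := by
          refine lintegral_congr fun x => ?_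
          rw [← lintegral_indicator_one measurableSet_Ici, ← lintegral_const_mul _
            (measurable_one.indicator measurableSet_Ici)]
          refine lintegral_congr fun e => ?_
          by_cases h0 : 0 < x <;> by_cases h2 : x ≤ e <;> simp [Set.indicator, h0, h2]
  rw [h1, ← lintegral_const_mul' _ _ ENNReal.ofReal_ne_top]
  have h2 : expMeasure r = volume.withDensity (exponentialPDF r) := rfl
  rw [h2, lintegral_withDensity_eq_lintegral_mul _ hpdf hg, ← h2]
  refine lintegral_congr_ae ?_
  have h0 : ∀ᵐ x : ℝ, x ≠ 0 := by simp [ae_iff]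
  filter_upwards [h0] with x hx
  rw [Pi.mul_apply]
  rcases lt_or_gt_of_ne hx with h | h
  · rw [exponentialPDF_of_neg h, Set.indicator_of_notMem (by simp [h.le])]; simp
  · rw [exponentialPDF_of_nonneg h.le, Set.indicator_of_mem (by exact h), expMeasure_Ici hr h.le,
      ENNReal.ofReal_mul hr.le]
    ring

lemma measurable_setLIntegral_Ioc {E : Type*} [MeasurableSpace E] {f : E → ℝ → ℝ≥0∞}
    (hf : Measurable fun q : E × ℝ => f q.1 q.2) :
    Measurable fun q : E × ℝ => ∫⁻ x in Set.Ioc 0 q.2, f q.1 x := by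
  have h1 : MeasurableSet {q : (E × ℝ) × ℝ | 0 < q.2} :=
    measurableSet_lt (by fun_prop) (by fun_prop)
  have h2 : MeasurableSet {q : (E × ℝ) × ℝ | q.2 ≤ q.1.2} :=
    measurableSet_le (by fun_prop) (by fun_prop)
  have h3 : Measurable fun q : (E × ℝ) × ℝ => {q : (E × ℝ) × ℝ | 0 < q.2 ∧ q.2 ≤ q.1.2}.indicator
      (fun q => f q.1.1 q.2) q :=
    Measurable.indicator (hf.comp (f := fun q : (E × ℝ) × ℝ => (q.1.1, q.2)) (by fun_prop))
      (h1.inter h2)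
  have h4 := h3.lintegral_prod_right' (ν := volume)
  convert h4 using 2 with q
  rw [← lintegral_indicator measurableSet_Ioc]
  rfl

namespace System

variable {N : ℕ} {Ω : Type*} [MeasurableSpace Ω] {P : Measure Ω} [IsProbabilityMeasure P]

/-- The sum of the first `n` interarrival times of queue `i`. -/
def arrivalSum (S : System N Ω P) (i : Fin N) (n : ℕ) (ω : Ω) : ℝ :=
  ∑ l ∈ Finset.range n, S.prim (.interarrival i l) ω

lemma measurable_arrivalSum (S : System N Ω P) (i : Fin N) (n : ℕ) :
    Measurable (S.arrivalSum i n) :=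
  Finset.measurable_fun_sum _ fun _ _ => S.measurable_prim _

/-- The compensator identity is applied to the last interarrival time, with the earlier sum frozen
by independence. -/
lemma lintegral_arrivalSum_succ (S : System N Ω P) (i : Fin N) (n : ℕ) {f : ℝ → ℝ≥0∞}
    (hf : Measurable f) :
    ∫⁻ ω, f (S.arrivalSum i (n + 1) ω) ∂P = ENNReal.ofReal (S.rate i) * ∫⁻ ω, (∫⁻ t in
      Set.Ioc (S.arrivalSum i n ω) (S.arrivalSum i (n + 1) ω), f t) ∂P := by
  have := isProbabilityMeasure_expMeasure (S.rate_pos i)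
  have ha := S.measurable_arrivalSum i n
  have he := S.measurable_prim (.interarrival i n)
  have hind : IndepFun (S.arrivalSum i n) (S.prim (.interarrival i n)) P := by
    refine S.indepFun_of_sigma (A := {s | ∃ l < n, s = .interarrival i l})
      (B := {.interarrival i n}) ?_ ?_ (S.measurable_prim_sigma rfl)
    · rw [Set.disjoint_singleton_right]
      rintro ⟨l, hl, h⟩
      simp only [Source.interarrival.injEq, true_and] at h
      omega
    · exact Finset.measurable_fun_sum _ fun l hl =>
        S.measurable_prim_sigma ⟨l, Finset.mem_range.mp hl, rfl⟩
  have hlaw : ∀ g : ℝ × ℝ → ℝ≥0∞, Measurable g →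
      ∫⁻ ω, g (S.arrivalSum i n ω, S.prim (.interarrival i n) ω) ∂P
        = ∫⁻ ω, ∫⁻ e, g (S.arrivalSum i n ω, e) ∂(expMeasure (S.rate i)) ∂P := by
    intro g hg
    rw [← lintegral_map (f := g)
      (g := fun ω => (S.arrivalSum i n ω, S.prim (.interarrival i n) ω)) hg (ha.prodMk he),
      hind.map_prod_eq_prod_map_map ha.aemeasurable he.aemeasurable, S.interarrival_law,
      lintegral_prod _ hg.aemeasurable, lintegral_map hg.lintegral_prod_right' ha]
  have hsucc : ∀ ω, S.arrivalSum i (n + 1) ω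
      = S.arrivalSum i n ω + S.prim (.interarrival i n) ω := fun ω => Finset.sum_range_succ _ _
  have htrans : ∀ a e : ℝ, ∫⁻ t in Set.Ioc a (a + e), f t = ∫⁻ x in Set.Ioc 0 e, f (a + x) := by
    intro a e
    rw [← lintegral_indicator measurableSet_Ioc, ← lintegral_indicator measurableSet_Ioc,
      ← lintegral_add_left_eq_self _ a]
    refine lintegral_congr fun x => ?_
    simp [Set.indicator]
  have hmeas : Measurable fun q : ℝ × ℝ => ∫⁻ x in Set.Ioc 0 q.2, f (q.1 + x) :=
    measurable_setLIntegral_Ioc (f := fun a x => f (a + x)) (by fun_prop)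
  simp_rw [hsucc, htrans]
  rw [hlaw (fun q => f (q.1 + q.2)) (by fun_prop),
    hlaw (fun q => ∫⁻ x in Set.Ioc 0 q.2, f (q.1 + x)) hmeas,
    ← lintegral_const_mul' _ _ ENNReal.ofReal_ne_top]
  exact lintegral_congr fun ω => lintegral_expMeasure (S.rate_pos i)
    (g := fun x => f (S.arrivalSum i n ω + x)) (by fun_prop)

/-- Campbell's formula for the first `n` arrivals. -/
lemma sum_lintegral_arrivalTime (S : System N Ω P) (i : Fin N) (n : ℕ) {f : ℝ → ℝ≥0∞}
    (hf : Measurable f) :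
    ∑ k ∈ Finset.range n, ∫⁻ ω, f (S.arrivalTime i k ω) ∂P = ENNReal.ofReal (S.rate i)
      * ∫⁻ ω, (∫⁻ t in Set.Ioc 0 (S.arrivalSum i n ω), f t) ∂P := by
  induction n with
  | zero => simp [arrivalSum]
  | succ n ih =>
    have hmeas : Measurable fun ω => ∫⁻ t in Set.Ioc 0 (S.arrivalSum i n ω), f t :=
      (measurable_setLIntegral_Ioc (E := Unit) (f := fun _ => f)
        (by fun_prop)).comp (measurable_const (a := ()) |>.prodMk (S.measurable_arrivalSum i n))
    rw [Finset.sum_range_succ, ih]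
    have h : ∫⁻ ω, f (S.arrivalTime i n ω) ∂P = ∫⁻ ω, f (S.arrivalSum i (n + 1) ω) ∂P := rfl
    rw [h, S.lintegral_arrivalSum_succ i n hf, ← mul_add, ← lintegral_add_left hmeas]
    congr 1
    refine lintegral_congr_ae ?_
    filter_upwards [S.ae_nonneg] with ω hω
    have h0 : 0 ≤ S.arrivalSum i n ω := Finset.sum_nonneg fun l _ => hω.2.2.2 i l
    have h1 : S.arrivalSum i n ω ≤ S.arrivalSum i (n + 1) ω := by
      rw [arrivalSum, arrivalSum, Finset.sum_range_succ]
      linarith [hω.2.2.2 i n]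
    rw [← Set.Ioc_union_Ioc_eq_Ioc h0 h1, lintegral_union measurableSet_Ioc]
    exact Set.disjoint_left.mpr fun y hy hy' => absurd hy'.1 (not_lt.mpr hy.2)

/-- Campbell's formula with `f = 1`. It converts bounds affine in the horizon into bounds affine in
`n`. -/
lemma rate_mul_lintegral_arrivalSum (S : System N Ω P) (i : Fin N) (n : ℕ) :
    ENNReal.ofReal (S.rate i) * ∫⁻ ω, ENNReal.ofReal (S.arrivalSum i n ω) ∂P = n := by
  have h := S.sum_lintegral_arrivalTime i n (f := fun _ => 1) measurable_const
  simp only [lintegral_const, measure_univ, mul_one, Finset.sum_const, Finset.card_range,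
    nsmul_eq_mul, Measure.restrict_apply, MeasurableSet.univ, Set.univ_inter, Real.volume_Ioc,
    sub_zero, one_mul] at h
  exact h.symm

/-! ### Mean sojourn time as a function of the arrival time. -/

/-- The initial delay contributes to the sojourn time of a customer who arrives at time `t` before
the first polling instant `s`. -/
def initialReward (κ : ℝ≥0∞) (t s : ℝ) : ℝ≥0∞ :=
  ENNReal.ofReal (s - t) + κ * (Set.Ici t).indicator 1 s

lemma measurable_initialReward (κ : ℝ≥0∞) :
    Measurable fun q : ℝ × ℝ => initialReward κ q.1 q.2 := by
  have h : Measurable fun q : ℝ × ℝ => {q : ℝ × ℝ | q.1 ≤ q.2}.indicator (1 : ℝ × ℝ → ℝ≥0∞) q :=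
    measurable_one.indicator (measurableSet_le (by fun_prop) (by fun_prop))
  exact Measurable.add (by fun_prop) (h.const_mul κ)

/-- The mean sojourn time of a customer who arrives at queue `i` at time `t`. -/
def meanSojournAt (S : System N Ω P) (i : Fin N) (t : ℝ) : ℝ≥0∞ :=
  ∫⁻ ω, initialReward (S.waitingMean i) t (S.pollTime i 0 ω) ∂P
    + ∑' m, ∫⁻ ω, ∫⁻ z, arrivalReward (S.waitingMean i) (t - S.pollTime i m ω) z
      ∂(S.markLaw i) ∂P

lemma measurable_lintegral_arrivalReward (S : System N Ω P) (i : Fin N) (κ : ℝ≥0∞) :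
    Measurable fun q : ℝ × ℝ => ∫⁻ z, arrivalReward κ (q.1 - q.2) z ∂(S.markLaw i) :=
  Measurable.lintegral_prod_right' (ν := S.markLaw i)
    (f := fun q : (ℝ × ℝ) × ((ℝ × ℝ) × ℝ) => arrivalReward κ (q.1.1 - q.1.2) q.2)
    ((measurable_arrivalReward κ).comp
      (f := fun q : (ℝ × ℝ) × ((ℝ × ℝ) × ℝ) => (q.1.1 - q.1.2, q.2)) (by fun_prop))

lemma measurable_comp_pollTime (S : System N Ω P) (i : Fin N) (m : ℕ) {g : ℝ × ℝ → ℝ≥0∞}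
    (hg : Measurable g) : Measurable fun q : ℝ × Ω => g (q.1, S.pollTime i m q.2) :=
  hg.comp (measurable_fst.prodMk ((S.measurable_pollTime i m).comp measurable_snd))

lemma measurable_meanSojournAt (S : System N Ω P) (i : Fin N) : Measurable (S.meanSojournAt i) := by
  refine Measurable.add ?_ (Measurable.tsum fun m => ?_)
  · exact (S.measurable_comp_pollTime i 0
      (measurable_initialReward (S.waitingMean i))).lintegral_prod_right'
  · exact (S.measurable_comp_pollTime i m
      (S.measurable_lintegral_arrivalReward i (S.waitingMean i))).lintegral_prod_right'

lemma lintegral_arrivalTime_pollTime (S : System N Ω P) (i : Fin N) (k m : ℕ) {g : ℝ × ℝ → ℝ≥0∞}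
    (hg : Measurable g) : ∫⁻ ω, g (S.arrivalTime i k ω, S.pollTime i m ω) ∂P
      = ∫⁻ ω, ∫⁻ ω', g (S.arrivalTime i k ω, S.pollTime i m ω') ∂P ∂P := by
  have ha := S.measurable_arrivalTime i k
  have hτ := S.measurable_pollTime i m
  have hind : IndepFun (S.arrivalTime i k) (S.pollTime i m) P := by
    refine S.indepFun_of_sigma (A := {s | ∃ l, s = .interarrival i l})
      (B := {s | ∀ l, s ≠ .interarrival i l}) ?_ ?_ ?_
    · rw [Set.disjoint_left]
      rintro s ⟨l, hl⟩ h
      exact h l hl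
    · exact Finset.measurable_fun_sum _ fun l _ => S.measurable_prim_sigma ⟨l, rfl⟩
    · exact S.measurable_pollTime_sigma_of_mem i m (by simp) (by simp)
  rw [← lintegral_map (f := g) (g := fun ω => (S.arrivalTime i k ω, S.pollTime i m ω)) hg
    (ha.prodMk hτ), hind.map_prod_eq_prod_map_map ha.aemeasurable hτ.aemeasurable,
    lintegral_prod _ hg.aemeasurable, lintegral_map hg.lintegral_prod_right' ha]
  refine lintegral_congr fun ω => ?_
  exact lintegral_map (hg.comp (measurable_prodMk_left (x := S.arrivalTime i k ω))) hτ

/-- Arrival times are independent of polling instants and of marks, so the customer can be replaced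
by one arriving at a deterministic time, averaged afterwards over the law of the arrival time. -/
lemma lintegral_sojournTime_eq (S : System N Ω P) (i : Fin N) (k : ℕ)
    (hc : ∫⁻ z, ENNReal.ofReal (z.1.1 + z.1.2) ∂(S.markLaw i) ≠ 0)
    (hp : S.markLaw i failSetᶜ ≠ 0) :
    ∫⁻ ω, S.sojournTime i k ω ∂P = ∫⁻ ω, S.meanSojournAt i (S.arrivalTime i k ω) ∂P := by
  have ha := S.measurable_arrivalTime i k
  have hτ := S.measurable_pollTime i
  have hI := measurable_initialReward (S.waitingMean i)
  have hA := S.measurable_lintegral_arrivalReward i (S.waitingMean i)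
  rw [S.lintegral_sojournTime i k hc hp]
  have h1 : ∫⁻ ω, ENNReal.ofReal (S.pollTime i 0 ω - S.arrivalTime i k ω) ∂P
        + S.waitingMean i * P {ω | S.arrivalTime i k ω ≤ S.pollTime i 0 ω}
      = ∫⁻ ω, initialReward (S.waitingMean i) (S.arrivalTime i k ω) (S.pollTime i 0 ω) ∂P := by
    have hset : MeasurableSet {ω | S.arrivalTime i k ω ≤ S.pollTime i 0 ω} :=
      measurableSet_le ha (hτ 0)
    rw [← lintegral_indicator_one hset,
      ← lintegral_const_mul _ (measurable_one.indicator hset), ← lintegral_add_left]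
    · rfl
    · have := hτ 0
      fun_prop
  have h2 : ∀ m, ∫⁻ ω, arrivalReward (S.waitingMean i)
      (S.arrivalTime i k ω - S.pollTime i m ω) (S.mark i k m ω) ∂P
      = ∫⁻ ω, ∫⁻ z, arrivalReward (S.waitingMean i)
        (S.arrivalTime i k ω - S.pollTime i m ω) z ∂(S.markLaw i) ∂P := fun m =>
    S.lintegral_past_mark i k m (f := fun q => arrivalReward (S.waitingMean i) q.1 q.2)
      ((S.measurable_arrivalTime_sigma i k m).sub (S.measurable_pollTime_sigma i k m))
      (measurable_arrivalReward _)
  simp_rw [h1, h2]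
  rw [S.lintegral_arrivalTime_pollTime i k 0 hI]
  simp_rw [fun m => S.lintegral_arrivalTime_pollTime i k m hA]
  unfold meanSojournAt
  have hm1 : Measurable fun ω => ∫⁻ ω', initialReward (S.waitingMean i) (S.arrivalTime i k ω)
      (S.pollTime i 0 ω') ∂P :=
    ((S.measurable_comp_pollTime i 0 hI).lintegral_prod_right' (ν := P)).comp ha
  have hm2 := fun m => (S.measurable_comp_pollTime i m hA).lintegral_prod_right' (ν := P)
  rw [lintegral_add_left hm1]
  congr 1
  exact (lintegral_tsum fun m => ((hm2 m).comp ha).aemeasurable).symm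

end System

/-! ### Long-run average of the sojourn times. -/

lemma tendsto_div_nat_of_bounds {s : ℕ → ℝ≥0∞} {c r : ℝ≥0∞} (hc : c ≠ 0) (hc' : c ≠ ∞) (hr : r ≠ ∞)
    (h : ∀ ε : ℝ≥0∞, ε ≠ 0 → ε ≠ ∞ → ∃ K : ℝ≥0∞, K ≠ ∞ ∧ ∀ n : ℕ,
      c * s n ≤ (r + ε) * n + K ∧ r * n ≤ c * s n + (ε * n + K)) :
    Tendsto (fun n : ℕ => s n / n) atTop (𝓝 (r / c)) := by
  have key : Tendsto (fun n : ℕ => c * s n / n) atTop (𝓝 r) := by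
    rw [ENNReal.tendsto_nhds hr]
    intro ε hε
    -- Half of `ε` goes to the slope error and half to `K / n`; the cap at `1` keeps `δ` finite.
    set δ := min (ε / 2) 1
    have hδ : δ ≠ 0 := by
      have := ENNReal.half_pos hε.ne'
      exact (lt_min this one_pos).ne'
    have hδ' : δ ≠ ∞ := ne_top_of_le_ne_top ENNReal.one_ne_top (min_le_right _ _)
    have hδε : δ + δ ≤ ε := by
      calc δ + δ ≤ ε / 2 + ε / 2 := add_le_add (min_le_left _ _) (min_le_left _ _)
        _ = ε := ENNReal.add_halves ε
    obtain ⟨K, hK, hKn⟩ := h δ hδ hδ'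
    have hlim : Tendsto (fun n : ℕ => K * (n : ℝ≥0∞)⁻¹) atTop (𝓝 0) := by
      have := ENNReal.Tendsto.const_mul ENNReal.tendsto_inv_nat_nhds_zero (Or.inr hK)
      rwa [mul_zero] at this
    filter_upwards [hlim.eventually (ge_mem_nhds (pos_iff_ne_zero.mpr hδ)),
      eventually_gt_atTop 0] with n hn hn0
    have hne : (n : ℝ≥0∞) ≠ 0 := by exact_mod_cast hn0.ne'
    have hne' : (n : ℝ≥0∞) ≠ ∞ := ENNReal.natCast_ne_top n
    obtain ⟨h1, h2⟩ := hKn n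
    have hcancel : (n : ℝ≥0∞) * (n : ℝ≥0∞)⁻¹ = 1 := ENNReal.mul_inv_cancel hne hne'
    rw [div_eq_mul_inv]
    refine ⟨tsub_le_iff_right.mpr ?_, ?_⟩
    · calc r = (r * n) * (n : ℝ≥0∞)⁻¹ := by rw [mul_assoc, hcancel, mul_one]
        _ ≤ (c * s n + (δ * n + K)) * (n : ℝ≥0∞)⁻¹ := by gcongr
        _ = c * s n * (n : ℝ≥0∞)⁻¹ + (δ * (n * (n : ℝ≥0∞)⁻¹) + K * (n : ℝ≥0∞)⁻¹) := by ring
        _ ≤ c * s n * (n : ℝ≥0∞)⁻¹ + (δ + δ) := by rw [hcancel, mul_one]; gcongr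
        _ ≤ _ := by gcongr
    · calc c * s n * (n : ℝ≥0∞)⁻¹ ≤ ((r + δ) * n + K) * (n : ℝ≥0∞)⁻¹ := by gcongr
        _ = (r + δ) * (n * (n : ℝ≥0∞)⁻¹) + K * (n : ℝ≥0∞)⁻¹ := by ring
        _ ≤ r + δ + δ := by rw [hcancel, mul_one]; gcongr
        _ ≤ _ := by rw [add_assoc]; gcongr
  have h2 := ENNReal.Tendsto.const_mul (a := c⁻¹) key (Or.inr (ENNReal.inv_ne_top.mpr hc))
  convert h2 using 2 with n
  · rw [mul_div_assoc, ← mul_assoc, ENNReal.inv_mul_cancel hc hc', one_mul]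
  · rw [div_eq_mul_inv, mul_comm]

namespace System

variable {N : ℕ} {Ω : Type*} [MeasurableSpace Ω] {P : Measure Ω} [IsProbabilityMeasure P]

/-- The expected time integral, over one cycle, of the mean sojourn time as a function of the
arrival time. -/
def cycleReward (S : System N Ω P) (i : Fin N) : ℝ≥0∞ :=
  ∫⁻ z, (∫⁻ u, arrivalReward (S.waitingMean i) u z) ∂(S.markLaw i)

lemma setLIntegral_meanSojournAt (S : System N Ω P) (i : Fin N) (T : ℝ) :
    ∫⁻ t in Set.Ioc 0 T, S.meanSojournAt i t
      = ∫⁻ ω, (∫⁻ t in Set.Ioc 0 T, initialReward (S.waitingMean i) t (S.pollTime i 0 ω)) ∂P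
        + renewalReward P (S.markLaw i) (S.pollTime i) (arrivalReward (S.waitingMean i)) T := by
  have hI := S.measurable_comp_pollTime i 0 (measurable_initialReward (S.waitingMean i))
  have hA := fun m => S.measurable_comp_pollTime i m
    (S.measurable_lintegral_arrivalReward i (S.waitingMean i))
  unfold meanSojournAt
  rw [lintegral_add_left hI.lintegral_prod_right',
    lintegral_tsum fun m => (hA m).lintegral_prod_right'.aemeasurable]
  rw [lintegral_lintegral_swap hI.aemeasurable]
  congr 1
  unfold renewalReward
  refine tsum_congr fun m => ?_
  rw [lintegral_lintegral_swap (hA m).aemeasurable]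
  refine lintegral_congr fun ω => ?_
  rw [lintegral_lintegral_swap]
  exact ((measurable_arrivalReward (S.waitingMean i)).comp
    (f := fun q : ℝ × ((ℝ × ℝ) × ℝ) => (q.1 - S.pollTime i m ω, q.2)) (by fun_prop)).aemeasurable

/-- Before the first poll the reward is at most `s + κ` over a stretch of length `s`. The bound is
uniform in `T`, so the initial phase disappears in the average. -/
lemma lintegral_initialReward_le (S : System N Ω P) (i : Fin N) (κ : ℝ≥0∞) (T : ℝ) :
    ∫⁻ ω, (∫⁻ t in Set.Ioc 0 T, initialReward κ t (S.pollTime i 0 ω)) ∂P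
      ≤ ∫⁻ ω, (ENNReal.ofReal (S.pollTime i 0 ω) + κ) * ENNReal.ofReal (S.pollTime i 0 ω) ∂P := by
  refine lintegral_mono fun ω => ?_
  rw [← lintegral_indicator measurableSet_Ioc]
  set s := S.pollTime i 0 ω
  calc _ ≤ ∫⁻ t, (Set.Ioc 0 s).indicator (fun _ => ENNReal.ofReal s + κ) t := by
        refine lintegral_mono fun t => ?_
        by_cases ht : t ∈ Set.Ioc 0 T
        swap
        · rw [Set.indicator_of_notMem ht]; exact zero_le
        rw [Set.indicator_of_mem ht, initialReward]
        by_cases hs : t ≤ s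
        · rw [Set.indicator_of_mem (show s ∈ Set.Ici t from hs),
            Set.indicator_of_mem (show t ∈ Set.Ioc 0 s from ⟨ht.1, hs⟩), Pi.one_apply, mul_one]
          gcongr
          linarith [ht.1]
        · rw [Set.indicator_of_notMem (show s ∉ Set.Ici t from hs),
            ENNReal.ofReal_of_nonpos (by linarith), mul_zero, add_zero]
          exact zero_le
    _ = _ := by
        rw [lintegral_indicator measurableSet_Ioc, setLIntegral_const, Real.volume_Ioc, sub_zero]

lemma arrivalReward_le (κ : ℝ≥0∞) (u : ℝ) {z : (ℝ × ℝ) × ℝ} (hz : 0 ≤ z.1.2) :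
    arrivalReward κ u z ≤ (Set.Ioc 0 (z.1.1 + z.1.2)).indicator
      (fun _ => ENNReal.ofReal (z.1.1 + z.1.2) + κ) u := by
  by_cases hu : u ∈ Set.Ioc 0 (z.1.1 + z.1.2)
  · rw [Set.indicator_of_mem hu, arrivalReward, if_pos hu]
    split_ifs with h
    · exact le_add_right (ENNReal.ofReal_le_ofReal (by linarith [hu.1]))
    · gcongr
      linarith [hu.1]
  · rw [arrivalReward_of_notMem κ hu]; exact zero_le

lemma lintegral_add_mul_self_ne_top {E : Type*} [MeasurableSpace E] {ν : Measure E}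
    [IsProbabilityMeasure ν] {f : E → ℝ≥0∞} (hf : Measurable f) (h : ∫⁻ z, f z ^ 2 ∂ν ≠ ∞)
    {κ : ℝ≥0∞} (hκ : κ ≠ ∞) : ∫⁻ z, (f z + κ) * f z ∂ν ≠ ∞ := by
  have hle : ∀ x : ℝ≥0∞, x ≤ 1 + x ^ 2 := fun x => by
    rcases le_total x 1 with h | h
    · exact le_add_right h
    · exact le_add_left (le_self_pow₀ h two_ne_zero)
  have h1 : ∫⁻ z, f z ∂ν ≠ ∞ := by
    refine ne_top_of_le_ne_top ?_ (lintegral_mono fun z => hle (f z))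
    rw [lintegral_add_left measurable_const]
    simp [h]
  have h2 : ∀ z, (f z + κ) * f z = f z ^ 2 + κ * f z := fun z => by ring
  simp_rw [h2]
  rw [lintegral_add_left (by fun_prop), lintegral_const_mul _ hf]
  finiteness

lemma waitingMean_ne_top (S : System N Ω P) (i : Fin N)
    (hc : ∫⁻ z, ENNReal.ofReal (z.1.1 + z.1.2) ∂(S.markLaw i) ≠ ∞)
    (hp : S.markLaw i failSetᶜ ≠ 0) : S.waitingMean i ≠ ∞ := by
  refine ENNReal.div_ne_top (ne_top_of_le_ne_top hc (lintegral_mono_ae ?_)) hp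
  filter_upwards [S.ae_markLaw_nonneg i] with z hz
  unfold waitingReward
  split_ifs with h
  · exact ENNReal.ofReal_le_ofReal (by linarith)
  · exact le_rfl

/-- The reward rate is at most the cycle length plus `κ`, for as long as the cycle lasts; hence the
second moment of the cycle is what is needed. -/
lemma cycleReward_ne_top (S : System N Ω P) (i : Fin N)
    (hc2 : ∫⁻ z, ENNReal.ofReal (z.1.1 + z.1.2) ^ 2 ∂(S.markLaw i) ≠ ∞)
    (hκ : S.waitingMean i ≠ ∞) : S.cycleReward i ≠ ∞ := by
  refine ne_top_of_le_ne_top (lintegral_add_mul_self_ne_top (by fun_prop) hc2 hκ)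
    (lintegral_mono_ae ?_)
  filter_upwards [S.ae_markLaw_nonneg i] with z hz
  refine (lintegral_mono fun u => arrivalReward_le _ u hz.2.1).trans (le_of_eq ?_)
  rw [lintegral_indicator measurableSet_Ioc, setLIntegral_const, Real.volume_Ioc, sub_zero]

/-- The mean sojourn time in steady state is the expected time integral over a cycle, divided by the
mean cycle length. -/
theorem tendsto_average_sojournTime (S : System N Ω P) (i : Fin N)
    (hc : ∫⁻ z, ENNReal.ofReal (z.1.1 + z.1.2) ∂(S.markLaw i) ≠ 0)
    (hc' : ∫⁻ z, ENNReal.ofReal (z.1.1 + z.1.2) ∂(S.markLaw i) ≠ ∞)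
    (hc2 : ∫⁻ z, ENNReal.ofReal (z.1.1 + z.1.2) ^ 2 ∂(S.markLaw i) ≠ ∞)
    (hτ2 : ∫⁻ ω, ENNReal.ofReal (S.pollTime i 0 ω) ^ 2 ∂P ≠ ∞)
    (hp : S.markLaw i failSetᶜ ≠ 0) :
    Tendsto (fun n : ℕ => (∑ k ∈ Finset.range n, ∫⁻ ω, S.sojournTime i k ω ∂P) / (n : ℝ≥0∞))
      atTop (𝓝 (S.cycleReward i / ∫⁻ z, ENNReal.ofReal (z.1.1 + z.1.2) ∂(S.markLaw i))) := by
  have hτ := S.measurable_pollTime i 0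
  have hκ := S.waitingMean_ne_top i hc' hp
  have hr := S.cycleReward_ne_top i hc2 hκ
  -- Any customer index would do: neither the epochs nor the mark law depends on it.
  have hR := S.isRenewal i 0
  have hinit := fun κ hκ => lintegral_add_mul_self_ne_top (κ := κ) (ν := P)
    (f := fun ω => ENNReal.ofReal (S.pollTime i 0 ω)) (by fun_prop) hτ2 hκ
  have hτ0 : ∫⁻ ω, ENNReal.ofReal (S.pollTime i 0 ω) ∂P ≠ ∞ := by
    refine ne_top_of_le_ne_top (hinit 1 ENNReal.one_ne_top) (lintegral_mono fun ω => ?_)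
    calc _ = 1 * ENNReal.ofReal (S.pollTime i 0 ω) := (one_mul _).symm
      _ ≤ _ := by gcongr; exact le_add_self
  set c := ∫⁻ z, ENNReal.ofReal (z.1.1 + z.1.2) ∂(S.markLaw i)
  set K₀ := ∫⁻ ω, (ENNReal.ofReal (S.pollTime i 0 ω) + S.waitingMean i)
    * ENNReal.ofReal (S.pollTime i 0 ω) ∂P
  set lam := ENNReal.ofReal (S.rate i)
  have hsum : ∀ n, ∑ k ∈ Finset.range n, ∫⁻ ω, S.sojournTime i k ω ∂P
      = lam * ∫⁻ ω, (∫⁻ t in Set.Ioc 0 (S.arrivalSum i n ω), S.meanSojournAt i t) ∂P := fun n => by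
    rw [← S.sum_lintegral_arrivalTime i n (S.measurable_meanSojournAt i)]
    exact Finset.sum_congr rfl fun k _ => S.lintegral_sojournTime_eq i k hc hp
  have harr : ∀ n, ∀ᵐ ω ∂P, 0 ≤ S.arrivalSum i n ω := fun n => by
    filter_upwards [S.ae_nonneg] with ω hω using Finset.sum_nonneg fun l _ => hω.2.2.2 i l
  refine tendsto_div_nat_of_bounds hc hc' hr fun ε hε hε' => ?_
  obtain ⟨K₁, hK₁, h1⟩ := hR.exists_length_mul_renewalReward_le
    (φ := arrivalReward (S.waitingMean i)) hc hc'
    (fun u z => arrivalReward_of_notMem _) hr hε hε'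
  obtain ⟨K₂, hK₂, h2⟩ := hR.exists_mul_le_length_mul_renewalReward hc hc' hτ0
    (measurable_arrivalReward (S.waitingMean i)) (fun u z => arrivalReward_of_notMem _) hr hε hε'
  have hlt : lam ≠ ∞ := ENNReal.ofReal_ne_top
  have hK₀ : K₀ ≠ ∞ := hinit _ hκ
  have hA : ∀ n, Measurable (S.arrivalSum i n) := S.measurable_arrivalSum i
  have hnlam : ∀ (a : ℝ≥0∞) (n : ℕ),
      lam * ∫⁻ ω, a * ENNReal.ofReal (S.arrivalSum i n ω) ∂P = a * n := fun a n => by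
    have := hA n
    rw [lintegral_const_mul _ (by fun_prop), ← S.rate_mul_lintegral_arrivalSum i n]
    ring
  have hdec := S.setLIntegral_meanSojournAt i
  have hI := S.lintegral_initialReward_le i (S.waitingMean i)
  -- `K₀` bounds the initial phase, `K₁` and `K₂` come from the two renewal-reward bounds; all are
  -- multiplied by `λ` because Campbell's formula is.
  refine ⟨lam * (c * K₀ + K₁ + K₂), by finiteness, fun n => ⟨?_, ?_⟩⟩
  · rw [hsum n]
    calc c * (lam * ∫⁻ ω, (∫⁻ t in Set.Ioc 0 (S.arrivalSum i n ω), S.meanSojournAt i t) ∂P)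
        = lam * ∫⁻ ω, c * (∫⁻ t in Set.Ioc 0 (S.arrivalSum i n ω), S.meanSojournAt i t) ∂P := by
          rw [lintegral_const_mul' _ _ hc']; ring
      _ ≤ lam * ∫⁻ ω, ((S.cycleReward i + ε) * ENNReal.ofReal (S.arrivalSum i n ω)
            + (c * K₀ + K₁)) ∂P := by
          gcongr 1
          refine lintegral_mono_ae ?_
          filter_upwards [harr n] with ω hω
          rw [hdec, mul_add]
          calc _ ≤ c * K₀ + ((S.cycleReward i + ε) * ENNReal.ofReal (S.arrivalSum i n ω) + K₁) := by
                refine add_le_add ?_ (h1 _ hω)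
                gcongr
                exact hI _
            _ = _ := by ring
      _ = (S.cycleReward i + ε) * n + lam * (c * K₀ + K₁) := by
          rw [lintegral_add_right _ measurable_const, mul_add, hnlam]
          simp
      _ ≤ _ := add_le_add_right (mul_le_mul_right le_self_add lam) _
  · rw [hsum n]
    calc S.cycleReward i * n
        = lam * ∫⁻ ω, S.cycleReward i * ENNReal.ofReal (S.arrivalSum i n ω) ∂P := (hnlam _ n).symm
      _ ≤ lam * ∫⁻ ω, (c * (∫⁻ t in Set.Ioc 0 (S.arrivalSum i n ω), S.meanSojournAt i t)
            + (ε * ENNReal.ofReal (S.arrivalSum i n ω) + K₂)) ∂P := by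
          gcongr 1
          refine lintegral_mono_ae ?_
          filter_upwards [harr n] with ω hω
          refine (h2 _ hω).trans ?_
          gcongr
          rw [hdec]
          exact le_add_self
      _ = c * (lam * ∫⁻ ω, (∫⁻ t in Set.Ioc 0 (S.arrivalSum i n ω), S.meanSojournAt i t) ∂P)
            + (ε * n + lam * K₂) := by
          have := hA n
          rw [lintegral_add_right _ (by fun_prop), lintegral_const_mul' _ _ hc',
            lintegral_add_right _ measurable_const, mul_add, mul_add, hnlam]
          simp only [lintegral_const, measure_univ, mul_one]
          ring
      _ ≤ _ := by
          gcongr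
          exact le_add_self

end System

/-! ### Residual laws, conditional means and the geometric law. -/

/-- Integration with respect to the residual law. -/
lemma lintegral_setLIntegral_Ico (μ : Measure ℝ) [IsProbabilityMeasure μ] (hm : 0 < ∫ x, x ∂μ)
    {H : ℝ → ℝ≥0∞} (hH : Measurable H) :
    ∫⁻ v, (∫⁻ y in Set.Ico 0 v, H y) ∂μ
      = ENNReal.ofReal (∫ x, x ∂μ) * ∫⁻ y, H y ∂(residualLaw μ) := by
  have hanti : Antitone fun y => μ.real (Set.Ioi y) := fun a b hab =>
    measureReal_mono (Set.Ioi_subset_Ioi hab)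
  have hd : Measurable fun y => ENNReal.ofReal (μ.real (Set.Ioi y) / ∫ x, x ∂μ) :=
    (hanti.measurable.div_const _).ennreal_ofReal
  have hS : MeasurableSet {q : ℝ × ℝ | 0 ≤ q.2 ∧ q.2 < q.1} := by
    have h1 : MeasurableSet {q : ℝ × ℝ | 0 ≤ q.2} := measurableSet_le (by fun_prop) (by fun_prop)
    have h2 : MeasurableSet {q : ℝ × ℝ | q.2 < q.1} := measurableSet_lt (by fun_prop) (by fun_prop)
    exact h1.inter h2
  have hmeas : Measurable fun q : ℝ × ℝ =>
      {q : ℝ × ℝ | 0 ≤ q.2 ∧ q.2 < q.1}.indicator (fun q => H q.2) q :=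
    (hH.comp measurable_snd).indicator hS
  calc _ = ∫⁻ v, (∫⁻ y, {q : ℝ × ℝ | 0 ≤ q.2 ∧ q.2 < q.1}.indicator (fun q => H q.2) (v, y)) ∂μ := by
        refine lintegral_congr fun v => ?_
        rw [← lintegral_indicator measurableSet_Ico]
        rfl
    _ = ∫⁻ y, ∫⁻ v, {q : ℝ × ℝ | 0 ≤ q.2 ∧ q.2 < q.1}.indicator (fun q => H q.2) (v, y) ∂μ :=
        lintegral_lintegral_swap hmeas.aemeasurable
    _ = ∫⁻ y in Set.Ici 0, H y * μ (Set.Ioi y) := by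
        rw [← lintegral_indicator measurableSet_Ici]
        refine lintegral_congr fun y => ?_
        by_cases hy : 0 ≤ y
        · rw [Set.indicator_of_mem (by exact hy), ← lintegral_indicator_one measurableSet_Ioi,
            ← lintegral_const_mul _ (measurable_one.indicator measurableSet_Ioi)]
          refine lintegral_congr fun v => ?_
          by_cases hv : y < v <;> simp [Set.indicator, hy, hv]
        · rw [Set.indicator_of_notMem (by exact hy)]
          simp [Set.indicator, hy]
    -- The endpoint `0` is Lebesgue-null; the residual density lives on the open half-line.
    _ = ∫⁻ y in Set.Ioi 0, H y * μ (Set.Ioi y) := setLIntegral_congr Ioi_ae_eq_Ici.symm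
    _ = _ := by
        rw [residualLaw, lintegral_withDensity_eq_lintegral_mul _ hd hH,
          ← lintegral_const_mul' _ _ ENNReal.ofReal_ne_top]
        refine lintegral_congr fun y => ?_
        rw [Pi.mul_apply, ← mul_assoc, ← ENNReal.ofReal_mul hm.le, mul_div_cancel₀ _ hm.ne',
          ofReal_measureReal, mul_comm]

lemma isProbabilityMeasure_residualLaw (μ : Measure ℝ) [IsProbabilityMeasure μ]
    (hm : 0 < ∫ x, x ∂μ) (h0 : ∀ᵐ x ∂μ, 0 ≤ x) : IsProbabilityMeasure (residualLaw μ) := by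
  -- A non-integrable function has integral `0` by convention, so a positive mean forces
  -- integrability.
  have hint : Integrable (fun x => x) μ := by
    by_contra h
    rw [integral_undef h] at hm
    exact lt_irrefl _ hm
  constructor
  have h := lintegral_setLIntegral_Ico μ hm (H := fun _ => 1) measurable_const
  simp only [lintegral_const, Measure.restrict_apply, MeasurableSet.univ, Set.univ_inter,
    Real.volume_Ico, sub_zero, one_mul] at h
  rw [← ofReal_integral_eq_lintegral_ofReal hint h0] at h
  exact (ENNReal.mul_right_inj (by simpa using hm) ENNReal.ofReal_ne_top).mp
    (h.symm.trans (mul_one _).symm)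

lemma ae_residualLaw_pos (μ : Measure ℝ) : ∀ᵐ y ∂(residualLaw μ), 0 < y :=
  (withDensity_absolutelyContinuous _ _).ae_le (ae_restrict_mem measurableSet_Ioi)

/-- For a null event both sides are `0`, which is the reading of such products adopted in the
theorem. -/
lemma measureReal_mul_integral_cond {E : Type*} [MeasurableSpace E] (ρ : Measure E)
    [IsFiniteMeasure ρ] (A : Set E) (f : E → ℝ) :
    ρ.real A * ∫ z, f z ∂(ρ[|A]) = ∫ z in A, f z ∂ρ := by
  rw [ProbabilityTheory.cond, integral_smul_measure, smul_eq_mul, ENNReal.toReal_inv, ← mul_assoc]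
  by_cases h : ρ A = 0
  · rw [setIntegral_measure_zero f h, mul_zero]
  · rw [measureReal_def, mul_inv_cancel₀, one_mul]
    exact (ENNReal.toReal_pos h (measure_ne_top _ _)).ne'

lemma hasSum_geometricLaw {p : ℝ} (hp : 0 < p) (hp1 : p ≤ 1) {f : ℕ → ℝ} {a : ℝ} (hf : ∀ n, 0 ≤ f n)
    (h : HasSum (fun n => (1 - p) ^ n * p * f n) a) : ∫ n, f n ∂(geometricLaw p) = a := by
  have hq : 0 ≤ 1 - p := by linarith
  have hw : ∀ n : ℕ, 0 ≤ (1 - p) ^ n * p := fun n => by positivity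
  rw [integral_eq_lintegral_of_nonneg_ae (ae_of_all _ hf)
    (measurable_of_countable f).aestronglyMeasurable, geometricLaw, lintegral_sum_measure]
  simp_rw [lintegral_smul_measure, lintegral_dirac, smul_eq_mul, ← ENNReal.ofReal_mul (hw _)]
  rw [← ENNReal.ofReal_tsum_of_nonneg (fun n => mul_nonneg (hw n) (hf n)) h.summable, h.tsum_eq,
    ENNReal.toReal_ofReal]
  exact h.nonneg fun n => mul_nonneg (hw n) (hf n)

lemma integral_geometricLaw {p : ℝ} (hp : 0 < p) (hp1 : p ≤ 1) :
    ∫ n : ℕ, (n : ℝ) ∂(geometricLaw p) = (1 - p) / p := by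
  refine hasSum_geometricLaw hp hp1 (fun n => n.cast_nonneg) ?_
  have hr : ‖1 - p‖ < 1 := by rw [Real.norm_eq_abs, abs_lt]; constructor <;> linarith
  have h := (hasSum_coe_mul_geometric_of_norm_lt_one hr).mul_right p
  rw [sub_sub_cancel] at h
  rw [show (fun n : ℕ => (1 - p) ^ n * p * (n : ℝ)) = fun n : ℕ => (n : ℝ) * (1 - p) ^ n * p by
    ext n; ring, show (1 - p) / p = (1 - p) / p ^ 2 * p by field_simp]
  exact h

lemma integral_succ_geometricLaw {p : ℝ} (hp : 0 < p) (hp1 : p ≤ 1) :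
    ∫ n : ℕ, ((n : ℝ) + 1) ∂(geometricLaw p) = 1 / p := by
  refine hasSum_geometricLaw hp hp1 (fun n => by positivity) ?_
  have hr : ‖1 - p‖ < 1 := by rw [Real.norm_eq_abs, abs_lt]; constructor <;> linarith
  have h := ((hasSum_coe_mul_geometric_of_norm_lt_one hr).add
    (hasSum_geometric_of_norm_lt_one hr)).mul_right p
  rw [sub_sub_cancel] at h
  rw [show (fun n : ℕ => (1 - p) ^ n * p * ((n : ℝ) + 1))
      = fun n : ℕ => ((n : ℝ) * (1 - p) ^ n + (1 - p) ^ n) * p by ext n; ring,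
    show 1 / p = ((1 - p) / p ^ 2 + p⁻¹) * p by field_simp; ring]
  exact h

lemma setLIntegral_Ioc_ofReal_sub {v w : ℝ} (hw : 0 ≤ w) :
    ∫⁻ u in Set.Ioc v (v + w), ENNReal.ofReal (v + w - u) = ENNReal.ofReal (w ^ 2 / 2) := by
  have hle : v ≤ v + w := by linarith
  rw [← ofReal_integral_eq_lintegral_ofReal]
  · rw [← intervalIntegral.integral_of_le hle, intervalIntegral.integral_comp_sub_left (fun x => x)]
    congr 1
    rw [integral_id]
    ring
  · exact (Continuous.integrableOn_Icc (by fun_prop)).mono_set Set.Ioc_subset_Icc_self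
  · filter_upwards [ae_restrict_mem measurableSet_Ioc] with u hu
    simp only [Pi.zero_apply]
    linarith [hu.2]

/-! ### Computation of the reward per cycle. -/

namespace System

open Classical in
/-- The expected time until the next polling instant, plus `κ` if the customer is then still
present, for a customer who arrives when the residual visit time is `y`. -/
def residualReward (κ : ℝ≥0∞) (w b y : ℝ) : ℝ≥0∞ :=
  if b ≤ y then ENNReal.ofReal b else ENNReal.ofReal (y + w) + κ

lemma measurable_residualReward (κ : ℝ≥0∞) :
    Measurable fun q : ℝ × ℝ × ℝ => residualReward κ q.1 q.2.1 q.2.2 :=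
  Measurable.ite (measurableSet_le (by fun_prop) (by fun_prop)) (by fun_prop) (by fun_prop)

/-- The cycle is split at the end of the visit. An arrival at age `u ≤ v` sees the remaining visit
time `y = v - u`; a later one cannot be served, since `b ≥ 0`, and waits for the rest of the cycle,
which integrates to `w² / 2`. -/
lemma lintegral_arrivalReward (κ : ℝ≥0∞) {v w b : ℝ} (hv : 0 ≤ v) (hw : 0 ≤ w) (hb : 0 ≤ b) :
    ∫⁻ u, arrivalReward κ u ((v, w), b) = (∫⁻ y in Set.Ico 0 v, residualReward κ w b y)
      + (ENNReal.ofReal (w ^ 2 / 2) + κ * ENNReal.ofReal w) := by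
  have h1 : ∫⁻ u, arrivalReward κ u ((v, w), b)
      = ∫⁻ u in Set.Ioc 0 (v + w), arrivalReward κ u ((v, w), b) := by
    rw [← lintegral_indicator measurableSet_Ioc]
    refine lintegral_congr fun u => ?_
    by_cases hu : u ∈ Set.Ioc 0 (v + w)
    · rw [Set.indicator_of_mem hu]
    · rw [Set.indicator_of_notMem hu, arrivalReward_of_notMem κ hu]
  rw [h1, ← Set.Ioc_union_Ioc_eq_Ioc hv (by linarith : v ≤ v + w), lintegral_union measurableSet_Ioc
    (Set.disjoint_left.mpr fun y hy hy' => absurd hy'.1 (not_lt.mpr hy.2))]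
  congr 1
  · rw [← lintegral_indicator measurableSet_Ioc, ← lintegral_indicator measurableSet_Ico,
      ← lintegral_sub_left_eq_self ((Set.Ico 0 v).indicator (residualReward κ w b)) v]
    refine lintegral_congr fun u => ?_
    by_cases hu : u ∈ Set.Ioc 0 v
    · have hu' : v - u ∈ Set.Ico 0 v := ⟨by linarith [hu.2], by linarith [hu.1]⟩
      rw [Set.indicator_of_mem hu, Set.indicator_of_mem hu', arrivalReward,
        if_pos ⟨hu.1, by linarith [hu.2]⟩, residualReward]
      have e : v + w - u = v - u + w := by ring
      by_cases hbu : u + b ≤ v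
      · rw [if_pos hbu, if_pos (by linarith)]
      · rw [if_neg hbu, if_neg (by intro h; exact hbu (by linarith)), e]
    · rw [Set.indicator_of_notMem hu, Set.indicator_of_notMem]
      exact fun h => hu ⟨by linarith [h.2], by linarith [h.1]⟩
  · rw [← setLIntegral_Ioc_ofReal_sub (v := v) hw]
    have h2 : κ * ENNReal.ofReal w = ∫⁻ _ in Set.Ioc v (v + w), κ := by
      rw [setLIntegral_const, Real.volume_Ioc, add_sub_cancel_left]
    rw [h2, ← lintegral_add_right _ measurable_const]
    refine setLIntegral_congr_fun measurableSet_Ioc fun u hu => ?_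
    have hu1 := hu.1
    simp only [arrivalReward]
    rw [if_pos ⟨by linarith, hu.2⟩, if_neg (by intro h; linarith)]

variable {N : ℕ} {Ω : Type*} [MeasurableSpace Ω] {P : Measure Ω} [IsProbabilityMeasure P]

lemma lintegral_markLaw (S : System N Ω P) (i : Fin N) {f : (ℝ × ℝ) × ℝ → ℝ≥0∞}
    (hf : Measurable f) :
    ∫⁻ z, f z ∂(S.markLaw i) = ∫⁻ v, ∫⁻ w, ∫⁻ b, f ((v, w), b) ∂(P.map (S.B i 0 0))
      ∂(P.map (S.Cexcl i 0)) ∂(P.map (S.V i 0)) := by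
  have h1 := Measure.isProbabilityMeasure_map (μ := P) (S.measurable_V i 0).aemeasurable
  have h2 := Measure.isProbabilityMeasure_map (μ := P) (S.measurable_Cexcl i 0).aemeasurable
  have h3 := Measure.isProbabilityMeasure_map (μ := P) (S.measurable_B i 0 0).aemeasurable
  rw [markLaw, lintegral_prod _ hf.aemeasurable,
    lintegral_prod _ hf.lintegral_prod_right'.aemeasurable]

lemma ae_map_nonneg {X : Ω → ℝ} (hX : Measurable X) (h : ∀ᵐ ω ∂P, 0 ≤ X ω) :
    ∀ᵐ x ∂(P.map X), 0 ≤ x :=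
  (ae_map_iff hX.aemeasurable (measurableSet_le measurable_const measurable_id)).mpr h

lemma lintegral_map_ofReal {X : Ω → ℝ} (hX : Measurable X) (h : ∀ᵐ ω ∂P, 0 ≤ X ω)
    (hint : Integrable X P) :
    ∫⁻ x, ENNReal.ofReal x ∂(P.map X) = ENNReal.ofReal (∫ ω, X ω ∂P) := by
  rw [lintegral_map (by fun_prop) hX, ofReal_integral_eq_lintegral_ofReal hint h]

lemma ae_V_nonneg (S : System N Ω P) (i : Fin N) : ∀ᵐ ω ∂P, 0 ≤ S.V i 0 ω := S.nonneg_prim _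

lemma ae_B_nonneg (S : System N Ω P) (i : Fin N) : ∀ᵐ ω ∂P, 0 ≤ S.B i 0 0 ω := S.nonneg_prim _

lemma ae_Cexcl_nonneg (S : System N Ω P) (i : Fin N) : ∀ᵐ ω ∂P, 0 ≤ S.Cexcl i 0 ω := by
  filter_upwards [S.ae_nonneg] with ω hω
  rw [Cexcl, C, sub_nonneg]
  have h := Finset.single_le_sum (f := fun j => S.V j 0 ω + S.D j 0 ω)
    (fun j _ => add_nonneg (hω.1 _ _) (hω.2.1 _ _)) (Finset.mem_univ i)
  linarith [hω.2.1 i 0]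

lemma integrable_min (S : System N Ω P) (i : Fin N) (hV : Integrable (S.V i 0) P) :
    Integrable (fun ω => min (S.B i 0 0 ω) (S.V i 0 ω)) P := by
  refine hV.mono ((S.measurable_B i 0 0).min (S.measurable_V i 0)).aestronglyMeasurable ?_
  filter_upwards [S.ae_V_nonneg i, S.ae_B_nonneg i] with ω h1 h2
  rw [Real.norm_of_nonneg (le_min h2 h1), Real.norm_of_nonneg h1]
  exact min_le_right _ _

lemma markLaw_compl_failSet (S : System N Ω P) (i : Fin N) :
    S.markLaw i failSetᶜ = ENNReal.ofReal (S.p i) := by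
  rw [← S.map_mark i 0 0, Measure.map_apply (S.measurable_mark i 0 0) measurableSet_failSet.compl,
    p, ofReal_measureReal]
  congr 1
  ext ω
  simp [failSet, mark]

lemma p_le_one (S : System N Ω P) (i : Fin N) : S.p i ≤ 1 := measureReal_le_one

lemma markLaw_failSet (S : System N Ω P) (i : Fin N) :
    S.markLaw i failSet = ENNReal.ofReal (1 - S.p i) := by
  have h := prob_compl_eq_one_sub (μ := S.markLaw i) measurableSet_failSet.compl
  rw [compl_compl, markLaw_compl_failSet, ← ENNReal.ofReal_one,
    ← ENNReal.ofReal_sub _ (show 0 ≤ S.p i from measureReal_nonneg)] at h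
  exact h

/-- The waiting reward is `min(B, V)` plus, on failure, `W`. As `W` is independent of `(V, B)`, the
second mean is the product `(1 - p) E W`. -/
lemma waitingMean_eq (S : System N Ω P) (i : Fin N) (hV : Integrable (S.V i 0) P)
    (hW : Integrable (S.Cexcl i 0) P) (hp : 0 < S.p i) :
    S.waitingMean i = ENNReal.ofReal (((∫ ω, min (S.B i 0 0 ω) (S.V i 0 ω) ∂P)
      + (1 - S.p i) * ∫ ω, S.Cexcl i 0 ω ∂P) / S.p i) := by
  have i1 := Measure.isProbabilityMeasure_map (μ := P) (S.measurable_V i 0).aemeasurable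
  have i2 := Measure.isProbabilityMeasure_map (μ := P) (S.measurable_Cexcl i 0).aemeasurable
  have i3 := Measure.isProbabilityMeasure_map (μ := P) (S.measurable_B i 0 0).aemeasurable
  have hβ : 0 ≤ ∫ ω, min (S.B i 0 0 ω) (S.V i 0 ω) ∂P := integral_nonneg_of_ae (by
    filter_upwards [S.ae_V_nonneg i, S.ae_B_nonneg i] with ω h1 h2 using le_min h2 h1)
  have hw : 0 ≤ ∫ ω, S.Cexcl i 0 ω ∂P := integral_nonneg_of_ae (S.ae_Cexcl_nonneg i)
  have hq : 0 ≤ 1 - S.p i := by linarith [S.p_le_one i]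
  have hf : Measurable (failSet.indicator (1 : (ℝ × ℝ) × ℝ → ℝ≥0∞)) :=
    measurable_one.indicator measurableSet_failSet
  rw [waitingMean, markLaw_compl_failSet, ENNReal.ofReal_div_of_pos hp]
  congr 1
  calc ∫⁻ z, waitingReward z ∂(S.markLaw i)
      = ∫⁻ z, (ENNReal.ofReal (min z.2 z.1.1)
          + failSet.indicator 1 z * ENNReal.ofReal z.1.2) ∂(S.markLaw i) := by
        refine lintegral_congr_ae ?_
        filter_upwards [S.ae_markLaw_nonneg i] with z hz
        rw [waitingReward]
        split_ifs with h
        · rw [Set.indicator_of_notMem (by simpa [failSet] using h), zero_mul, add_zero,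
            min_eq_left h]
        · rw [Set.indicator_of_mem (by simpa [failSet] using h), Pi.one_apply, one_mul,
            min_eq_right (not_le.mp h).le, ENNReal.ofReal_add hz.1 hz.2.1]
    _ = ∫⁻ z, ENNReal.ofReal (min z.2 z.1.1) ∂(S.markLaw i)
        + ∫⁻ z, failSet.indicator 1 z * ENNReal.ofReal z.1.2 ∂(S.markLaw i) :=
        lintegral_add_left (by fun_prop) _
    _ = ENNReal.ofReal (∫ ω, min (S.B i 0 0 ω) (S.V i 0 ω) ∂P)
        + ENNReal.ofReal (1 - S.p i) * ENNReal.ofReal (∫ ω, S.Cexcl i 0 ω ∂P) := by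
        congr 1
        · rw [← S.map_mark i 0 0, lintegral_map (by fun_prop) (S.measurable_mark i 0 0),
            ofReal_integral_eq_lintegral_ofReal (S.integrable_min i hV)]
          · rfl
          · filter_upwards [S.ae_V_nonneg i, S.ae_B_nonneg i] with ω h1 h2 using le_min h2 h1
        · have e : ∀ v w b : ℝ, failSet.indicator (1 : (ℝ × ℝ) × ℝ → ℝ≥0∞) ((v, w), b)
              = (Set.Ioi v).indicator 1 b := fun v w b => by
            by_cases h : v < b <;> simp [Set.indicator, failSet, h]
          rw [← markLaw_failSet, ← lintegral_indicator_one measurableSet_failSet,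
            S.lintegral_markLaw i hf,
            S.lintegral_markLaw i (f := fun z => failSet.indicator 1 z * ENNReal.ofReal z.1.2)
              (hf.mul (by fun_prop)),
            ← lintegral_map_ofReal (S.measurable_Cexcl i 0) (S.ae_Cexcl_nonneg i) hW]
          simp only [e, lintegral_indicator_one measurableSet_Ioi, lintegral_const, measure_univ,
            mul_one]
          have hanti : Antitone fun y => P.map (S.B i 0 0) (Set.Ioi y) := fun a b hab =>
            measure_mono (Set.Ioi_subset_Ioi hab)
          rw [← lintegral_mul_const _ hanti.measurable]
          refine lintegral_congr fun v => ?_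
          rw [← lintegral_const_mul _ (by fun_prop)]
          refine lintegral_congr fun w => ?_
          rw [lintegral_mul_const _ (measurable_one.indicator measurableSet_Ioi),
            lintegral_indicator_one measurableSet_Ioi]
    _ = _ := by
        rw [← ENNReal.ofReal_mul hq, ← ENNReal.ofReal_add hβ (mul_nonneg hq hw)]

lemma integral_map_V (S : System N Ω P) (i : Fin N) :
    ∫ x, x ∂(P.map (S.V i 0)) = ∫ ω, S.V i 0 ω ∂P :=
  integral_map (S.measurable_V i 0).aemeasurable aestronglyMeasurable_id

lemma isProbabilityMeasure_residualLaw_V (S : System N Ω P) (i : Fin N)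
    (hm : 0 < ∫ ω, S.V i 0 ω ∂P) : IsProbabilityMeasure (residualLaw (P.map (S.V i 0))) := by
  have i1 := Measure.isProbabilityMeasure_map (μ := P) (S.measurable_V i 0).aemeasurable
  exact isProbabilityMeasure_residualLaw _ (by rwa [integral_map_V])
    (ae_map_nonneg (S.measurable_V i 0) (S.ae_V_nonneg i))

lemma measurableSet_served : MeasurableSet {z : ℝ × ℝ | z.1 ≤ z.2} :=
  measurableSet_le (by fun_prop) (by fun_prop)

lemma compl_served : {z : ℝ × ℝ | z.1 ≤ z.2}ᶜ = {z | z.2 < z.1} := by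
  ext z; simp

/-- `V` is independent of `(W, B)`, so these two can be averaged first for a fixed remaining visit
time; averaging over the visit then replaces `V` by `V^res` at the price of a factor `E V`. -/
lemma cycleReward_eq_lintegral (S : System N Ω P) (i : Fin N) (hm : 0 < ∫ ω, S.V i 0 ω ∂P)
    (hW : Integrable (S.Cexcl i 0) P) (hW2 : Integrable (fun ω => S.Cexcl i 0 ω ^ 2) P) :
    S.cycleReward i = ENNReal.ofReal (∫ ω, S.V i 0 ω ∂P)
      * (∫⁻ z in {z | z.1 ≤ z.2}, ENNReal.ofReal z.1 ∂(S.serviceResidualLaw i)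
        + (∫⁻ z in {z | z.2 < z.1}, ENNReal.ofReal z.2 ∂(S.serviceResidualLaw i)
          + (ENNReal.ofReal (∫ ω, S.Cexcl i 0 ω ∂P) + S.waitingMean i)
            * S.serviceResidualLaw i {z | z.2 < z.1}))
      + (ENNReal.ofReal ((∫ ω, S.Cexcl i 0 ω ^ 2 ∂P) / 2)
        + S.waitingMean i * ENNReal.ofReal (∫ ω, S.Cexcl i 0 ω ∂P)) := by
  have i1 := Measure.isProbabilityMeasure_map (μ := P) (S.measurable_V i 0).aemeasurable
  have i2 := Measure.isProbabilityMeasure_map (μ := P) (S.measurable_Cexcl i 0).aemeasurable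
  have i3 := Measure.isProbabilityMeasure_map (μ := P) (S.measurable_B i 0 0).aemeasurable
  have i4 := S.isProbabilityMeasure_residualLaw_V i hm
  have hWnn := ae_map_nonneg (S.measurable_Cexcl i 0) (S.ae_Cexcl_nonneg i)
  have hWm := lintegral_map_ofReal (S.measurable_Cexcl i 0) (S.ae_Cexcl_nonneg i) hW
  have hW2m : ∫⁻ w, ENNReal.ofReal (w ^ 2 / 2) ∂(P.map (S.Cexcl i 0))
      = ENNReal.ofReal ((∫ ω, S.Cexcl i 0 ω ^ 2 ∂P) / 2) := by
    rw [lintegral_map (by fun_prop) (S.measurable_Cexcl i 0), ← integral_div,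
      ofReal_integral_eq_lintegral_ofReal (hW2.div_const 2) (ae_of_all _ fun ω => by positivity)]
  set κ := S.waitingMean i
  set μV := P.map (S.V i 0)
  set μW := P.map (S.Cexcl i 0)
  set μB := P.map (S.B i 0 0)
  have hR : Measurable fun q : ((ℝ × ℝ) × ℝ) × ℝ => residualReward κ q.1.1.2 q.1.2 q.2 :=
    (measurable_residualReward κ).comp
      (f := fun q : ((ℝ × ℝ) × ℝ) × ℝ => (q.1.1.2, q.1.2, q.2)) (by fun_prop)
  have hRi : Measurable fun z : (ℝ × ℝ) × ℝ => ∫⁻ y in Set.Ico 0 z.1.1,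
      residualReward κ z.1.2 z.2 y := by
    have h1 : MeasurableSet {q : ((ℝ × ℝ) × ℝ) × ℝ | 0 ≤ q.2} :=
      measurableSet_le (by fun_prop) (by fun_prop)
    have h2 : MeasurableSet {q : ((ℝ × ℝ) × ℝ) × ℝ | q.2 < q.1.1.1} :=
      measurableSet_lt (by fun_prop) (by fun_prop)
    have h4 := (hR.indicator (h1.inter h2)).lintegral_prod_right' (ν := volume)
    convert h4 using 2 with q
    rw [← lintegral_indicator measurableSet_Ico]
    rfl
  have hH : Measurable fun y => ∫⁻ w, ∫⁻ b, residualReward κ w b y ∂μB ∂μW := by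
    have h1 : Measurable fun q : (ℝ × ℝ) × ℝ => residualReward κ q.1.2 q.2 q.1.1 :=
      (measurable_residualReward κ).comp
        (f := fun q : (ℝ × ℝ) × ℝ => (q.1.2, q.2, q.1.1)) (by fun_prop)
    exact (h1.lintegral_prod_right' (ν := μB)).lintegral_prod_right' (ν := μW)
  calc S.cycleReward i
      = ∫⁻ z, ((∫⁻ y in Set.Ico 0 z.1.1, residualReward κ z.1.2 z.2 y)
          + (ENNReal.ofReal (z.1.2 ^ 2 / 2) + κ * ENNReal.ofReal z.1.2)) ∂(S.markLaw i) := by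
        refine lintegral_congr_ae ?_
        filter_upwards [S.ae_markLaw_nonneg i] with z hz
        exact lintegral_arrivalReward κ hz.1 hz.2.1 hz.2.2
    _ = ∫⁻ z, (∫⁻ y in Set.Ico 0 z.1.1, residualReward κ z.1.2 z.2 y) ∂(S.markLaw i)
          + ∫⁻ w, (ENNReal.ofReal (w ^ 2 / 2) + κ * ENNReal.ofReal w) ∂μW := by
        rw [lintegral_add_left hRi, S.lintegral_markLaw i (f := fun z =>
          ENNReal.ofReal (z.1.2 ^ 2 / 2) + κ * ENNReal.ofReal z.1.2) (by fun_prop)]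
        simp only [lintegral_const, measure_univ, mul_one]
        rfl
    _ = ∫⁻ v, (∫⁻ y in Set.Ico 0 v, ∫⁻ w, ∫⁻ b, residualReward κ w b y ∂μB ∂μW) ∂μV
          + (ENNReal.ofReal ((∫ ω, S.Cexcl i 0 ω ^ 2 ∂P) / 2)
            + κ * ENNReal.ofReal (∫ ω, S.Cexcl i 0 ω ∂P)) := by
        rw [lintegral_add_left (by fun_prop), lintegral_const_mul _ (by fun_prop), hWm, hW2m,
          S.lintegral_markLaw i hRi]
        congr 1
        refine lintegral_congr fun v => ?_
        have hyw : Measurable fun q : (ℝ × ℝ) × ℝ => residualReward κ q.1.1 q.2 q.1.2 :=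
          (measurable_residualReward κ).comp
            (f := fun q : (ℝ × ℝ) × ℝ => (q.1.1, q.2, q.1.2)) (by fun_prop)
        refine Eq.trans ?_ (lintegral_lintegral_swap
          (f := fun w y => ∫⁻ b, residualReward κ w b y ∂μB) (μ := μW)
          (hyw.lintegral_prod_right' (ν := μB)).aemeasurable)
        refine lintegral_congr fun w => ?_
        exact lintegral_lintegral_swap (μ := μB) (ν := volume.restrict (Set.Ico 0 v))
          (f := fun b y => residualReward κ w b y)
          ((measurable_residualReward κ).comp
            (f := fun q : ℝ × ℝ => (w, q.1, q.2)) (by fun_prop)).aemeasurable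
    _ = _ := by
        rw [lintegral_setLIntegral_Ico μV (by rwa [integral_map_V]) hH, integral_map_V]
        congr 2
        have hG : Measurable fun z : ℝ × ℝ => ∫⁻ w, residualReward κ w z.1 z.2 ∂μW :=
          ((measurable_residualReward κ).comp
            (f := fun q : (ℝ × ℝ) × ℝ => (q.2, q.1.1, q.1.2)) (by fun_prop)).lintegral_prod_right'
        -- Nonnegativity of the residual time is needed to split `ENNReal.ofReal (y + w)`
        -- additively.
        have hpos : ∀ᵐ z ∂(S.serviceResidualLaw i), 0 < z.2 :=
          Measure.quasiMeasurePreserving_snd.ae (ae_residualLaw_pos μV)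
        have hA := measurableSet_served
        calc ∫⁻ y, ∫⁻ w, ∫⁻ b, residualReward κ w b y ∂μB ∂μW ∂(residualLaw μV)
            = ∫⁻ y, ∫⁻ b, ∫⁻ w, residualReward κ w b y ∂μW ∂μB ∂(residualLaw μV) := by
              refine lintegral_congr fun y => ?_
              rw [lintegral_lintegral_swap]
              exact ((measurable_residualReward κ).comp
                (f := fun q : ℝ × ℝ => (q.1, q.2, y)) (by fun_prop)).aemeasurable
          _ = ∫⁻ z, ∫⁻ w, residualReward κ w z.1 z.2 ∂μW ∂(S.serviceResidualLaw i) :=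
              (lintegral_prod_symm _ hG.aemeasurable).symm
          _ = _ := by
              rw [← lintegral_add_compl _ hA, compl_served]
              congr 1
              · refine setLIntegral_congr_fun hA fun z hz => ?_
                simp only [residualReward, if_pos (show z.1 ≤ z.2 from hz)]
                simp
              · have hA' : MeasurableSet {z : ℝ × ℝ | z.2 < z.1} := by
                  rw [← compl_served]; exact hA.compl
                rw [← setLIntegral_const, ← lintegral_add_left (by fun_prop)]
                refine setLIntegral_congr_fun_ae hA' ?_
                filter_upwards [hpos] with z hz0 hz
                have hz' : ¬ z.1 ≤ z.2 := not_le.mpr hz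
                simp only [residualReward, if_neg hz']
                rw [lintegral_add_right _ measurable_const, ← hWm, ← add_assoc]
                congr 1
                · rw [lintegral_congr_ae (g := fun w => ENNReal.ofReal z.2 + ENNReal.ofReal w),
                    lintegral_add_left measurable_const]
                  · simp
                  · filter_upwards [hWnn] with w hw
                    exact ENNReal.ofReal_add hz0.le hw
                · simp

end System

/-! ### From extended nonnegative to real integrals. -/

lemma lintegral_ofReal_sq_ne_top {Ω : Type*} [MeasurableSpace Ω] {P : Measure Ω} {f : Ω → ℝ}
    (hf : MemLp f 2 P) : ∫⁻ ω, ENNReal.ofReal (f ω) ^ 2 ∂P ≠ ∞ := by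
  refine ne_top_of_le_ne_top hf.integrable_sq.lintegral_lt_top.ne (lintegral_mono fun ω => ?_)
  rcases le_total 0 (f ω) with h | h
  · rw [ENNReal.ofReal_pow h]
  · rw [ENNReal.ofReal_of_nonpos h]; simp

namespace System

variable {N : ℕ} {Ω : Type*} [MeasurableSpace Ω] {P : Measure Ω} [IsProbabilityMeasure P]

lemma memLp_C (S : System N Ω P) (hV2 : ∀ j, MemLp (S.V j 0) 2 P) (hD2 : ∀ j, MemLp (S.D j 0) 2 P) :
    MemLp (S.C 0) 2 P :=
  memLp_finsetSum _ fun j _ => (hV2 j).add (hD2 j)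

lemma memLp_Cexcl (S : System N Ω P) (i : Fin N) (hV2 : ∀ j, MemLp (S.V j 0) 2 P)
    (hD2 : ∀ j, MemLp (S.D j 0) 2 P) : MemLp (S.Cexcl i 0) 2 P :=
  (S.memLp_C hV2 hD2).sub (hV2 i)

lemma integral_C_pos (S : System N Ω P) (i : Fin N) (hV2 : ∀ j, MemLp (S.V j 0) 2 P)
    (hD2 : ∀ j, MemLp (S.D j 0) 2 P) (hV : 0 < ∫ ω, S.V i 0 ω ∂P)
    (hC : 0 < ∫ ω, S.Cexcl i 0 ω ∂P) : 0 < ∫ ω, S.C 0 ω ∂P := by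
  have h : ∫ ω, S.C 0 ω ∂P = ∫ ω, S.V i 0 ω ∂P + ∫ ω, S.Cexcl i 0 ω ∂P := by
    rw [← integral_add ((hV2 i).integrable one_le_two)
      ((S.memLp_Cexcl i hV2 hD2).integrable one_le_two)]
    simp [Cexcl]
  rw [h]
  exact add_pos hV hC

lemma memLp_pollTime_zero (S : System N Ω P) (i : Fin N) (hV2 : ∀ j, MemLp (S.V j 0) 2 P)
    (hD2 : ∀ j, MemLp (S.D j 0) 2 P) : MemLp (S.pollTime i 0) 2 P := by
  have h : S.pollTime i 0 = fun ω => ∑ j ∈ Finset.Iio i, (S.V j 0 ω + S.D j 0 ω) := by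
    ext ω; simp [pollTime]
  rw [h]
  exact memLp_finsetSum _ fun j _ => (hV2 j).add (hD2 j)

/-- The interval between two polls of queue `i` mixes variables of two cycles, but has the law of
`C`. -/
lemma lintegral_markLaw_length (S : System N Ω P) (i : Fin N) {f : ℝ → ℝ≥0∞} (hf : Measurable f) :
    ∫⁻ z, f (z.1.1 + z.1.2) ∂(S.markLaw i) = ∫⁻ ω, f (S.C 0 ω) ∂P := by
  have hlen : Measurable fun z : ℝ × ℝ => f (z.1 + z.2) := by fun_prop
  have h1 : ∫⁻ z, f (z.1.1 + z.1.2) ∂(S.markLaw i)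
      = ∫⁻ ω, f (S.V i 0 ω + S.away i 0 ω) ∂P := by
    rw [← S.map_mark i 0 0, lintegral_map (by fun_prop) (S.measurable_mark i 0 0)]
    rfl
  have hid := (S.identDistrib_visit_away i 0).comp hlen
  rw [h1]
  refine (hid.lintegral_eq).trans (lintegral_congr fun ω => ?_)
  simp [Cexcl]

/-- The mean sojourn time in terms of the moments of the model. -/
theorem hasMeanSojournTime (S : System N Ω P) (i : Fin N)
    (hV2 : ∀ j, MemLp (S.V j 0) 2 P) (hD2 : ∀ j, MemLp (S.D j 0) 2 P)
    (hV : 0 < ∫ ω, S.V i 0 ω ∂P) (hC : 0 < ∫ ω, S.Cexcl i 0 ω ∂P) (hp : 0 < S.p i) :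
    S.HasMeanSojournTime i
      (((∫ ω, S.V i 0 ω ∂P) * ((∫ z in {z | z.1 ≤ z.2}, z.1 ∂(S.serviceResidualLaw i))
          + ((∫ z in {z | z.2 < z.1}, z.2 ∂(S.serviceResidualLaw i))
          + ((∫ ω, S.Cexcl i 0 ω ∂P) + ((∫ ω, min (S.B i 0 0 ω) (S.V i 0 ω) ∂P)
            + (1 - S.p i) * ∫ ω, S.Cexcl i 0 ω ∂P) / S.p i)
              * (S.serviceResidualLaw i).real {z | z.2 < z.1}))
        + ((∫ ω, S.Cexcl i 0 ω ^ 2 ∂P) / 2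
          + ((∫ ω, min (S.B i 0 0 ω) (S.V i 0 ω) ∂P)
            + (1 - S.p i) * ∫ ω, S.Cexcl i 0 ω ∂P) / S.p i * ∫ ω, S.Cexcl i 0 ω ∂P))
        / ∫ ω, S.C 0 ω ∂P)
    ∧ Integrable (fun z => z.1) ((S.serviceResidualLaw i).restrict {z | z.1 ≤ z.2})
    ∧ Integrable (fun z => z.2) ((S.serviceResidualLaw i).restrict {z | z.2 < z.1}) := by
  have i1 := Measure.isProbabilityMeasure_map (μ := P) (S.measurable_V i 0).aemeasurable
  have i3 := Measure.isProbabilityMeasure_map (μ := P) (S.measurable_B i 0 0).aemeasurable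
  have i4 := S.isProbabilityMeasure_residualLaw_V i hV
  have i5 : IsProbabilityMeasure (S.serviceResidualLaw i) := by
    unfold serviceResidualLaw; infer_instance
  have hCL := S.memLp_C hV2 hD2
  have hWL := S.memLp_Cexcl i hV2 hD2
  have hVi : Integrable (S.V i 0) P := (hV2 i).integrable one_le_two
  have hWi : Integrable (S.Cexcl i 0) P := hWL.integrable one_le_two
  have hCi : Integrable (S.C 0) P := hCL.integrable one_le_two
  have hECpos := S.integral_C_pos i hV2 hD2 hV hC
  have hC0 : ∀ᵐ ω ∂P, 0 ≤ S.C 0 ω := by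
    filter_upwards [S.ae_nonneg] with ω hω
    exact Finset.sum_nonneg fun j _ => add_nonneg (hω.1 _ _) (hω.2.1 _ _)
  have hc : ∫⁻ z, ENNReal.ofReal (z.1.1 + z.1.2) ∂(S.markLaw i)
      = ENNReal.ofReal (∫ ω, S.C 0 ω ∂P) := by
    rw [S.lintegral_markLaw_length i (f := ENNReal.ofReal) (by fun_prop),
      ofReal_integral_eq_lintegral_ofReal hCi hC0]
  have hc0 : ∫⁻ z, ENNReal.ofReal (z.1.1 + z.1.2) ∂(S.markLaw i) ≠ 0 := by
    rw [hc]; simpa using hECpos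
  have hct : ∫⁻ z, ENNReal.ofReal (z.1.1 + z.1.2) ∂(S.markLaw i) ≠ ∞ := by
    rw [hc]; exact ENNReal.ofReal_ne_top
  have hc2 : ∫⁻ z, ENNReal.ofReal (z.1.1 + z.1.2) ^ 2 ∂(S.markLaw i) ≠ ∞ := by
    rw [S.lintegral_markLaw_length i (f := fun x => ENNReal.ofReal x ^ 2) (by fun_prop)]
    exact lintegral_ofReal_sq_ne_top hCL
  have hτ2 := lintegral_ofReal_sq_ne_top (S.memLp_pollTime_zero i hV2 hD2)
  have hp' : S.markLaw i failSetᶜ ≠ 0 := by rw [markLaw_compl_failSet]; simpa using hp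
  have hlim := S.tendsto_average_sojournTime i hc0 hct hc2 hτ2 hp'
  have hfin := S.cycleReward_ne_top i hc2 (S.waitingMean_ne_top i hct hp')
  have hform := S.cycleReward_eq_lintegral i hV hWi hWL.integrable_sq
  have hκ := S.waitingMean_eq i hVi hWi hp
  have hβ : 0 ≤ ∫ ω, min (S.B i 0 0 ω) (S.V i 0 ω) ∂P := integral_nonneg_of_ae (by
    filter_upwards [S.ae_V_nonneg i, S.ae_B_nonneg i] with ω h1 h2 using le_min h2 h1)
  have hq : 0 ≤ 1 - S.p i := by linarith [S.p_le_one i]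
  have hW2 : 0 ≤ ∫ ω, S.Cexcl i 0 ω ^ 2 ∂P := integral_nonneg fun ω => by positivity
  have hκ0 : 0 ≤ ((∫ ω, min (S.B i 0 0 ω) (S.V i 0 ω) ∂P)
            + (1 - S.p i) * ∫ ω, S.Cexcl i 0 ω ∂P) / S.p i := by positivity
  have hpos2 : ∀ᵐ z ∂(S.serviceResidualLaw i), 0 ≤ z.2 :=
    Measure.quasiMeasurePreserving_snd.ae ((ae_residualLaw_pos _).mono fun _ h => h.le)
  have hpos1 : ∀ᵐ z ∂(S.serviceResidualLaw i), 0 ≤ z.1 :=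
    Measure.quasiMeasurePreserving_fst.ae (ae_map_nonneg (S.measurable_B i 0 0) (S.ae_B_nonneg i))
  rw [hform] at hfin
  have hVne : ENNReal.ofReal (∫ ω, S.V i 0 ω ∂P) ≠ 0 := by simpa using hV
  -- No moment of `B` is assumed. Integrability of the truncated variables is read off from the
  -- finiteness of the cycle reward, using `E V ≠ 0`.
  have hf2 := ENNReal.lt_top_of_mul_ne_top_right (ENNReal.add_ne_top.mp hfin).1 hVne
  obtain ⟨hf3, hf4⟩ := ENNReal.add_ne_top.mp hf2.ne
  have hf5 := (ENNReal.add_ne_top.mp hf4).1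
  have hint1 : Integrable (fun z : ℝ × ℝ => z.1)
      ((S.serviceResidualLaw i).restrict {z | z.1 ≤ z.2}) :=
    (lintegral_ofReal_ne_top_iff_integrable (by fun_prop) (ae_restrict_of_ae hpos1)).mp hf3
  have hint2 : Integrable (fun z : ℝ × ℝ => z.2)
      ((S.serviceResidualLaw i).restrict {z | z.2 < z.1}) :=
    (lintegral_ofReal_ne_top_iff_integrable (by fun_prop) (ae_restrict_of_ae hpos2)).mp hf5
  refine ⟨?_, hint1, hint2⟩
  rw [hform, hc, hκ, ← ofReal_integral_eq_lintegral_ofReal hint1 (ae_restrict_of_ae hpos1),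
    ← ofReal_integral_eq_lintegral_ofReal hint2 (ae_restrict_of_ae hpos2),
    ← ofReal_measureReal (s := {z : ℝ × ℝ | z.2 < z.1})] at hlim
  have hE1 : 0 ≤ ∫ z in {z | z.1 ≤ z.2}, z.1 ∂(S.serviceResidualLaw i) :=
    integral_nonneg_of_ae (ae_restrict_of_ae hpos1)
  have hE2 : 0 ≤ ∫ z in {z | z.2 < z.1}, z.2 ∂(S.serviceResidualLaw i) :=
    integral_nonneg_of_ae (ae_restrict_of_ae hpos2)
  have hρ : 0 ≤ (S.serviceResidualLaw i).real {z | z.2 < z.1} := measureReal_nonneg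
  unfold HasMeanSojournTime
  rw [ENNReal.ofReal_div_of_pos hECpos, ENNReal.ofReal_add (by positivity) (by positivity),
    ENNReal.ofReal_mul hV.le, ENNReal.ofReal_add hE1 (by positivity),
    ENNReal.ofReal_add hE2 (by positivity), ENNReal.ofReal_mul (by positivity),
    ENNReal.ofReal_add hC.le hκ0, ENNReal.ofReal_add (by positivity) (by positivity),
    ENNReal.ofReal_mul hκ0]
  exact hlim

end System

/-! ### Exponential laws. -/

lemma expMeasure_ae_nonneg {r : ℝ} (hr : 0 < r) : ∀ᵐ x ∂(expMeasure r), 0 ≤ x := by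
  have := isProbabilityMeasure_expMeasure hr
  have h : expMeasure r (Set.Ici 0) = 1 := by rw [expMeasure_Ici hr le_rfl]; simp
  exact (prob_compl_eq_zero_iff measurableSet_Ici).mpr h

lemma integral_expMeasure {r : ℝ} (hr : 0 < r) : ∫ x, x ∂(expMeasure r) = 1 / r := by
  have := isProbabilityMeasure_expMeasure hr
  have h := lintegral_expMeasure hr (g := fun _ => 1) measurable_const
  have h0 : 0 ≤ᵐ[expMeasure r] fun x => x := expMeasure_ae_nonneg hr
  simp only [lintegral_const, measure_univ, mul_one, Measure.restrict_apply, MeasurableSet.univ,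
    Set.univ_inter, Real.volume_Ioc, sub_zero, one_mul] at h
  rw [integral_eq_lintegral_of_nonneg_ae h0 (by fun_prop), eq_div_iff hr.ne', mul_comm]
  have h2 := congrArg ENNReal.toReal h
  rw [ENNReal.toReal_mul, ENNReal.toReal_ofReal hr.le] at h2
  exact h2.symm

/-- Exponential laws are memoryless. -/
lemma residualLaw_expMeasure {r : ℝ} (hr : 0 < r) : residualLaw (expMeasure r) = expMeasure r := by
  have := isProbabilityMeasure_expMeasure hr
  have h : expMeasure r = volume.withDensity (exponentialPDF r) := rfl
  rw [residualLaw, ← withDensity_indicator measurableSet_Ioi]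
  conv_rhs => rw [h]
  refine withDensity_congr_ae ?_
  have h0 : ∀ᵐ x : ℝ, x ≠ 0 := by simp [ae_iff]
  filter_upwards [h0] with x hx
  rcases lt_or_gt_of_ne hx with hx | hx
  · rw [exponentialPDF_of_neg hx, Set.indicator_of_notMem (by simp [hx.le])]
  · rw [exponentialPDF_of_nonneg hx.le, Set.indicator_of_mem (by exact hx), integral_expMeasure hr,
      measureReal_congr Ioi_ae_eq_Ici, measureReal_def, expMeasure_Ici hr hx.le,
      ENNReal.toReal_ofReal (Real.exp_pos _).le]
    congr 1
    field_simp

/-- The compensator identity with `g` the indicator of `x ≤ y`: the integral of `g` over `(0, e]` is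
`min(e, y)`. Agreement of the sections up to null sets suffices, so strict and non-strict
comparisons are covered together. -/
lemma expMeasure_prod_apply {r : ℝ} (hr : 0 < r) (ν : Measure ℝ) [IsProbabilityMeasure ν]
    (h0 : ∀ᵐ y ∂ν, 0 ≤ y) {A : Set (ℝ × ℝ)} (hA : MeasurableSet A)
    (hAy : ∀ y, (fun x => (x, y)) ⁻¹' A =ᵐ[volume] Set.Iic y) :
    (expMeasure r).prod ν A
      = ENNReal.ofReal r * ∫⁻ z, ENNReal.ofReal (min z.1 z.2) ∂((expMeasure r).prod ν) := by
  have := isProbabilityMeasure_expMeasure hr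
  have hpre : ∀ y, MeasurableSet ((fun x => (x, y)) ⁻¹' A) := fun y => measurable_prodMk_right hA
  rw [Measure.prod_apply_symm hA, lintegral_prod_symm _ (by fun_prop),
    ← lintegral_const_mul' _ _ ENNReal.ofReal_ne_top]
  refine lintegral_congr_ae ?_
  filter_upwards [h0] with y hy
  have h := lintegral_expMeasure hr
    (g := ((fun x => (x, y)) ⁻¹' A).indicator 1) (measurable_one.indicator (hpre y))
  rw [lintegral_indicator_one (hpre y)] at h
  rw [h]
  congr 1
  refine lintegral_congr fun e => ?_
  rw [lintegral_indicator_one (hpre y), measure_congr (ae_restrict_of_ae (hAy y)),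
    Measure.restrict_apply measurableSet_Iic,
    Set.inter_comm, Set.Ioc_inter_Iic, Real.volume_Ioc, sub_zero]

lemma expMeasure_prod_le {r : ℝ} (hr : 0 < r) (ν : Measure ℝ) [IsProbabilityMeasure ν]
    (h0 : ∀ᵐ y ∂ν, 0 ≤ y) :
    (expMeasure r).prod ν {z | z.1 ≤ z.2}
      = ENNReal.ofReal r * ∫⁻ z, ENNReal.ofReal (min z.1 z.2) ∂((expMeasure r).prod ν) :=
  expMeasure_prod_apply hr ν h0 (measurableSet_le measurable_fst measurable_snd)
    fun _ => Filter.EventuallyEq.rfl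

lemma expMeasure_prod_lt {r : ℝ} (hr : 0 < r) (ν : Measure ℝ) [IsProbabilityMeasure ν]
    (h0 : ∀ᵐ y ∂ν, 0 ≤ y) :
    (expMeasure r).prod ν {z | z.1 < z.2}
      = ENNReal.ofReal r * ∫⁻ z, ENNReal.ofReal (min z.1 z.2) ∂((expMeasure r).prod ν) :=
  expMeasure_prod_apply hr ν h0 (measurableSet_lt measurable_fst measurable_snd)
    fun _ => Iio_ae_eq_Iic

lemma expMeasure_prod_swap_lt {μ γ : ℝ} (hμ : 0 < μ) (hγ : 0 < γ) :
    (expMeasure μ).prod (expMeasure γ) {z | z.2 < z.1} = ENNReal.ofReal γ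
      * ∫⁻ z, ENNReal.ofReal (min z.1 z.2) ∂((expMeasure μ).prod (expMeasure γ)) := by
  have := isProbabilityMeasure_expMeasure hμ
  have := isProbabilityMeasure_expMeasure hγ
  have h := expMeasure_prod_lt hγ (expMeasure μ) (expMeasure_ae_nonneg hμ)
  rw [← Measure.prod_swap, Measure.map_apply measurable_swap
    (measurableSet_lt measurable_snd measurable_fst), lintegral_map (by fun_prop) measurable_swap]
  simp_rw [Prod.fst_swap, Prod.snd_swap, min_comm (Prod.snd _)]
  exact h

namespace System

variable {N : ℕ} {Ω : Type*} [MeasurableSpace Ω] {P : Measure Ω} [IsProbabilityMeasure P]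

lemma indepFun_B_V (S : System N Ω P) (i : Fin N) : IndepFun (S.B i 0 0) (S.V i 0) P :=
  S.indepFun_of_sigma (A := {.service i 0 0}) (B := {.visit i 0}) (by simp)
    (S.measurable_prim_sigma rfl) (S.measurable_prim_sigma rfl)

lemma map_B_V (S : System N Ω P) (i : Fin N) :
    P.map (fun ω => (S.B i 0 0 ω, S.V i 0 ω)) = (P.map (S.B i 0 0)).prod (P.map (S.V i 0)) :=
  (indepFun_iff_map_prod_eq_prod_map_map (S.measurable_B i 0 0).aemeasurable
    (S.measurable_V i 0).aemeasurable).mp (S.indepFun_B_V i)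

end System

end Polling

end

/-! ### The mean sojourn time: general formula and exponential case. -/

theorem mainTheorem5 {N : ℕ} (hN : 2 ≤ N) {Ω : Type*} [MeasurableSpace Ω] (P : Measure Ω)
    [IsProbabilityMeasure P] (S : Polling.System N Ω P) (i : Fin N)
    (hV2 : ∀ j, MemLp (S.V j 0) 2 P) (hD2 : ∀ j, MemLp (S.D j 0) 2 P)
    (hV : 0 < ∫ ω, S.V i 0 ω ∂P) (hC : 0 < ∫ ω, S.Cexcl i 0 ω ∂P) (hp : 0 < S.p i) :
    -- the general formula; `z.1` is `B_i` and `z.2` is `V_i^res`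
    S.HasMeanSojournTime i
      ((∫ ω, S.V i 0 ω ∂P) / (∫ ω, S.C 0 ω ∂P)
          * (S.serviceResidualLaw i).real {z | z.1 ≤ z.2}
          * (∫ z, z.1 ∂((S.serviceResidualLaw i)[|{z | z.1 ≤ z.2}]))
        + (∫ ω, S.V i 0 ω ∂P) / (∫ ω, S.C 0 ω ∂P)
          * (S.serviceResidualLaw i).real {z | z.2 < z.1}
          * ((∫ z, z.2 ∂((S.serviceResidualLaw i)[|{z | z.2 < z.1}]))
            + (∫ n : ℕ, ((n : ℝ) + 1) ∂(Polling.geometricLaw (S.p i)))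
              * ((∫ ω, S.Cexcl i 0 ω ∂P) + ∫ ω, min (S.B i 0 0 ω) (S.V i 0 ω) ∂P))
        + (∫ ω, S.Cexcl i 0 ω ∂P) / (∫ ω, S.C 0 ω ∂P)
          * ((∫ ω, S.Cexcl i 0 ω ^ 2 ∂P) / (2 * ∫ ω, S.Cexcl i 0 ω ∂P)
            + (∫ n : ℕ, (n : ℝ) ∂(Polling.geometricLaw (S.p i))) * (∫ ω, S.Cexcl i 0 ω ∂P)
            + (∫ n : ℕ, ((n : ℝ) + 1) ∂(Polling.geometricLaw (S.p i)))
              * ∫ ω, min (S.B i 0 0 ω) (S.V i 0 ω) ∂P))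
    ∧ -- exponential service times (rate `μ`) and visit times (rate `γ`) at queue `i`
    ∀ μ γ : ℝ, 0 < μ → 0 < γ →
      P.map (S.B i 0 0) = expMeasure μ → P.map (S.V i 0) = expMeasure γ →
      S.HasMeanSojournTime i
        ((γ * (∫ ω, S.Cexcl i 0 ω ∂P) + 1) ^ 2 / (γ * μ * ∫ ω, S.C 0 ω ∂P)
          + (∫ ω, S.Cexcl i 0 ω ^ 2 ∂P) / (2 * ∫ ω, S.C 0 ω ∂P)) := by
  obtain ⟨hS, hint1, hint2⟩ := S.hasMeanSojournTime i hV2 hD2 hV hC hp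
  have i3 := Measure.isProbabilityMeasure_map (μ := P) (S.measurable_B i 0 0).aemeasurable
  have i4 := S.isProbabilityMeasure_residualLaw_V i hV
  have i5 : IsProbabilityMeasure (S.serviceResidualLaw i) := by
    unfold Polling.System.serviceResidualLaw; infer_instance
  have hECpos := S.integral_C_pos i hV2 hD2 hV hC
  refine ⟨?_, fun μ γ hμ hγ hB hV' => ?_⟩
  · convert hS using 1
    rw [mul_assoc, Polling.measureReal_mul_integral_cond, mul_assoc _ (Measure.real _ _),
      mul_add (Measure.real _ _),
      Polling.measureReal_mul_integral_cond, Polling.integral_geometricLaw hp (S.p_le_one i),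
      Polling.integral_succ_geometricLaw hp (S.p_le_one i)]
    field_simp
    ring
  · have hρ : S.serviceResidualLaw i = (expMeasure μ).prod (expMeasure γ) := by
      rw [Polling.System.serviceResidualLaw, hB, hV', Polling.residualLaw_expMeasure hγ]
    -- By memorylessness `(B, V^res)` has the law of `(B, V)`, so residual probabilities become `p`
    -- and `1 - p`.
    have hmap : P.map (fun ω => (S.B i 0 0 ω, S.V i 0 ω)) = S.serviceResidualLaw i := by
      rw [S.map_B_V, hρ, hB, hV']
    have hA : MeasurableSet {z : ℝ × ℝ | z.1 ≤ z.2} :=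
      measurableSet_le measurable_fst measurable_snd
    have hcompl : {z : ℝ × ℝ | z.1 ≤ z.2}ᶜ = {z | z.2 < z.1} := by ext; simp
    have hBV : Measurable fun ω => (S.B i 0 0 ω, S.V i 0 ω) :=
      (S.measurable_B i 0 0).prodMk (S.measurable_V i 0)
    have hp1 : S.p i = (S.serviceResidualLaw i).real {z | z.1 ≤ z.2} := by
      rw [← hmap, map_measureReal_apply hBV hA]; rfl
    have hq : 1 - S.p i = (S.serviceResidualLaw i).real {z | z.2 < z.1} := by
      rw [hp1, ← hcompl, probReal_compl_eq_one_sub hA]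
    have hβ : ∫ ω, min (S.B i 0 0 ω) (S.V i 0 ω) ∂P
        = ∫ z, min z.1 z.2 ∂(S.serviceResidualLaw i) := by
      rw [← hmap, integral_map hBV.aemeasurable (by fun_prop)]
    have hmin0 : ∀ᵐ z ∂(S.serviceResidualLaw i), 0 ≤ min z.1 z.2 := by
      rw [← hmap, ae_map_iff hBV.aemeasurable (measurableSet_le measurable_const (by fun_prop))]
      filter_upwards [S.ae_B_nonneg i, S.ae_V_nonneg i] with ω h1 h2 using le_min h1 h2
    have hlint : ∫⁻ z, ENNReal.ofReal (min z.1 z.2) ∂(S.serviceResidualLaw i)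
        = ENNReal.ofReal (∫ ω, min (S.B i 0 0 ω) (S.V i 0 ω) ∂P) := by
      have hi : Integrable (fun z => min z.1 z.2) (S.serviceResidualLaw i) := by
        rw [← hmap, integrable_map_measure (by fun_prop) hBV.aemeasurable]
        exact S.integrable_min i ((hV2 i).integrable one_le_two)
      rw [hβ, ofReal_integral_eq_lintegral_ofReal hi hmin0]
    have hβ0 : 0 ≤ ∫ ω, min (S.B i 0 0 ω) (S.V i 0 ω) ∂P := by
      rw [hβ]; exact integral_nonneg_of_ae hmin0
    have i6 := isProbabilityMeasure_expMeasure hγ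
    have e1 : S.p i = μ * ∫ ω, min (S.B i 0 0 ω) (S.V i 0 ω) ∂P := by
      have h := Polling.expMeasure_prod_le hμ (expMeasure γ) (Polling.expMeasure_ae_nonneg hγ)
      rw [← hρ, hlint, ← ENNReal.ofReal_mul hμ.le] at h
      rw [hp1, measureReal_def, h, ENNReal.toReal_ofReal (by positivity)]
    have e2 : 1 - S.p i = γ * ∫ ω, min (S.B i 0 0 ω) (S.V i 0 ω) ∂P := by
      have h := Polling.expMeasure_prod_swap_lt hμ hγ
      rw [← hρ, hlint, ← ENNReal.ofReal_mul hγ.le] at h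
      rw [hq, measureReal_def, h, ENNReal.toReal_ofReal (by positivity)]
    have e3 : (∫ z in {z | z.1 ≤ z.2}, z.1 ∂(S.serviceResidualLaw i))
        + ∫ z in {z | z.2 < z.1}, z.2 ∂(S.serviceResidualLaw i)
        = ∫ ω, min (S.B i 0 0 ω) (S.V i 0 ω) ∂P := by
      have hmin1 : Set.EqOn (fun z : ℝ × ℝ => z.1) (fun z => min z.1 z.2) {z | z.1 ≤ z.2} :=
        fun z hz => (min_eq_left hz).symm
      have hmin2 : Set.EqOn (fun z : ℝ × ℝ => z.2) (fun z => min z.1 z.2) {z | z.2 < z.1} :=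
        fun z hz => (min_eq_right (le_of_lt hz)).symm
      have hA' : MeasurableSet {z : ℝ × ℝ | z.2 < z.1} := hcompl ▸ hA.compl
      have hi1 : IntegrableOn (fun z => min z.1 z.2) {z | z.1 ≤ z.2} (S.serviceResidualLaw i) :=
        IntegrableOn.congr_fun hint1 hmin1 hA
      have hi2 : IntegrableOn (fun z => min z.1 z.2) {z | z.2 < z.1} (S.serviceResidualLaw i) :=
        IntegrableOn.congr_fun hint2 hmin2 hA'
      have hi : Integrable (fun z => min z.1 z.2) (S.serviceResidualLaw i) := by
        rw [← integrableOn_univ, ← Set.union_compl_self {z : ℝ × ℝ | z.1 ≤ z.2}, hcompl]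
        exact hi1.union hi2
      rw [setIntegral_congr_fun hA hmin1, setIntegral_congr_fun hA' hmin2, hβ, ← hcompl,
        integral_add_compl hA hi]
    have e4 : ∫ ω, S.V i 0 ω ∂P = 1 / γ := by
      rw [← Polling.integral_expMeasure hγ, ← hV', S.integral_map_V]
    -- The two truncated means enter only through their sum `β`; one is eliminated so that the other
    -- cancels.
    rw [← hq, eq_sub_of_add_eq e3, e4, e2, e1] at hS
    -- Adding `p = μ β` and `1 - p = γ β`. Then `κ = (1 + γ E W) / μ`, and a factor `1 + γ E W`
    -- splits off twice, which produces the square.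
    have hβγ : (μ + γ) * ∫ ω, min (S.B i 0 0 ω) (S.V i 0 ω) ∂P = 1 := by linarith
    have hβ1 : ∫ ω, min (S.B i 0 0 ω) (S.V i 0 ω) ∂P = 1 / (μ + γ) := by
      rw [eq_div_iff (by positivity), mul_comm]; exact hβγ
    rw [hβ1] at hS
    convert hS using 1
    field_simp
    ring
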